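/- **Setting.** Let $S^1=\mathbb R/2\pi\mathbb Z$, and $Q=Q_0=(S^1)^3$. All mappings are $C^\infty$. Let $\mathcal L(\boldsymbol u,\rho,\nabla\rho)$ be a smooth real function of $\boldsymbol u\in\mathbb R^3$, $\rho>0$, $\nabla\rho\in\mathbb R^3$ such that $\boldsymbol u\mapsto\partial\mathcal L/\partial\boldsymbol u$ is a diffeomorphism of $\mathbb R^3$ for each $(\rho,\nabla\rho)$, and let $$\mathcal H(\boldsymbol p,\rho,\nabla\rho)=\boldsymbol u\cdot\boldsymbol p-\mathcal L(\boldsymbol u,\rho,\nabla\rho),\qquad \text{where } \boldsymbol u \text{ is determined by } \frac{\partial\mathcal L}{\partial\boldsymbol u}(\boldsymbol u,\rho,\nabla\rho)=\boldsymbol p .$$ Let $\ell\mathcal C_0$ be the set of smooth maps $(\boldsymbol x,\theta)\mapsto(\tilde{\boldsymbol h},\tilde{\boldsymbol p},\tilde\rho,\tilde\chi)\in Q_0\times\mathbb R^3\times\mathbb R\times\mathbb R$ on $Q\times S^1$ such that $\boldsymbol x\mapsto\tilde{\boldsymbol h}(\boldsymbol x,\theta)$ is a diffeomorphism $Q\to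 Q_0$ for each $\theta$, and $\tilde\rho>0$. For a phase function $S$ with values in $S^1$ write $\partial_t^S=\partial_t+\partial_tS\,\partial_\theta$ and $\nabla^S=\nabla+\nabla S\,\partial_\theta$; for a tensor, $(\nabla\cdot T)_j=\partial_iT_{ij}$, and $(\nabla^S\tilde{\boldsymbol h})_{ij}=\partial_i\tilde h_j+\partial_iS\,\partial_\theta\tilde h_j$. The Lagrangian is $$\widetilde{\mathsf L}=\frac1{2\pi}\int_0^{2\pi}\!\int_Q\Big(\tilde{\boldsymbol p}\cdot\tilde{\boldsymbol v}+\tilde\rho\,\dot{\tilde\chi}+\tilde\rho\,\dot S\,\partial_\theta\tilde\chi+\tilde\rho\,\tilde{\boldsymbol v}\cdot\nabla^S\tilde\chi-\mathcal H(\tilde{\boldsymbol p},\tilde\rho,\nabla^S\tilde\rho)\Big)d^3\boldsymbol x\,d\theta,\qquad \tilde{\boldsymbol v}=-(\dot{\tilde{\boldsymbol h}}+\dot S\,\partial_\theta\tilde{\boldsymbol h})\cdot(\nabla^S\tilde{\boldsymbol h})^{-1}.$$ **Theorem 3.** Let $t_1<t_2$ and let $\gamma=(\tilde{\boldsymbol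 h},\tilde{\boldsymbol p},\tilde\rho,\tilde\chi,S):[t_1,t_2]\to\ell\mathcal C_0\times C^\infty(Q,S^1)$ be a smooth curve along which the matrix $\nabla^S\tilde{\boldsymbol h}$ is everywhere invertible (so that $\tilde{\boldsymbol v}$ is defined). Then $\gamma$ is a critical point of $$\widetilde{\mathsf A}(\gamma)=\int_{t_1}^{t_2}\widetilde{\mathsf L}(\gamma(t),\partial_t\gamma(t))\,dt$$ with respect to smooth variations of all five fields that fix both endpoints $\gamma(t_1),\gamma(t_2)$, if and only if on $[t_1,t_2]\times Q\times S^1$ $$\partial_t^S\tilde{\boldsymbol h}=-\frac{\partial\mathcal H}{\partial\boldsymbol p}\cdot\nabla^S\tilde{\boldsymbol h},$$ $$\partial_t^S\tilde{\boldsymbol p}+\nabla^S\cdot\Big(\frac{\partial\mathcal H}{\partial\boldsymbol p}\otimes\tilde{\boldsymbol p}+\frac{\partial\mathcal H}{\partial\nabla\rho}\otimes\nabla^S\tilde\rho\Big)=-\nabla^S\Big(\tilde\rho\frac{\partial\mathcal H}{\partial\rho}-\tilde\rho\,\nabla^S\cdot\frac{\partial\mathcal H}{\partial\nabla\rho}+\tilde{\boldsymbol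 p}\cdot\frac{\partial\mathcal H}{\partial\boldsymbol p}-\mathcal H\Big),$$ $$\partial_t^S\tilde\rho+\nabla^S\cdot\Big(\tilde\rho\frac{\partial\mathcal H}{\partial\boldsymbol p}\Big)=0,$$ $$\partial_t^S\tilde\chi+\frac{\partial\mathcal H}{\partial\boldsymbol p}\cdot\nabla^S\tilde\chi=\frac{\partial\mathcal H}{\partial\rho}-\nabla^S\cdot\frac{\partial\mathcal H}{\partial\nabla\rho},$$ where $\mathcal H$ and its derivatives are evaluated at $(\tilde{\boldsymbol p},\tilde\rho,\nabla^S\tilde\rho)$. -/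

import Mathlib

open scoped ContDiff

namespace ExtLBEP

noncomputable section

/-- Vectors with three real components: coordinates on (the universal cover of) the fluid container
`Q` and the label space `Q₀`, both equal to the torus `(ℝ / 2πℤ)³`; also velocities, momenta. -/
abbrev Vec3 := Fin 3 → ℝ

/-- The lattice vector `2π k`. -/
def lat (k : Fin 3 → ℤ) : Vec3 := fun i => 2 * Real.pi * (k i : ℝ)

/-- The gradient of a real-valued function on `ℝ³`. -/
def grad (f : Vec3 → ℝ) (x : Vec3) : Vec3 := fun i => fderiv ℝ f x (Pi.single i 1)

/-! ### The Euler-Poincaré Lagrange density and the Hamiltonian density -/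

/-- `f : ℝ³ → ℝ³` is a (smooth) diffeomorphism. -/
def IsDiffeo (f : Vec3 → Vec3) : Prop :=
  ContDiff ℝ ∞ f ∧ ∃ g : Vec3 → Vec3, ContDiff ℝ ∞ g ∧ (∀ x, g (f x) = x) ∧ ∀ y, f (g y) = y

/-- Fibre derivative `∂L/∂u` of a Lagrange density `L(u, ρ, ∇ρ)`. -/
def fibreDeriv (L : Vec3 → ℝ → Vec3 → ℝ) (u : Vec3) (r : ℝ) (q : Vec3) : Vec3 :=
  grad (fun w => L w r q) u

/-- `L(u, ρ, ∇ρ)` is an Euler-Poincaré Lagrange density: it is smooth and `u ↦ ∂L/∂u` is a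
diffeomorphism of `ℝ³` for each `(ρ, ∇ρ)`. Only the physical range `ρ > 0` is involved. -/
structure IsEPLagrangian (L : Vec3 → ℝ → Vec3 → ℝ) : Prop where
  smooth : ContDiffOn ℝ ∞ (fun z : Vec3 × ℝ × Vec3 => L z.1 z.2.1 z.2.2) {z | 0 < z.2.1}
  diffeo : ∀ r : ℝ, 0 < r → ∀ q : Vec3, IsDiffeo (fun u => fibreDeriv L u r q)

/-- The velocity determined by `(∂L/∂u)(u, ρ, ∇ρ) = p`. -/
def velocityOf (L : Vec3 → ℝ → Vec3 → ℝ) (p : Vec3) (r : ℝ) (q : Vec3) : Vec3 :=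
  Function.invFun (fun u => fibreDeriv L u r q) p

/-- The Hamiltonian density `H(p, ρ, ∇ρ) = u · p - L(u, ρ, ∇ρ)`, where `(∂L/∂u)(u, ρ, ∇ρ) = p`. -/
def hamiltonian (L : Vec3 → ℝ → Vec3 → ℝ) (p : Vec3) (r : ℝ) (q : Vec3) : ℝ :=
  velocityOf L p r q ⬝ᵥ p - L (velocityOf L p r q) r q

/-! ### Looped frozen fields

A smooth map from a torus (times a time or parameter interval) to a circle or a torus is described
by its smooth lift to the universal covers; the lift is unique up to a constant in the lattice,
which does not affect any derivative. A real-valued function on a torus is a periodic function. -/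

/-- The five fields `(h, p, ρ, χ, S)` as functions of `x` and `θ` (`S` of `x` alone), lifted to the
universal covers. Also used for the velocities `(ḣ, ṗ, ρ', χ', Ṡ)` of such fields. -/
structure Fields where
  h : Vec3 → ℝ → Vec3
  p : Vec3 → ℝ → Vec3
  rho : Vec3 → ℝ → ℝ
  chi : Vec3 → ℝ → ℝ
  S : Vec3 → ℝ

/-- The fields descend to maps `h : Q × S¹ → Q₀`, `p : Q × S¹ → ℝ³`, `ρ, χ : Q × S¹ → ℝ` and
`S : Q → S¹` on the tori. -/
structure Fields.OnTorus (c : Fields) : Prop where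
  h : ∀ x θ (k : Fin 3 → ℤ) (m : ℤ), ∃ n : Fin 3 → ℤ,
    c.h (x + lat k) (θ + 2 * Real.pi * m) = c.h x θ + lat n
  p : ∀ x θ (k : Fin 3 → ℤ) (m : ℤ), c.p (x + lat k) (θ + 2 * Real.pi * m) = c.p x θ
  rho : ∀ x θ (k : Fin 3 → ℤ) (m : ℤ), c.rho (x + lat k) (θ + 2 * Real.pi * m) = c.rho x θ
  chi : ∀ x θ (k : Fin 3 → ℤ) (m : ℤ), c.chi (x + lat k) (θ + 2 * Real.pi * m) = c.chi x θ
  S : ∀ x (k : Fin 3 → ℤ), ∃ n : ℤ, c.S (x + lat k) = c.S x + 2 * Real.pi * n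

/-- `f : ℝ³ → ℝ³` is the lift of a diffeomorphism of the torus `Q → Q₀`: it is smooth, descends to
the torus, and the same holds for some `g` which is inverse to `f` modulo the lattice. -/
def IsTorusDiffeo (f : Vec3 → Vec3) : Prop :=
  (ContDiff ℝ ∞ f ∧ ∀ x k, ∃ n, f (x + lat k) = f x + lat n) ∧
  ∃ g : Vec3 → Vec3, (ContDiff ℝ ∞ g ∧ ∀ x k, ∃ n, g (x + lat k) = g x + lat n) ∧
    (∀ x, ∃ n, g (f x) = x + lat n) ∧ ∀ y, ∃ n, f (g y) = y + lat n

/-- `c` belongs to the product of the space of looped frozen field configurations with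
`C^∞(Q, S¹)`: the fields are smooth on the torus, `x ↦ h(x, θ)` is a diffeomorphism `Q → Q₀` for
each `θ`, and `ρ > 0`. -/
structure Fields.IsConfig (c : Fields) : Prop where
  smooth_h : ContDiff ℝ ∞ (fun z : Vec3 × ℝ => c.h z.1 z.2)
  smooth_p : ContDiff ℝ ∞ (fun z : Vec3 × ℝ => c.p z.1 z.2)
  smooth_rho : ContDiff ℝ ∞ (fun z : Vec3 × ℝ => c.rho z.1 z.2)
  smooth_chi : ContDiff ℝ ∞ (fun z : Vec3 × ℝ => c.chi z.1 z.2)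
  smooth_S : ContDiff ℝ ∞ c.S
  onTorus : c.OnTorus
  diffeo : ∀ θ, IsTorusDiffeo (fun x => c.h x θ)
  rho_pos : ∀ x θ, 0 < c.rho x θ

/-! ### Derivatives -/

variable {F : Type*} [NormedAddCommGroup F] [NormedSpace ℝ F]

/-- `∂f/∂θ`. -/
def dTheta (f : Vec3 → ℝ → F) (x : Vec3) (θ : ℝ) : F := deriv (fun s => f x s) θ

/-- The `i`-th component of `∇^S f = ∇f + ∇S ∂f/∂θ`. -/
def dSpaceS (S : Vec3 → ℝ) (i : Fin 3) (f : Vec3 → ℝ → F) (x : Vec3) (θ : ℝ) : F :=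
  fderiv ℝ (fun y => f y θ) x (Pi.single i 1) + grad S x i • dTheta f x θ

/-- `∂_t^S f = ∂f/∂t + (∂S/∂t) ∂f/∂θ`. -/
def dTimeS (S : ℝ → Vec3 → ℝ) (f : ℝ → Vec3 → ℝ → F) (t : ℝ) (x : Vec3) (θ : ℝ) : F :=
  deriv (fun τ => f τ x θ) t + deriv (fun τ => S τ x) t • dTheta (f t) x θ

/-- The vector `∇^S f` of a scalar function `f`. -/
def gradS (S : Vec3 → ℝ) (f : Vec3 → ℝ → ℝ) (x : Vec3) (θ : ℝ) : Vec3 :=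
  fun i => dSpaceS S i f x θ

/-- The divergence `∇^S · w` of a vector function `w`. -/
def divS (S : Vec3 → ℝ) (w : Vec3 → ℝ → Vec3) (x : Vec3) (θ : ℝ) : ℝ :=
  ∑ i, dSpaceS S i (fun y s => w y s i) x θ

/-- The matrix `∇^S h`, with entries `(∇^S h)_{ij} = ∂_i h_j + ∂_i S ∂_θ h_j`. -/
def jacS (S : Vec3 → ℝ) (h : Vec3 → ℝ → Vec3) (x : Vec3) (θ : ℝ) : Matrix (Fin 3) (Fin 3) ℝ :=
  Matrix.of fun i j => dSpaceS S i (fun y s => h y s j) x θ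

/-! ### The Lagrangian and the action -/

/-- `v = -(ḣ + Ṡ ∂_θ h) · (∇^S h)⁻¹`. -/
def vel (c d : Fields) (x : Vec3) (θ : ℝ) : Vec3 :=
  -(Matrix.vecMul (d.h x θ + d.S x • dTheta c.h x θ) (jacS c.S c.h x θ)⁻¹)

/-- The integrand of the Lagrangian at fields `c` with velocities `d`:
`p · v + ρ χ' + ρ Ṡ ∂_θ χ + ρ v · ∇^S χ - H(p, ρ, ∇^S ρ)`. -/
def lagrangianDensity (H : Vec3 → ℝ → Vec3 → ℝ) (c d : Fields) (x : Vec3) (θ : ℝ) : ℝ :=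
  c.p x θ ⬝ᵥ vel c d x θ + c.rho x θ * d.chi x θ + c.rho x θ * (d.S x * dTheta c.chi x θ)
    + c.rho x θ * (vel c d x θ ⬝ᵥ gradS c.S c.chi x θ)
    - H (c.p x θ) (c.rho x θ) (gradS c.S c.rho x θ)

/-- The Lagrangian: the average over `θ` of the integral over `Q`, the latter being computed on the
fundamental domain `[0, 2π]³`. -/
def lagrangian (H : Vec3 → ℝ → Vec3 → ℝ) (c d : Fields) : ℝ :=
  (2 * Real.pi)⁻¹ * ∫ θ in (0 : ℝ)..(2 * Real.pi),
    ∫ x in Set.Icc (0 : Vec3) (fun _ => 2 * Real.pi), lagrangianDensity H c d x θ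

/-- The time derivative `∂_t γ` of a curve of fields. -/
def velocity (γ : ℝ → Fields) (t : ℝ) : Fields where
  h := fun x θ => deriv (fun τ => (γ τ).h x θ) t
  p := fun x θ => deriv (fun τ => (γ τ).p x θ) t
  rho := fun x θ => deriv (fun τ => (γ τ).rho x θ) t
  chi := fun x θ => deriv (fun τ => (γ τ).chi x θ) t
  S := fun x => deriv (fun τ => (γ τ).S x) t

/-- The action `∫_{t₁}^{t₂} L(γ(t), ∂_t γ(t)) dt`. -/
def action (H : Vec3 → ℝ → Vec3 → ℝ) (t₁ t₂ : ℝ) (γ : ℝ → Fields) : ℝ :=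
  ∫ t in t₁..t₂, lagrangian H (γ t) (velocity γ t)

/-! ### Smooth curves, variations and critical points -/

/-- `γ` represents a smooth curve `[t₁, t₂] → ℓC₀ × C^∞(Q, S¹)`. As usual, smoothness on the closed
interval means being the restriction of a map that is smooth in `(t, x, θ)` for all real `t`; the
values of `γ` at times outside `[t₁, t₂]` are otherwise arbitrary and play no role. -/
structure IsSmoothCurve (t₁ t₂ : ℝ) (γ : ℝ → Fields) : Prop where
  smooth_h : ContDiff ℝ ∞ (fun z : ℝ × Vec3 × ℝ => (γ z.1).h z.2.1 z.2.2)
  smooth_p : ContDiff ℝ ∞ (fun z : ℝ × Vec3 × ℝ => (γ z.1).p z.2.1 z.2.2)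
  smooth_rho : ContDiff ℝ ∞ (fun z : ℝ × Vec3 × ℝ => (γ z.1).rho z.2.1 z.2.2)
  smooth_chi : ContDiff ℝ ∞ (fun z : ℝ × Vec3 × ℝ => (γ z.1).chi z.2.1 z.2.2)
  smooth_S : ContDiff ℝ ∞ (fun z : ℝ × Vec3 => (γ z.1).S z.2)
  config : ∀ t ∈ Set.Icc t₁ t₂, (γ t).IsConfig

/-- `Γ` is a smooth one-parameter family `ε ↦ Γ ε` of curves through `γ = Γ 0` with the same
endpoints. The configuration space is open in the space of smooth fields on the torus and
`[t₁, t₂] × Q × S¹` is compact, so the curves `Γ ε` stay in the configuration space for small `ε`;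
larger `ε` are irrelevant for the derivative at `ε = 0`. -/
structure IsVariation (t₁ t₂ : ℝ) (γ : ℝ → Fields) (Γ : ℝ → ℝ → Fields) : Prop where
  smooth_h : ContDiff ℝ ∞ (fun z : ℝ × ℝ × Vec3 × ℝ => (Γ z.1 z.2.1).h z.2.2.1 z.2.2.2)
  smooth_p : ContDiff ℝ ∞ (fun z : ℝ × ℝ × Vec3 × ℝ => (Γ z.1 z.2.1).p z.2.2.1 z.2.2.2)
  smooth_rho : ContDiff ℝ ∞ (fun z : ℝ × ℝ × Vec3 × ℝ => (Γ z.1 z.2.1).rho z.2.2.1 z.2.2.2)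
  smooth_chi : ContDiff ℝ ∞ (fun z : ℝ × ℝ × Vec3 × ℝ => (Γ z.1 z.2.1).chi z.2.2.1 z.2.2.2)
  smooth_S : ContDiff ℝ ∞ (fun z : ℝ × ℝ × Vec3 => (Γ z.1 z.2.1).S z.2.2)
  onTorus : ∀ ε, ∀ t ∈ Set.Icc t₁ t₂, (Γ ε t).OnTorus
  base : ∀ t ∈ Set.Icc t₁ t₂, Γ 0 t = γ t
  left_end : ∀ ε, Γ ε t₁ = γ t₁
  right_end : ∀ ε, Γ ε t₂ = γ t₂

/-- `γ` is a fixed-endpoint critical point of the action: along every smooth fixed-endpoint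
variation the derivative of the action at `ε = 0` exists and is zero. -/
def IsCriticalPoint (H : Vec3 → ℝ → Vec3 → ℝ) (t₁ t₂ : ℝ) (γ : ℝ → Fields) : Prop :=
  ∀ Γ : ℝ → ℝ → Fields, IsVariation t₁ t₂ γ Γ →
    HasDerivAt (fun ε => action H t₁ t₂ (Γ ε)) 0 0

/-! ### The extended equations -/

/-- The value of `H` at `(p, ρ, ∇^S ρ)`. -/
def hamAt (H : Vec3 → ℝ → Vec3 → ℝ) (c : Fields) (x : Vec3) (θ : ℝ) : ℝ :=
  H (c.p x θ) (c.rho x θ) (gradS c.S c.rho x θ)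

/-- `∂H/∂p` evaluated at `(p, ρ, ∇^S ρ)`. -/
def hamP (H : Vec3 → ℝ → Vec3 → ℝ) (c : Fields) (x : Vec3) (θ : ℝ) : Vec3 :=
  grad (fun p' => H p' (c.rho x θ) (gradS c.S c.rho x θ)) (c.p x θ)

/-- `∂H/∂ρ` evaluated at `(p, ρ, ∇^S ρ)`. -/
def hamRho (H : Vec3 → ℝ → Vec3 → ℝ) (c : Fields) (x : Vec3) (θ : ℝ) : ℝ :=
  deriv (fun r => H (c.p x θ) r (gradS c.S c.rho x θ)) (c.rho x θ)

/-- `∂H/∂∇ρ` evaluated at `(p, ρ, ∇^S ρ)`. -/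
def hamGradRho (H : Vec3 → ℝ → Vec3 → ℝ) (c : Fields) (x : Vec3) (θ : ℝ) : Vec3 :=
  grad (fun q => H (c.p x θ) (c.rho x θ) q) (gradS c.S c.rho x θ)

/-- The curve `γ` satisfies the extended equations on `[t₁, t₂]`. For a tensor `T` the divergence
is `(∇ · T)_j = ∂_i T_{ij}`. -/
structure SolvesExtended (H : Vec3 → ℝ → Vec3 → ℝ) (t₁ t₂ : ℝ) (γ : ℝ → Fields) : Prop where
  /-- `∂_t^S h = - ∂H/∂p · ∇^S h`. -/
  labels : ∀ t ∈ Set.Icc t₁ t₂, ∀ x θ,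
    dTimeS (fun τ => (γ τ).S) (fun τ => (γ τ).h) t x θ
      = -(Matrix.vecMul (hamP H (γ t) x θ) (jacS (γ t).S (γ t).h x θ))
  /-- `∂_t^S p + ∇^S · (∂H/∂p ⊗ p + ∂H/∂∇ρ ⊗ ∇^S ρ)
    = - ∇^S (ρ ∂H/∂ρ - ρ ∇^S · ∂H/∂∇ρ + p · ∂H/∂p - H)`. -/
  momentum : ∀ t ∈ Set.Icc t₁ t₂, ∀ x θ, ∀ j : Fin 3,
    dTimeS (fun τ => (γ τ).S) (fun τ y s => (γ τ).p y s j) t x θ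
      + divS (γ t).S (fun y s i => hamP H (γ t) y s i * (γ t).p y s j
          + hamGradRho H (γ t) y s i * gradS (γ t).S (γ t).rho y s j) x θ
      = -(gradS (γ t).S (fun y s => (γ t).rho y s * hamRho H (γ t) y s
          - (γ t).rho y s * divS (γ t).S (hamGradRho H (γ t)) y s
          + (γ t).p y s ⬝ᵥ hamP H (γ t) y s - hamAt H (γ t) y s) x θ j)
  /-- `∂_t^S ρ + ∇^S · (ρ ∂H/∂p) = 0`. -/
  continuity : ∀ t ∈ Set.Icc t₁ t₂, ∀ x θ,
    dTimeS (fun τ => (γ τ).S) (fun τ => (γ τ).rho) t x θ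
      + divS (γ t).S (fun y s => (γ t).rho y s • hamP H (γ t) y s) x θ = 0
  /-- `∂_t^S χ + ∂H/∂p · ∇^S χ = ∂H/∂ρ - ∇^S · ∂H/∂∇ρ`. -/
  multiplier : ∀ t ∈ Set.Icc t₁ t₂, ∀ x θ,
    dTimeS (fun τ => (γ τ).S) (fun τ => (γ τ).chi) t x θ
      + hamP H (γ t) x θ ⬝ᵥ gradS (γ t).S (γ t).chi x θ
      = hamRho H (γ t) x θ - divS (γ t).S (hamGradRho H (γ t)) x θ

end

end ExtLBEP

/-!
Why the theorem is true. For a phase function `S`, the operators `D_a = ∂_a + (∂_a S) ∂_θ`, where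
`a` is a direction in time, in space, or in the parameter `ε` of a variation, commute with each
other, because `S` does not depend on `θ` (`bracket_lift`). Consequently the Lagrangian has the same
algebraic form as the one without loops, with `∂_t`, `∂_i` replaced by `D_t`, `D_i`, and a variation
of `S` is absorbed by measuring all variations with `D_ε` instead of `∂_ε`. In particular the phase
contributes no equation of its own.

Write `ξ = -(D_ε h) · (∇^S h)⁻¹` for the displacement of the labels and `m = p + ρ ∇^S χ`. From
`D_t h = -v · ∇^S h` one obtains `D_ε v = D_t ξ + v · ∇^S ξ - ξ · ∇^S v`
(`FluidData.Laws.delta_vel`), and then `D_ε` of the Lagrange density is, up to `D_t` and `D_i` of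
boundary terms,
`(v - H_p) · D_ε p + (D_t χ + v · ∇^S χ - H_ρ + ∇^S · H_{∇ρ}) D_ε ρ
  - (D_t ρ + ∇^S · (ρ v)) D_ε χ - (D_t m + ∇^S · (v ⊗ m) + m · ∇^S v) · ξ`
(`FluidData.Laws.delta_lag`). The four coefficients vanish if and only if the four equations of the
theorem hold (`FluidData.Laws.eqs_mem_iff`); the chain rule for `H` turns the last one into the
momentum equation. All of this is an identity in a commutative ring with commuting derivations,
which is applied to the ring `SmoothFun U` of smooth functions of `(ε, t, x, θ)` on the open set `U`
where `ρ > 0` and `∇^S h` is invertible.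

Since `D_a f = ∂_a f + ∂_θ ((∂_a S) f)`, the boundary terms form an ordinary divergence, whose
integral vanishes by periodicity and the fixed endpoints (`setIntegral_domain_div`). This gives the
first variation formula `SmoothFamily.hasDerivAt_action`, valid for every variation. The
coefficients in it depend on the curve `Γ 0` alone (`SmoothFamily.Agree`), so solutions are critical
points. Conversely, a critical curve is varied by the four coefficients themselves, cut off in time:
the first variation is then the integral of a sum of squares, so that the coefficients vanish.

The Hamiltonian is smooth for `ρ > 0` because the Legendre map is a bijective local diffeomorphism
(`IsEPLagrangian.contDiffOn_hamiltonian`).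
-/

namespace ExtLBEP

open Set Filter Topology MeasureTheory

/-! ### Smoothness of the Hamiltonian density -/

/-- The range `ρ > 0` in the space of triples `(u, ρ, ∇ρ)` or `(p, ρ, ∇ρ)`. -/
def posDensity : Set (Vec3 × ℝ × Vec3) := {z | 0 < z.2.1}

theorem isOpen_posDensity : IsOpen posDensity :=
  isOpen_lt continuous_const (by fun_prop)

theorem IsEPLagrangian.differentiableAt {L : Vec3 → ℝ → Vec3 → ℝ} (hL : IsEPLagrangian L)
    {z : Vec3 × ℝ × Vec3} (hz : z ∈ posDensity) :
    DifferentiableAt ℝ (fun z : Vec3 × ℝ × Vec3 => L z.1 z.2.1 z.2.2) z :=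
  (hL.smooth.contDiffAt (isOpen_posDensity.mem_nhds hz)).differentiableAt (by simp)

theorem IsEPLagrangian.fibreDeriv_eq {L : Vec3 → ℝ → Vec3 → ℝ} (hL : IsEPLagrangian L)
    {z : Vec3 × ℝ × Vec3} (hz : z ∈ posDensity) (i : Fin 3) :
    fibreDeriv L z.1 z.2.1 z.2.2 i =
      fderiv ℝ (fun z : Vec3 × ℝ × Vec3 => L z.1 z.2.1 z.2.2) z (Pi.single i 1, 0, 0) := by
  have h1 : HasFDerivAt (fun u : Vec3 => (u, z.2.1, z.2.2))
      (ContinuousLinearMap.inl ℝ Vec3 (ℝ × Vec3)) z.1 :=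
    hasFDerivAt_prodMk_left z.1 (z.2.1, z.2.2)
  have h2 := (hL.differentiableAt hz).hasFDerivAt.comp z.1 h1
  exact congrArg (fun l : Vec3 →L[ℝ] ℝ => l (Pi.single i 1)) h2.fderiv

/-- The fibre derivative, completed by the identity in `(ρ, ∇ρ)`. -/
noncomputable def legendreMap (L : Vec3 → ℝ → Vec3 → ℝ) (z : Vec3 × ℝ × Vec3) : Vec3 × ℝ × Vec3 :=
  (fibreDeriv L z.1 z.2.1 z.2.2, z.2)

theorem IsEPLagrangian.contDiffOn_legendreMap {L : Vec3 → ℝ → Vec3 → ℝ} (hL : IsEPLagrangian L) :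
    ContDiffOn ℝ ∞ (legendreMap L) posDensity := by
  refine ContDiffOn.prodMk ?_ contDiff_snd.contDiffOn
  refine contDiffOn_pi.2 fun i => ?_
  have h : ContDiffOn ℝ ∞ (fun z => fderiv ℝ (fun z : Vec3 × ℝ × Vec3 => L z.1 z.2.1 z.2.2) z
      (Pi.single i 1, 0, 0)) posDensity :=
    (hL.smooth.fderiv_of_isOpen isOpen_posDensity (by simp)).clm_apply contDiffOn_const
  exact h.congr fun z hz => hL.fibreDeriv_eq hz i

/-- The derivative of the Legendre map is injective: it is the identity in `(ρ, ∇ρ)`, and in `u` it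
has a left inverse because the fibre derivative is a diffeomorphism. -/
theorem IsEPLagrangian.fderiv_legendreMap_injective {L : Vec3 → ℝ → Vec3 → ℝ}
    (hL : IsEPLagrangian L) {z : Vec3 × ℝ × Vec3} (hz : z ∈ posDensity) :
    Function.Injective (fderiv ℝ (legendreMap L) z) := by
  have hG : HasFDerivAt (legendreMap L) (fderiv ℝ (legendreMap L) z) z :=
    ((hL.contDiffOn_legendreMap.contDiffAt
      (isOpen_posDensity.mem_nhds hz)).differentiableAt (by simp)).hasFDerivAt
  refine (injective_iff_map_eq_zero _).2 fun a ha => ?_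
  have h2 : a.2 = 0 := by
    have h := (hasFDerivAt_snd (𝕜 := ℝ) (p := legendreMap L z)).comp z hG
    have h' := h.unique (hasFDerivAt_snd (𝕜 := ℝ) (p := z))
    have := congrArg (fun l : (Vec3 × ℝ × Vec3) →L[ℝ] ℝ × Vec3 => l a) h'
    simpa [ha] using this.symm
  obtain ⟨hf, g, hg, hgf, -⟩ := hL.diffeo z.2.1 hz z.2.2
  have h1 : HasFDerivAt (fun u : Vec3 => (u, z.2.1, z.2.2))
      (ContinuousLinearMap.inl ℝ Vec3 (ℝ × Vec3)) z.1 :=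
    hasFDerivAt_prodMk_left z.1 (z.2.1, z.2.2)
  have h3 := (hasFDerivAt_fst (𝕜 := ℝ) (p := legendreMap L z)).comp z.1 (hG.comp z.1 h1)
  have h4 := ((hg.differentiable (by simp)) _).hasFDerivAt.comp z.1 h3
  have h5 := (h4.congr_of_eventuallyEq (f₁ := id) (Eventually.of_forall fun u =>
    (hgf u).symm)).unique (hasFDerivAt_id z.1)
  have h6 := congrArg (fun l : Vec3 →L[ℝ] Vec3 => l a.1) h5
  -- on `a = (a.1, 0)` the left inverse `fderiv g` recovers `a.1` from the derivative in `u`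
  have h7 : ((a.1, 0) : Vec3 × ℝ × Vec3) = a := by rw [← h2]
  have h8 : a.1 = 0 := by simpa [h7, ha] using h6.symm
  exact Prod.ext h8 h2

theorem IsEPLagrangian.fibreDeriv_velocityOf {L : Vec3 → ℝ → Vec3 → ℝ} (hL : IsEPLagrangian L)
    (p : Vec3) {r : ℝ} (hr : 0 < r) (q : Vec3) : fibreDeriv L (velocityOf L p r q) r q = p := by
  obtain ⟨-, g, -, -, hfg⟩ := hL.diffeo r hr q
  exact Function.invFun_eq (f := fun u => fibreDeriv L u r q) ⟨g p, hfg p⟩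

theorem IsEPLagrangian.contDiffOn_velocityOf {L : Vec3 → ℝ → Vec3 → ℝ} (hL : IsEPLagrangian L) :
    ContDiffOn ℝ ∞ (fun z : Vec3 × ℝ × Vec3 => velocityOf L z.1 z.2.1 z.2.2) posDensity := by
  -- the velocity is the first component of a local inverse of the Legendre map
  intro z hz
  refine ContDiffAt.contDiffWithinAt ?_
  set w : Vec3 × ℝ × Vec3 := (velocityOf L z.1 z.2.1 z.2.2, z.2) with hw
  have hwp : w ∈ posDensity := hz
  have hGw : legendreMap L w = z := Prod.ext (hL.fibreDeriv_velocityOf _ hz _) rfl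
  have hG := hL.contDiffOn_legendreMap.contDiffAt (isOpen_posDensity.mem_nhds hwp)
  let e := (LinearEquiv.ofInjectiveEndo (fderiv ℝ (legendreMap L) w).toLinearMap
    (hL.fderiv_legendreMap_injective hwp)).toContinuousLinearEquiv
  have he : (e : (Vec3 × ℝ × Vec3) →L[ℝ] Vec3 × ℝ × Vec3) = fderiv ℝ (legendreMap L) w := by
    exact ContinuousLinearMap.ext fun _ => rfl
  have hd : HasFDerivAt (legendreMap L) (e : (Vec3 × ℝ × Vec3) →L[ℝ] Vec3 × ℝ × Vec3) w := by
    rw [he]; exact (hG.differentiableAt (by simp)).hasFDerivAt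
  have hinv := hG.to_localInverse hd (by simp)
  have hs : HasStrictFDerivAt (legendreMap L) (e : (Vec3 × ℝ × Vec3) →L[ℝ] Vec3 × ℝ × Vec3) w :=
    hG.hasStrictFDerivAt' hd (by simp)
  have hri := hs.eventually_right_inverse
  rw [hGw] at hinv hri
  refine (contDiffAt_fst.comp z hinv).congr_of_eventuallyEq ?_
  filter_upwards [hri, isOpen_posDensity.mem_nhds hz] with y hy hyp
  set y' := hG.localInverse hd (by simp) y with hy'
  have hy2 : legendreMap L y' = y := hy
  have h2 : y'.2 = y.2 := by
    change (legendreMap L y').2 = y.2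
    rw [hy2]
  have h1 : fibreDeriv L y'.1 y.2.1 y.2.2 = y.1 := by
    rw [← h2]
    change (legendreMap L y').1 = y.1
    rw [hy2]
  obtain ⟨-, g, -, hgf, -⟩ := hL.diffeo y.2.1 hyp y.2.2
  have hinj : Function.Injective (fun u => fibreDeriv L u y.2.1 y.2.2) :=
    Function.LeftInverse.injective hgf
  exact hinj ((hL.fibreDeriv_velocityOf y.1 hyp y.2.2).trans h1.symm)

/-- The Hamiltonian density is smooth for `ρ > 0`: the Legendre map is a bijective local
diffeomorphism there, so that its inverse depends smoothly on all arguments. -/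
theorem IsEPLagrangian.contDiffOn_hamiltonian {L : Vec3 → ℝ → Vec3 → ℝ} (hL : IsEPLagrangian L) :
    ContDiffOn ℝ ∞ (fun z : Vec3 × ℝ × Vec3 => hamiltonian L z.1 z.2.1 z.2.2) posDensity := by
  have hv := hL.contDiffOn_velocityOf
  refine ContDiffOn.sub ?_ ?_
  · simp only [dotProduct]
    exact ContDiffOn.sum fun i _ => (contDiffOn_pi.1 hv i).mul
      (by fun_prop : ContDiff ℝ ∞ fun z : Vec3 × ℝ × Vec3 => z.1 i).contDiffOn
  · exact hL.smooth.comp (hv.prodMk contDiff_snd.contDiffOn) fun z hz => hz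

/-! ### The ring of smooth functions on an open set -/

section SmoothFun

variable {X : Type*} [NormedAddCommGroup X] [NormedSpace ℝ X]

/-- The algebra of smooth real functions on the open set `U`, as functions on the subtype. -/
def SmoothFun (U : TopologicalSpace.Opens X) : Subalgebra ℝ (U → ℝ) where
  carrier := {f | ∃ F : X → ℝ, ContDiffOn ℝ ∞ F U ∧ ∀ u : U, F u = f u}
  mul_mem' := by
    rintro f g ⟨F, hF, hf⟩ ⟨G, hG, hg⟩
    exact ⟨fun x => F x * G x, hF.mul hG, fun u => by simp [hf, hg]⟩
  add_mem' := by
    rintro f g ⟨F, hF, hf⟩ ⟨G, hG, hg⟩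
    exact ⟨fun x => F x + G x, hF.add hG, fun u => by simp [hf, hg]⟩
  algebraMap_mem' r := ⟨fun _ => r, contDiffOn_const, fun u => rfl⟩

variable {U : TopologicalSpace.Opens X}

namespace SmoothFun

/-- The restriction to `U` of a function which is smooth there. -/
def mk (F : X → ℝ) (hF : ContDiffOn ℝ ∞ F U) : SmoothFun U := ⟨fun u => F u, F, hF, fun _ => rfl⟩

/-- Some extension to the whole space of a smooth function on `U`. -/
noncomputable def rep (f : SmoothFun U) : X → ℝ := f.2.choose

theorem contDiffOn_rep (f : SmoothFun U) : ContDiffOn ℝ ∞ (rep f) U := f.2.choose_spec.1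

theorem rep_apply (f : SmoothFun U) (u : U) : rep f u = f.1 u := f.2.choose_spec.2 u

/-- Evaluation at a point of `U`. -/
def ev (u : U) : SmoothFun U →+* ℝ := (Pi.evalRingHom (fun _ : U => ℝ) u).comp (SmoothFun U).val.toRingHom

theorem rep_eq_ev (f : SmoothFun U) (u : U) : rep f u = ev u f := rep_apply f u

@[simp] theorem ev_mk (u : U) (F : X → ℝ) (hF : ContDiffOn ℝ ∞ F U) : ev u (mk F hF) = F u := rfl

theorem ext_ev {f g : SmoothFun U} (h : ∀ u, ev u f = ev u g) : f = g :=
  Subtype.ext (funext h)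

theorem contDiffAt_rep (f : SmoothFun U) (u : U) : ContDiffAt ℝ ∞ (rep f) u :=
  (contDiffOn_rep f).contDiffAt (U.isOpen.mem_nhds u.2)

theorem eventuallyEq_rep {f : SmoothFun U} {F : X → ℝ} (hF : ∀ u : U, F u = ev u f) (u : U) :
    F =ᶠ[𝓝 (u : X)] rep f :=
  eventuallyEq_of_mem (U.isOpen.mem_nhds u.2) fun x hx =>
    (hF ⟨x, hx⟩).trans (rep_eq_ev f ⟨x, hx⟩).symm

theorem isUnit_of_ev_ne_zero {f : SmoothFun U} (h : ∀ u, ev u f ≠ 0) : IsUnit f := by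
  have hg : ContDiffOn ℝ ∞ (fun x => (rep f x)⁻¹) U :=
    (contDiffOn_rep f).inv fun x hx => by rw [rep_eq_ev f ⟨x, hx⟩]; exact h _
  refine IsUnit.of_mul_eq_one (mk _ hg) (ext_ev fun u => ?_)
  rw [map_mul, ev_mk, rep_eq_ev, map_one, mul_inv_cancel₀ (h u)]

/-- The directional derivative along the vector field `V`. -/
noncomputable def derFun (V : X → X) (hV : ContDiff ℝ ∞ V) (f : SmoothFun U) : SmoothFun U :=
  mk (fun x => fderiv ℝ (rep f) x (V x))
    (((contDiffOn_rep f).fderiv_of_isOpen U.isOpen (by simp)).clm_apply hV.contDiffOn)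

theorem ev_derFun (V : X → X) (hV : ContDiff ℝ ∞ V) {f : SmoothFun U} {F : X → ℝ}
    (hF : ∀ u : U, F u = ev u f) (u : U) : ev u (derFun V hV f) = fderiv ℝ F u (V u) := by
  rw [derFun, ev_mk, (eventuallyEq_rep hF u).fderiv_eq]

/-- The derivation of the ring of smooth functions given by a vector field `V`. -/
noncomputable def der (V : X → X) (hV : ContDiff ℝ ∞ V) :
    Derivation ℝ (SmoothFun U) (SmoothFun U) :=
  Derivation.mk'
    { toFun := derFun V hV
      map_add' := fun f g => ext_ev fun u => by
        rw [ev_derFun V hV (F := fun x => rep f x + rep g x) (fun u => by simp [rep_eq_ev]),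
          fderiv_fun_add ((contDiffAt_rep f u).differentiableAt (by simp))
            ((contDiffAt_rep g u).differentiableAt (by simp))]
        rfl
      map_smul' := fun c f => ext_ev fun u => by
        have h : ∀ u : U, c * rep f u = ev u (c • f) := fun u => by rw [rep_eq_ev]; rfl
        rw [ev_derFun V hV (F := fun x => c * rep f x) h,
          fderiv_const_mul ((contDiffAt_rep f u).differentiableAt (by simp))]
        rfl }
    fun f g => ext_ev fun u => by
      have h : ∀ u : U, rep f u * rep g u = ev u (f * g) := fun u => by simp [rep_eq_ev]
      simp only [LinearMap.coe_mk, AddHom.coe_mk, smul_eq_mul, map_add, map_mul]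
      rw [ev_derFun V hV (F := fun x => rep f x * rep g x) h,
        fderiv_fun_mul ((contDiffAt_rep f u).differentiableAt (by simp))
            ((contDiffAt_rep g u).differentiableAt (by simp)),
        ev_derFun V hV (rep_eq_ev f), ev_derFun V hV (rep_eq_ev g)]
      simp [rep_eq_ev]

theorem ev_der (V : X → X) (hV : ContDiff ℝ ∞ V) {f : SmoothFun U} {F : X → ℝ}
    (hF : ∀ u : U, F u = ev u f) (u : U) : ev u (der V hV f) = fderiv ℝ F u (V u) :=
  ev_derFun V hV hF u

/-- Derivations given by vector fields whose Lie bracket vanishes commute. -/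
theorem der_comm {V V' : X → X} (hV : ContDiff ℝ ∞ V) (hV' : ContDiff ℝ ∞ V')
    (hb : ∀ x, fderiv ℝ V' x (V x) = fderiv ℝ V x (V' x)) (f : SmoothFun U) :
    der V hV (der V' hV' f) = der V' hV' (der V hV f) := by
  have key : ∀ (V V' : X → X) (hV : ContDiff ℝ ∞ V) (hV' : ContDiff ℝ ∞ V') (u : U),
      ev u (der V hV (der V' hV' f)) = fderiv ℝ (fderiv ℝ (rep f)) u (V u) (V' u)
        + fderiv ℝ (rep f) u (fderiv ℝ V' u (V u)) := by
    intro V V' hV hV' u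
    rw [ev_der V hV (F := fun x => fderiv ℝ (rep f) x (V' x))
      (fun u => (ev_der V' hV' (rep_eq_ev f) u).symm)]
    have h1 : DifferentiableAt ℝ (fderiv ℝ (rep f)) u :=
      ((contDiffAt_rep f u).fderiv_right (m := ∞) (by simp)).differentiableAt (by simp)
    rw [fderiv_clm_apply h1 (hV'.differentiable (by simp) _)]
    simp [add_comm]
  refine ext_ev fun u => ?_
  rw [key V V' hV hV' u, key V' V hV' hV u, hb]
  have hs : IsSymmSndFDerivAt ℝ (rep f) u :=
    (contDiffAt_rep f u).isSymmSndFDerivAt (by simpa using WithTop.coe_le_coe.2 (le_top (a := (2 : ℕ∞))))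
  rw [hs.eq]

end SmoothFun

end SmoothFun

/-! ### Differential algebra of the first variation -/

section Algebra

variable {R : Type*} [CommRing R] [Algebra ℝ R]

/-- The fields and the Hamiltonian density with its derivatives, as elements of a ring with the
derivations `dt` (for `∂_t^S`) and `d i` (for `∇^S_i`). The velocity `v` is a separate entry. -/
structure FluidData (R : Type*) [CommRing R] [Algebra ℝ R] where
  dt : Derivation ℝ R R
  d : Fin 3 → Derivation ℝ R R
  h : Fin 3 → R
  p : Fin 3 → R
  rho : R
  chi : R
  v : Fin 3 → R
  ham : R
  hamP : Fin 3 → R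
  hamR : R
  hamQ : Fin 3 → R

namespace FluidData

variable (D : FluidData R)

/-- The relations between the entries that hold by definition of the velocity and by the chain
rule, together with the commutation of the derivations. -/
structure Laws : Prop where
  comm_t : ∀ i f, D.d i (D.dt f) = D.dt (D.d i f)
  comm : ∀ i j f, D.d i (D.d j f) = D.d j (D.d i f)
  vel : ∀ j, ∑ k, D.v k * D.d k (D.h j) = -D.dt (D.h j)
  injective : ∀ y : Fin 3 → R, (∀ j, ∑ k, y k * D.d k (D.h j) = 0) → ∀ k, y k = 0
  chain : ∀ k, D.d k D.ham = ∑ i, D.hamP i * D.d k (D.p i) + D.hamR * D.d k D.rho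
    + ∑ i, D.hamQ i * D.d k (D.d i D.rho)

/-- The total momentum density `p + ρ ∇^S χ`. -/
def mom (k : Fin 3) : R := D.p k + D.rho * D.d k D.chi

/-- The Lagrange density. -/
def lag : R := ∑ k, D.p k * D.v k + D.rho * D.dt D.chi + D.rho * ∑ k, D.v k * D.d k D.chi - D.ham

/-- The variational derivative with respect to `p`. -/
def resP (k : Fin 3) : R := D.v k - D.hamP k

/-- The variational derivative with respect to `ρ`. -/
def resRho : R :=
  D.dt D.chi + ∑ k, D.v k * D.d k D.chi - D.hamR + ∑ k, D.d k (D.hamQ k)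

/-- The variational derivative with respect to `χ`. -/
def resChi : R := -(D.dt D.rho + ∑ k, D.d k (D.rho * D.v k))

/-- The variational derivative with respect to the displacement `ξ = -δh · (∇^S h)⁻¹`. -/
def resH (k : Fin 3) : R :=
  -(D.dt (D.mom k) + ∑ i, D.d i (D.v i * D.mom k) + ∑ i, D.mom i * D.d k (D.v i))

/-- The defect in the equation for the labels. -/
def eqLabels (j : Fin 3) : R := D.dt (D.h j) + ∑ k, D.hamP k * D.d k (D.h j)

/-- The defect in the momentum equation. -/
def eqMomentum (k : Fin 3) : R :=
  D.dt (D.p k) + ∑ i, D.d i (D.hamP i * D.p k + D.hamQ i * D.d k D.rho)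
    + D.d k (D.rho * D.hamR - D.rho * ∑ i, D.d i (D.hamQ i) + ∑ i, D.p i * D.hamP i - D.ham)

/-- The defect in the continuity equation. -/
def eqContinuity : R := D.dt D.rho + ∑ k, D.d k (D.rho * D.hamP k)

/-- The defect in the equation for `χ`. -/
def eqMultiplier : R :=
  D.dt D.chi + ∑ k, D.hamP k * D.d k D.chi - (D.hamR - ∑ k, D.d k (D.hamQ k))

variable {D}

/-- How the velocity changes under a derivation `δ` that displaces the labels by
`δh = -ξ · ∇^S h`: the velocity changes by the material derivative of `ξ` minus `ξ · ∇^S v`. -/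
theorem Laws.delta_vel (hD : D.Laws) (δ : Derivation ℝ R R)
    (hδt : ∀ f, δ (D.dt f) = D.dt (δ f)) (hδ : ∀ i f, δ (D.d i f) = D.d i (δ f))
    (ξ : Fin 3 → R) (hξ : ∀ j, ∑ k, ξ k * D.d k (D.h j) = -δ (D.h j)) (k : Fin 3) :
    δ (D.v k) = D.dt (ξ k) + ∑ i, D.v i * D.d i (ξ k) - ∑ i, ξ i * D.d i (D.v k) := by
  refine sub_eq_zero.1 (hD.injective
    (fun k => δ (D.v k) - (D.dt (ξ k) + ∑ i, D.v i * D.d i (ξ k) - ∑ i, ξ i * D.d i (D.v k)))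
    (fun j => ?_) k)
  -- differentiate the relations defining `v` and `ξ`; the second derivatives of `h` cancel
  have e1 := congrArg δ (hD.vel j)
  have e2 := congrArg D.dt (hξ j)
  have e3 := fun i => congrArg (D.d i) (hξ j)
  have e4 := fun i => congrArg (D.d i) (hD.vel j)
  simp only [map_sum, Derivation.leibniz, map_neg, hδt, hδ, hD.comm_t, smul_eq_mul] at e1 e2 e3 e4
  have c10 := hD.comm 1 0 (D.h j)
  have c20 := hD.comm 2 0 (D.h j)
  have c21 := hD.comm 2 1 (D.h j)
  have e30 := e3 0
  have e31 := e3 1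
  have e32 := e3 2
  have e40 := e4 0
  have e41 := e4 1
  have e42 := e4 2
  simp only [Fin.sum_univ_three] at *
  rw [c10, c20] at *
  rw [c21] at *
  linear_combination e1 - e2 - D.v 0 * e30 - D.v 1 * e31 - D.v 2 * e32
    + ξ 0 * e40 + ξ 1 * e41 + ξ 2 * e42

/-- The first variation of the Lagrange density: up to divergences, it is the sum of the
variational derivatives times the variations. -/
theorem Laws.delta_lag (hD : D.Laws) (δ : Derivation ℝ R R)
    (hδt : ∀ f, δ (D.dt f) = D.dt (δ f)) (hδ : ∀ i f, δ (D.d i f) = D.d i (δ f))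
    (hham : δ D.ham = ∑ i, D.hamP i * δ (D.p i) + D.hamR * δ D.rho
      + ∑ i, D.hamQ i * δ (D.d i D.rho))
    (ξ : Fin 3 → R) (hξ : ∀ j, ∑ k, ξ k * D.d k (D.h j) = -δ (D.h j)) :
    δ D.lag = ∑ k, D.resP k * δ (D.p k) + D.resRho * δ D.rho + D.resChi * δ D.chi
        + ∑ k, D.resH k * ξ k
      + D.dt (D.rho * δ D.chi + ∑ k, D.mom k * ξ k)
      + ∑ i, D.d i (D.rho * D.v i * δ D.chi + D.v i * ∑ k, D.mom k * ξ k
          - D.hamQ i * δ D.rho) := by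
  have e := hD.delta_vel δ hδt hδ ξ hξ
  simp only [lag, resP, resRho, resChi, resH, mom, map_add, map_sub, map_sum, Derivation.leibniz,
    smul_eq_mul, hham, hδt, hδ, e]
  simp only [Fin.sum_univ_three]
  ring

/-- The variational derivative for the displacement is a combination of the momentum equation and
the other variational derivatives. -/
theorem Laws.resH_eq (hD : D.Laws) (k : Fin 3) :
    D.resH k = -D.eqMomentum k + D.d k D.chi * D.resChi - D.rho * D.d k D.resRho
      - (∑ i, D.d i (D.resP i * D.p k) + ∑ i, D.p i * D.d k (D.resP i)) := by
  simp only [eqMomentum, resP, resRho, resChi, resH, mom, map_add, map_sub, map_sum,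
    Derivation.leibniz, smul_eq_mul, hD.chain, ← hD.comm_t]
  have c10 := hD.comm 1 0
  have c20 := hD.comm 2 0
  have c21 := hD.comm 2 1
  fin_cases k <;>
    simp only [Fin.sum_univ_three, Fin.zero_eta, Fin.mk_one, Fin.reduceFinMk, c10, c20, c21] <;>
    ring

theorem Laws.eqLabels_eq (hD : D.Laws) (j : Fin 3) :
    D.eqLabels j = -∑ k, D.resP k * D.d k (D.h j) := by
  simp only [eqLabels, resP, sub_mul, Finset.sum_sub_distrib, hD.vel]
  ring

theorem eqContinuity_eq : D.eqContinuity = -D.resChi - ∑ k, D.d k (D.rho * D.resP k) := by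
  simp only [eqContinuity, resP, resChi, mul_sub, map_sub, Finset.sum_sub_distrib]
  ring

theorem eqMultiplier_eq : D.eqMultiplier = D.resRho - ∑ k, D.resP k * D.d k D.chi := by
  simp only [eqMultiplier, resP, resRho, sub_mul, Finset.sum_sub_distrib]
  ring

/-- Modulo an ideal which is stable under the derivations, the four equations are equivalent to the
vanishing of the variational derivatives. -/
theorem Laws.eqs_mem_iff (hD : D.Laws) (I : Ideal R)
    (hd : ∀ i, ∀ f ∈ I, D.d i f ∈ I)
    (hinj : ∀ y : Fin 3 → R, (∀ j, ∑ k, y k * D.d k (D.h j) ∈ I) → ∀ k, y k ∈ I) :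
    ((∀ j, D.eqLabels j ∈ I) ∧ (∀ k, D.eqMomentum k ∈ I) ∧ D.eqContinuity ∈ I
        ∧ D.eqMultiplier ∈ I) ↔
      ((∀ k, D.resP k ∈ I) ∧ D.resRho ∈ I ∧ D.resChi ∈ I ∧ ∀ k, D.resH k ∈ I) := by
  have hP : (∀ j, D.eqLabels j ∈ I) ↔ ∀ k, D.resP k ∈ I := by
    constructor
    · intro h
      refine hinj _ fun j => ?_
      have := h j
      rwa [hD.eqLabels_eq, neg_mem_iff] at this
    · intro h j
      rw [hD.eqLabels_eq, neg_mem_iff]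
      exact sum_mem fun k _ => I.mul_mem_right _ (h k)
  rw [hP]
  refine and_congr_right fun h => ?_
  have h1 : D.eqContinuity ∈ I ↔ D.resChi ∈ I := by
    rw [eqContinuity_eq, Submodule.sub_mem_iff_left, neg_mem_iff]
    exact sum_mem fun k _ => hd k _ (I.mul_mem_left _ (h k))
  have h2 : D.eqMultiplier ∈ I ↔ D.resRho ∈ I := by
    rw [eqMultiplier_eq, Submodule.sub_mem_iff_left]
    exact sum_mem fun k _ => I.mul_mem_right _ (h k)
  rw [h1, h2]
  have h3 : D.resChi ∈ I → D.resRho ∈ I → ∀ k, (D.eqMomentum k ∈ I ↔ D.resH k ∈ I) := by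
    intro hc hr k
    rw [hD.resH_eq, Submodule.sub_mem_iff_left, Submodule.sub_mem_iff_left,
      Submodule.add_mem_iff_left, neg_mem_iff]
    · exact I.mul_mem_left _ hc
    · exact I.mul_mem_left _ (hd k _ hr)
    · exact add_mem (sum_mem fun i _ => hd i _ (I.mul_mem_right _ (h i)))
        (sum_mem fun i _ => I.mul_mem_left _ (hd k _ (h i)))
  constructor
  · rintro ⟨hm, hc, hr⟩
    exact ⟨hr, hc, fun k => (h3 hc hr k).1 (hm k)⟩
  · rintro ⟨hr, hc, hm⟩
    exact ⟨fun k => (h3 hc hr k).2 (hm k), hc, hr⟩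

end FluidData

end Algebra

/-! ### Integrals over the space-time domain -/

/-- Differentiation under the integral sign over a compact set. -/
theorem hasDerivAt_setIntegral_of_contDiffOn {Z : Type*} [NormedAddCommGroup Z] [NormedSpace ℝ Z]
    [MeasurableSpace Z] [BorelSpace Z] [SecondCountableTopology Z] {μ : Measure Z}
    [IsFiniteMeasureOnCompacts μ]
    {F : ℝ × Z → ℝ} {O : Set (ℝ × Z)} (hO : IsOpen O) (hF : ContDiffOn ℝ 1 F O) {K : Set Z}
    (hK : IsCompact K) (hKO : ∀ z ∈ K, ((0 : ℝ), z) ∈ O) :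
    HasDerivAt (fun ε => ∫ z in K, F (ε, z) ∂μ) (∫ z in K, fderiv ℝ F (0, z) (1, 0) ∂μ) 0 := by
  obtain ⟨u, v, hu, -, h0u, hKv, huv⟩ := generalized_tube_lemma (isCompact_singleton (x := (0 : ℝ)))
    hK hO (by rintro ⟨e, z⟩ ⟨rfl, hz⟩; exact hKO z hz)
  obtain ⟨r, hr, hru⟩ := Metric.nhds_basis_closedBall.mem_iff.1 (hu.mem_nhds (h0u rfl))
  have hsub : Metric.closedBall (0 : ℝ) r ×ˢ K ⊆ O :=
    (prod_mono hru hKv).trans huv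
  have hF' : ContinuousOn (fun w => fderiv ℝ F w (1, 0)) O :=
    (hF.continuousOn_fderiv_of_isOpen hO le_rfl).clm_apply continuousOn_const
  have hcomp : IsCompact (Metric.closedBall (0 : ℝ) r ×ˢ K) := (isCompact_closedBall _ _).prod hK
  obtain ⟨C, hC⟩ := hcomp.exists_bound_of_continuousOn (hF'.mono hsub)
  have hcont : ∀ e ∈ Metric.closedBall (0 : ℝ) r, ∀ (G : ℝ × Z → ℝ), ContinuousOn G O →
      ContinuousOn (fun z => G (e, z)) K := fun e he G hG =>
    hG.comp (by fun_prop) fun z hz => hsub ⟨he, hz⟩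
  have hball : Metric.closedBall (0 : ℝ) r ∈ 𝓝 (0 : ℝ) := Metric.closedBall_mem_nhds _ hr
  have h0 : (0 : ℝ) ∈ Metric.closedBall (0 : ℝ) r := Metric.mem_closedBall_self hr.le
  refine (hasDerivAt_integral_of_dominated_loc_of_deriv_le (F := fun e z => F (e, z))
    (F' := fun e z => fderiv ℝ F (e, z) (1, 0)) (bound := fun _ => C) (μ := μ.restrict K)
    hball ?_ ?_ ?_ ?_ ?_ ?_).2
  · filter_upwards [hball] with e he
    exact (hcont e he F hF.continuousOn).aestronglyMeasurable hK.measurableSet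
  · exact (hcont 0 h0 F hF.continuousOn).integrableOn_compact hK
  · exact (hcont 0 h0 _ hF').aestronglyMeasurable hK.measurableSet
  · exact (ae_restrict_mem hK.measurableSet).mono fun z hz e he => hC _ ⟨he, hz⟩
  · exact integrableOn_const hK.measure_lt_top.ne
  · refine (ae_restrict_mem hK.measurableSet).mono fun z hz e he => ?_
    have h1 : HasFDerivAt F (fderiv ℝ F (e, z)) (e, z) :=
      ((hF.contDiffAt (hO.mem_nhds (hsub ⟨he, hz⟩))).differentiableAt one_ne_zero).hasFDerivAt
    exact h1.comp_hasDerivAt (f := fun e : ℝ => (e, z)) e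
      ((hasDerivAt_id e).prodMk (hasDerivAt_const e z))

/-- Space-time with the loop parameter: points `(t, x, θ)`. -/
abbrev STL := ℝ × Vec3 × ℝ

/-- The fundamental domain `[0, 2π]³` of the torus `Q`. -/
def cell : Set Vec3 := Icc (0 : Vec3) (fun _ => 2 * Real.pi)

/-- The domain of integration `[t₁, t₂] × [0, 2π]³ × [0, 2π]`. -/
def domain (t₁ t₂ : ℝ) : Set STL := Icc t₁ t₂ ×ˢ cell ×ˢ Icc 0 (2 * Real.pi)

theorem isCompact_cell : IsCompact cell := isCompact_Icc

theorem isCompact_domain (t₁ t₂ : ℝ) : IsCompact (domain t₁ t₂) :=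
  isCompact_Icc.prod (isCompact_cell.prod isCompact_Icc)

theorem setIntegral_domain_eq_time_last {t₁ t₂ : ℝ} {f : STL → ℝ}
    (hf : ContinuousOn f (domain t₁ t₂)) :
    ∫ z in domain t₁ t₂, f z
      = ∫ y in cell ×ˢ Icc 0 (2 * Real.pi), ∫ t in Icc t₁ t₂, f (t, y) := by
  have h := setIntegral_prod_swap (μ := (volume : Measure ℝ)) (ν := (volume : Measure (Vec3 × ℝ)))
    (Icc t₁ t₂) (cell ×ˢ Icc 0 (2 * Real.pi)) f
  rw [domain, Measure.volume_eq_prod, ← h, setIntegral_prod]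
  · rfl
  · refine ContinuousOn.integrableOn_compact ((isCompact_cell.prod isCompact_Icc).prod
      isCompact_Icc) (hf.comp continuous_swap.continuousOn ?_)
    rintro ⟨y, t⟩ ⟨hy, ht⟩
    exact ⟨ht, hy⟩

theorem setIntegral_domain {t₁ t₂ : ℝ} {f : STL → ℝ} (hf : ContinuousOn f (domain t₁ t₂)) :
    ∫ z in domain t₁ t₂, f z
      = ∫ t in Icc t₁ t₂, ∫ x in cell, ∫ θ in Icc 0 (2 * Real.pi), f (t, x, θ) := by
  rw [domain, Measure.volume_eq_prod, setIntegral_prod _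
    (hf.integrableOn_compact (isCompact_domain t₁ t₂))]
  refine setIntegral_congr_fun measurableSet_Icc fun t ht => ?_
  rw [Measure.volume_eq_prod, setIntegral_prod]
  refine ContinuousOn.integrableOn_compact (isCompact_cell.prod isCompact_Icc)
    (hf.comp (by fun_prop) fun y hy => ⟨ht, hy⟩)

theorem setIntegral_domain_eq_space_last {t₁ t₂ : ℝ} {f : STL → ℝ}
    (hf : ContinuousOn f (domain t₁ t₂)) :
    ∫ z in domain t₁ t₂, f z
      = ∫ t in Icc t₁ t₂, ∫ θ in Icc 0 (2 * Real.pi), ∫ x in cell, f (t, x, θ) := by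
  rw [setIntegral_domain hf]
  refine setIntegral_congr_fun measurableSet_Icc fun t ht => ?_
  refine integral_integral_swap (f := fun x θ => f (t, x, θ)) ?_
  rw [Measure.prod_restrict]
  refine ContinuousOn.integrableOn_compact (isCompact_cell.prod isCompact_Icc)
    (hf.comp (by fun_prop) fun y hy => ⟨ht, hy⟩)

theorem setIntegral_Icc_eq_zero {t₁ t₂ : ℝ} {f : ℝ → ℝ} (h : ∀ t ∈ Ioo t₁ t₂, f t = 0) :
    ∫ t in Icc t₁ t₂, f t = 0 := by
  rw [integral_Icc_eq_integral_Ioo]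
  exact setIntegral_eq_zero_of_forall_eq_zero h

theorem setIntegral_Icc_fderiv {a b : ℝ} (hab : a ≤ b) {X : Type*} [NormedAddCommGroup X]
    [NormedSpace ℝ X] {f : X → ℝ} {O : Set X} (hO : IsOpen O) (hf : ContDiffOn ℝ 1 f O)
    {c : ℝ → X} {e : X} (hc : ∀ s, HasDerivAt c e s) (hcO : ∀ s ∈ Icc a b, c s ∈ O) :
    ∫ s in Icc a b, fderiv ℝ f (c s) e = f (c b) - f (c a) := by
  rw [integral_Icc_eq_integral_Ioc, ← intervalIntegral.integral_of_le hab]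
  have hcc : Continuous c := continuous_iff_continuousAt.2 fun s => (hc s).continuousAt
  refine intervalIntegral.integral_eq_sub_of_hasDerivAt (f := fun s => f (c s)) (fun s hs => ?_) ?_
  · rw [uIcc_of_le hab] at hs
    exact ((hf.contDiffAt (hO.mem_nhds (hcO s hs))).differentiableAt
      one_ne_zero).hasFDerivAt.comp_hasDerivAt s (hc s)
  · refine ContinuousOn.intervalIntegrable ?_
    rw [uIcc_of_le hab]
    exact ((hf.continuousOn_fderiv_of_isOpen hO le_rfl).clm_apply continuousOn_const).comp
      hcc.continuousOn hcO

theorem insertNth_add_lat (i : Fin 3) (y : Fin 2 → ℝ) :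
    (i.insertNth (2 * Real.pi) y : Vec3) = i.insertNth 0 y + lat (Pi.single i 1) := by
  refine (Fin.insertNth_eq_iff).2 ⟨by simp [lat], ?_⟩
  funext j
  simp [Fin.removeNth, lat]

/-- The integral over the torus of a divergence vanishes. -/
theorem setIntegral_cell_div {f : Fin 3 → Vec3 → ℝ} {O : Set Vec3} (hO : IsOpen O)
    (hf : ∀ i, ContDiffOn ℝ 1 (f i) O) (hcO : cell ⊆ O)
    (hper : ∀ i x, f i (x + lat (Pi.single i 1)) = f i x) :
    ∫ x in cell, ∑ i, fderiv ℝ (f i) x (Pi.single i 1) = 0 := by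
  have h := integral_divergence_of_hasFDerivAt_off_countable' (n := 2) (0 : Vec3)
    (fun _ => 2 * Real.pi) (fun _ => Real.two_pi_pos.le) f (fun i x => fderiv ℝ (f i) x) ∅
    countable_empty (fun i => (hf i).continuousOn.mono hcO) ?_ ?_
  · refine h.trans (Finset.sum_eq_zero fun i _ => ?_)
    have : ∀ y, f i (i.insertNth (2 * Real.pi) y) = f i (i.insertNth ((0 : Vec3) i) y) := fun y => by
      rw [insertNth_add_lat, hper]; rfl
    simp only [this, sub_self]
  · rintro x ⟨hx, -⟩ i
    have hxc : x ∈ cell := ⟨fun i => (hx i trivial).1.le, fun i => (hx i trivial).2.le⟩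
    exact (((hf i).contDiffAt (hO.mem_nhds (hcO hxc))).differentiableAt one_ne_zero).hasFDerivAt
  · refine ContinuousOn.integrableOn_compact isCompact_cell (continuousOn_finsetSum _ fun i _ => ?_)
    exact (((hf i).continuousOn_fderiv_of_isOpen hO le_rfl).clm_apply continuousOn_const).mono hcO

/-- The integral of a space-time divergence vanishes if the temporal component vanishes at the
initial and final times, and the other components are periodic. -/
theorem setIntegral_domain_div {t₁ t₂ : ℝ} (ht : t₁ ≤ t₂) {A C : STL → ℝ} {B : Fin 3 → STL → ℝ}
    {O : Set STL} (hO : IsOpen O) (hKO : ∀ t ∈ Icc t₁ t₂, ∀ y, (t, y) ∈ O)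
    (hA : ContDiffOn ℝ 1 A O) (hB : ∀ i, ContDiffOn ℝ 1 (B i) O) (hC : ContDiffOn ℝ 1 C O)
    (hA₁ : ∀ y, A (t₁, y) = 0) (hA₂ : ∀ y, A (t₂, y) = 0)
    (hBper : ∀ i, ∀ t ∈ Ioo t₁ t₂, ∀ x θ, B i (t, x + lat (Pi.single i 1), θ) = B i (t, x, θ))
    (hCper : ∀ t ∈ Ioo t₁ t₂, ∀ x θ, C (t, x, θ + 2 * Real.pi) = C (t, x, θ)) :
    ∫ z in domain t₁ t₂, (fderiv ℝ A z (1, 0, 0)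
      + ∑ i, fderiv ℝ (B i) z (0, Pi.single i 1, 0) + fderiv ℝ C z (0, 0, 1)) = 0 := by
  have hcont : ∀ {f : STL → ℝ}, ContDiffOn ℝ 1 f O → ∀ e : STL,
      ContinuousOn (fun z => fderiv ℝ f z e) (domain t₁ t₂) := fun hf e =>
    ((hf.continuousOn_fderiv_of_isOpen hO le_rfl).clm_apply continuousOn_const).mono
      fun z hz => hKO z.1 hz.1 z.2
  have hint : ∀ {f : STL → ℝ}, ContinuousOn f (domain t₁ t₂) → IntegrableOn f (domain t₁ t₂) :=
    fun hf => hf.integrableOn_compact (isCompact_domain t₁ t₂)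
  have hBc : ContinuousOn (fun z => ∑ i, fderiv ℝ (B i) z (0, Pi.single i 1, 0)) (domain t₁ t₂) :=
    continuousOn_finsetSum _ fun i _ => hcont (hB i) _
  have h1 : ∫ z in domain t₁ t₂, fderiv ℝ A z (1, 0, 0) = 0 := by
    rw [setIntegral_domain_eq_time_last (hcont hA _)]
    refine integral_eq_zero_of_ae (Eventually.of_forall fun y => ?_)
    refine (setIntegral_Icc_fderiv ht hO hA (c := fun t => (t, y)) (e := (1, 0, 0)) (fun t =>
      (hasDerivAt_id t).prodMk (hasDerivAt_const t y)) fun t h => hKO t h y).trans ?_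
    simp [hA₁, hA₂]
  have h2 : ∫ z in domain t₁ t₂, ∑ i, fderiv ℝ (B i) z (0, Pi.single i 1, 0) = 0 := by
    rw [setIntegral_domain_eq_space_last hBc]
    refine setIntegral_Icc_eq_zero fun t h => ?_
    have hT := Ioo_subset_Icc_self h
    refine integral_eq_zero_of_ae (Eventually.of_forall fun θ => ?_)
    have hd : ∀ x : Vec3, HasFDerivAt (fun x : Vec3 => ((t, x, θ) : STL))
        ((ContinuousLinearMap.inr ℝ ℝ (Vec3 × ℝ)).comp (ContinuousLinearMap.inl ℝ Vec3 ℝ)) x :=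
      fun x => (hasFDerivAt_prodMk_right t (x, θ)).comp x (hasFDerivAt_prodMk_left x θ)
    have hsm : ContDiff ℝ 1 (fun x : Vec3 => ((t, x, θ) : STL)) := by fun_prop
    have hz := setIntegral_cell_div (f := fun i x => B i (t, x, θ)) isOpen_univ
      (fun i => (hB i).comp hsm.contDiffOn fun x _ => hKO t hT _) (subset_univ _)
      (fun i x => hBper i t h x θ)
    refine Eq.trans (integral_congr_ae (Eventually.of_forall fun x => ?_)) hz
    refine Finset.sum_congr rfl fun i _ => ?_
    have := ((((hB i).contDiffAt (hO.mem_nhds (hKO t hT (x, θ)))).differentiableAt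
      one_ne_zero).hasFDerivAt.comp x (hd x)).fderiv
    have h' := congrArg (fun l : Vec3 →L[ℝ] ℝ => l (Pi.single i 1)) this
    exact h'.symm
  have h3 : ∫ z in domain t₁ t₂, fderiv ℝ C z (0, 0, 1) = 0 := by
    rw [setIntegral_domain (hcont hC _)]
    refine setIntegral_Icc_eq_zero fun t h => ?_
    refine integral_eq_zero_of_ae (Eventually.of_forall fun x => ?_)
    refine (setIntegral_Icc_fderiv Real.two_pi_pos.le hO hC (c := fun θ => (t, x, θ))
      (e := (0, 0, 1)) (fun θ => (hasDerivAt_const θ t).prodMk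
        ((hasDerivAt_const θ x).prodMk (hasDerivAt_id θ))) fun θ _ =>
          hKO t (Ioo_subset_Icc_self h) _).trans ?_
    have := hCper t h x 0
    rw [zero_add] at this
    simp [this]
  refine (integral_add ((hint (hcont hA _)).add (hint hBc)) (hint (hcont hC _))).trans ?_
  rw [h3, add_zero]
  refine (integral_add (hint (hcont hA _)) (hint hBc)).trans ?_
  rw [h1, h2, add_zero]

theorem domain_subset_closure_interior {t₁ t₂ : ℝ} (ht : t₁ < t₂) :
    domain t₁ t₂ ⊆ closure (interior (domain t₁ t₂)) := by
  have hconv : Convex ℝ (domain t₁ t₂) :=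
    (convex_Icc _ _).prod ((convex_Icc _ _).prod (convex_Icc _ _))
  rw [hconv.closure_interior_eq_closure_of_nonempty_interior]
  · exact subset_closure
  · rw [domain, interior_prod_eq, interior_prod_eq, interior_Icc, interior_Icc, cell,
      ← pi_univ_Icc, interior_pi_set finite_univ]
    simp only [interior_Icc]
    exact (nonempty_Ioo.2 ht).prod ((univ_pi_nonempty_iff.2 fun i =>
      nonempty_Ioo.2 Real.two_pi_pos).prod (nonempty_Ioo.2 Real.two_pi_pos))

theorem eq_zero_of_setIntegral_domain_eq_zero {t₁ t₂ : ℝ} (ht : t₁ < t₂) {f : STL → ℝ}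
    (hf : ContinuousOn f (domain t₁ t₂)) (h0 : ∀ z ∈ domain t₁ t₂, 0 ≤ f z)
    (hint : ∫ z in domain t₁ t₂, f z = 0) : ∀ z ∈ domain t₁ t₂, f z = 0 := by
  have hK := (isCompact_domain t₁ t₂).measurableSet
  have hae : f =ᵐ[volume.restrict (domain t₁ t₂)] 0 := by
    refine (setIntegral_eq_zero_iff_of_nonneg_ae ?_
      (hf.integrableOn_compact (isCompact_domain t₁ t₂))).1 hint
    exact (ae_restrict_mem hK).mono h0
  exact Measure.eqOn_of_ae_eq hae hf continuousOn_const (domain_subset_closure_interior ht)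

/-! ### Commuting derivations attached to a phase function -/

/-- Points `(ε, t, x, θ)`: the variation parameter, time, position and loop parameter. -/
abbrev Ext := ℝ × STL

/-- The direction of the variation parameter. -/
def eEps : Ext := (1, 0, 0, 0)

/-- The direction of time. -/
def eTime : Ext := (0, 1, 0, 0)

/-- The `i`-th spatial direction. -/
def eSpace (i : Fin 3) : Ext := (0, 0, Pi.single i 1, 0)

/-- The direction of the loop parameter. -/
def eLoop : Ext := (0, 0, 0, 1)

/-- The vector field `a + (∂_a S) ∂_θ`. -/
noncomputable def lift (S : Ext → ℝ) (a : Ext) (w : Ext) : Ext := a + fderiv ℝ S w a • eLoop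

theorem contDiff_lift {S : Ext → ℝ} (hS : ContDiff ℝ ∞ S) (a : Ext) : ContDiff ℝ ∞ (lift S a) :=
  contDiff_const.add (((hS.fderiv_right (m := ∞) (by simp)).clm_apply contDiff_const).smul
    contDiff_const)

theorem fderiv_apply_eq_zero_of_invariant {f : Ext → ℝ} {w e : Ext} (hf : DifferentiableAt ℝ f w)
    (h : ∀ s : ℝ, f (w + s • e) = f w) : fderiv ℝ f w e = 0 := by
  rw [← hf.lineDeriv_eq_fderiv, lineDeriv]
  simp [h]

theorem fderiv_lift_apply {S : Ext → ℝ} (hS : ContDiff ℝ ∞ S)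
    (hinv : ∀ w (s : ℝ), S (w + s • eLoop) = S w) (a b w : Ext) :
    fderiv ℝ (lift S b) w (lift S a w) = fderiv ℝ (fderiv ℝ S) w a b • eLoop := by
  have hd : ContDiff ℝ ∞ (fderiv ℝ S) := hS.fderiv_right (by simp)
  have hdw : DifferentiableAt ℝ (fderiv ℝ S) w := hd.differentiable (by simp) w
  have h1 : HasFDerivAt (lift S b) (((fderiv ℝ (fderiv ℝ S) w).flip b).smulRight eLoop) w := by
    have := ((hdw.hasFDerivAt.clm_apply (hasFDerivAt_const b w)).smul_const eLoop).const_add b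
    refine this.congr_fderiv ?_
    exact ContinuousLinearMap.ext fun y => by simp
  have h2 : fderiv ℝ (fderiv ℝ S) w eLoop b = 0 := by
    have hdb : DifferentiableAt ℝ (fun w => fderiv ℝ S w b) w :=
      hdw.clm_apply (differentiableAt_const b)
    have h3 := fderiv_apply_eq_zero_of_invariant (e := eLoop) hdb fun s => by
      rw [← fderiv_comp_add_right, funext fun w => hinv w s]
    rw [fderiv_clm_apply hdw (differentiableAt_const b)] at h3
    simpa using h3
  rw [h1.fderiv]
  simp [lift, h2]

theorem bracket_lift {S : Ext → ℝ} (hS : ContDiff ℝ ∞ S)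
    (hinv : ∀ w (s : ℝ), S (w + s • eLoop) = S w) (a b w : Ext) :
    fderiv ℝ (lift S b) w (lift S a w) = fderiv ℝ (lift S a) w (lift S b w) := by
  rw [fderiv_lift_apply hS hinv, fderiv_lift_apply hS hinv]
  have hs : IsSymmSndFDerivAt ℝ S w :=
    hS.contDiffAt.isSymmSndFDerivAt (by simpa using WithTop.coe_le_coe.2 (le_top (a := (2 : ℕ∞))))
  rw [hs.eq]

/-! ### Families of curves of fields -/

/-- `Γ` is a smooth family of curves of fields, with parameter `ε`. -/
structure SmoothFamily (Γ : ℝ → ℝ → Fields) : Prop where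
  smooth_h : ContDiff ℝ ∞ (fun w : Ext => (Γ w.1 w.2.1).h w.2.2.1 w.2.2.2)
  smooth_p : ContDiff ℝ ∞ (fun w : Ext => (Γ w.1 w.2.1).p w.2.2.1 w.2.2.2)
  smooth_rho : ContDiff ℝ ∞ (fun w : Ext => (Γ w.1 w.2.1).rho w.2.2.1 w.2.2.2)
  smooth_chi : ContDiff ℝ ∞ (fun w : Ext => (Γ w.1 w.2.1).chi w.2.2.1 w.2.2.2)
  smooth_S : ContDiff ℝ ∞ (fun w : ℝ × ℝ × Vec3 => (Γ w.1 w.2.1).S w.2.2)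

theorem IsVariation.smoothFamily {t₁ t₂ : ℝ} {γ : ℝ → Fields} {Γ : ℝ → ℝ → Fields}
    (h : IsVariation t₁ t₂ γ Γ) : SmoothFamily Γ :=
  ⟨h.smooth_h, h.smooth_p, h.smooth_rho, h.smooth_chi, h.smooth_S⟩

/-- The components of `h` as functions on `Ext`. -/
def fH (Γ : ℝ → ℝ → Fields) (j : Fin 3) (w : Ext) : ℝ := (Γ w.1 w.2.1).h w.2.2.1 w.2.2.2 j

/-- The components of `p` as functions on `Ext`. -/
def fP (Γ : ℝ → ℝ → Fields) (j : Fin 3) (w : Ext) : ℝ := (Γ w.1 w.2.1).p w.2.2.1 w.2.2.2 j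

/-- The density as a function on `Ext`. -/
def fRho (Γ : ℝ → ℝ → Fields) (w : Ext) : ℝ := (Γ w.1 w.2.1).rho w.2.2.1 w.2.2.2

/-- The field `χ` as a function on `Ext`. -/
def fChi (Γ : ℝ → ℝ → Fields) (w : Ext) : ℝ := (Γ w.1 w.2.1).chi w.2.2.1 w.2.2.2

/-- The phase as a function on `Ext`. -/
def fS (Γ : ℝ → ℝ → Fields) (w : Ext) : ℝ := (Γ w.1 w.2.1).S w.2.2.1

theorem fS_add_smul_eLoop (Γ : ℝ → ℝ → Fields) (w : Ext) (s : ℝ) :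
    fS Γ (w + s • eLoop) = fS Γ w := by
  simp [fS, eLoop]

/-- The values of `(p, ρ, ∇^S ρ)`. -/
noncomputable def phase (Γ : ℝ → ℝ → Fields) (w : Ext) : Vec3 × ℝ × Vec3 :=
  (fun i => fP Γ i w, fRho Γ w, fun i => fderiv ℝ (fRho Γ) w (lift (fS Γ) (eSpace i) w))

/-- The matrix `∇^S h`. -/
noncomputable def jac (Γ : ℝ → ℝ → Fields) (w : Ext) : Matrix (Fin 3) (Fin 3) ℝ :=
  Matrix.of fun i j => fderiv ℝ (fH Γ j) w (lift (fS Γ) (eSpace i) w)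

namespace SmoothFamily

variable {Γ : ℝ → ℝ → Fields}

theorem contDiff_fH (hΓ : SmoothFamily Γ) (j : Fin 3) : ContDiff ℝ ∞ (fH Γ j) := contDiff_pi.1 hΓ.smooth_h j

theorem contDiff_fP (hΓ : SmoothFamily Γ) (j : Fin 3) : ContDiff ℝ ∞ (fP Γ j) := contDiff_pi.1 hΓ.smooth_p j

theorem contDiff_fRho (hΓ : SmoothFamily Γ) : ContDiff ℝ ∞ (fRho Γ) := hΓ.smooth_rho

theorem contDiff_fChi (hΓ : SmoothFamily Γ) : ContDiff ℝ ∞ (fChi Γ) := hΓ.smooth_chi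

theorem contDiff_fS (hΓ : SmoothFamily Γ) : ContDiff ℝ ∞ (fS Γ) :=
  hΓ.smooth_S.comp (by fun_prop : ContDiff ℝ ∞ fun w : Ext => (w.1, w.2.1, w.2.2.1))

theorem contDiff_lie (hΓ : SmoothFamily Γ) {f : Ext → ℝ} (hf : ContDiff ℝ ∞ f) (a : Ext) :
    ContDiff ℝ ∞ fun w => fderiv ℝ f w (lift (fS Γ) a w) :=
  (hf.fderiv_right (m := ∞) (by simp)).clm_apply (contDiff_lift hΓ.contDiff_fS a)

theorem contDiff_phase (hΓ : SmoothFamily Γ) : ContDiff ℝ ∞ (phase Γ) :=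
  (contDiff_pi.2 hΓ.contDiff_fP).prodMk (hΓ.contDiff_fRho.prodMk
    (contDiff_pi.2 fun i => hΓ.contDiff_lie hΓ.contDiff_fRho (eSpace i)))

theorem continuous_jac (hΓ : SmoothFamily Γ) : Continuous (jac Γ) :=
  continuous_matrix fun i j => (hΓ.contDiff_lie (hΓ.contDiff_fH j) (eSpace i)).continuous

/-- The open set of points where `ρ > 0` and `∇^S h` is invertible. -/
noncomputable def regular (hΓ : SmoothFamily Γ) : TopologicalSpace.Opens Ext :=
  ⟨{w | 0 < fRho Γ w ∧ (jac Γ w).det ≠ 0},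
    (isOpen_lt continuous_const hΓ.contDiff_fRho.continuous).inter
      (isOpen_ne_fun hΓ.continuous_jac.matrix_det continuous_const)⟩

end SmoothFamily

/-! ### The fields as elements of a differential ring -/

namespace SmoothFamily

variable {Γ : ℝ → ℝ → Fields} (hΓ : SmoothFamily Γ)

/-- The derivation `∂_a + (∂_a S) ∂_θ` on smooth functions. -/
noncomputable def dd (a : Ext) : Derivation ℝ (SmoothFun hΓ.regular) (SmoothFun hΓ.regular) :=
  SmoothFun.der (lift (fS Γ) a) (contDiff_lift hΓ.contDiff_fS a)

theorem dd_comm (a b : Ext) (f : SmoothFun hΓ.regular) :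
    hΓ.dd a (hΓ.dd b f) = hΓ.dd b (hΓ.dd a f) :=
  SmoothFun.der_comm _ _ (bracket_lift hΓ.contDiff_fS (fS_add_smul_eLoop Γ) a b) f

theorem ev_dd (a : Ext) {f : SmoothFun hΓ.regular} {F : Ext → ℝ}
    (hF : ∀ u : hΓ.regular, F u = SmoothFun.ev u f) (u : hΓ.regular) :
    SmoothFun.ev u (hΓ.dd a f) = fderiv ℝ F u (lift (fS Γ) a u) :=
  SmoothFun.ev_der _ _ hF u

/-- The restriction of a smooth function to the set of regular points. -/
noncomputable def el (f : Ext → ℝ) (hf : ContDiff ℝ ∞ f) : SmoothFun hΓ.regular := SmoothFun.mk f hf.contDiffOn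

theorem ev_el {f : Ext → ℝ} (hf : ContDiff ℝ ∞ f) (u : hΓ.regular) :
    SmoothFun.ev u (hΓ.el f hf) = f u := rfl

theorem ev_dd_el (a : Ext) {f : Ext → ℝ} (hf : ContDiff ℝ ∞ f) (u : hΓ.regular) :
    SmoothFun.ev u (hΓ.dd a (hΓ.el f hf)) = fderiv ℝ f u (lift (fS Γ) a u) :=
  hΓ.ev_dd a (fun _ => rfl) u

/-- The labels as ring elements. -/
noncomputable def elH (j : Fin 3) : SmoothFun hΓ.regular := hΓ.el (fH Γ j) (hΓ.contDiff_fH j)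

/-- The matrix `∇^S h` over the ring of smooth functions. -/
noncomputable def jacMatrix : Matrix (Fin 3) (Fin 3) (SmoothFun hΓ.regular) :=
  Matrix.of fun i j => hΓ.dd (eSpace i) (hΓ.elH j)

theorem map_jacMatrix (u : hΓ.regular) : (SmoothFun.ev u).mapMatrix hΓ.jacMatrix = jac Γ u := by
  ext i j
  exact hΓ.ev_dd_el _ _ u

theorem isUnit_jacMatrix : IsUnit hΓ.jacMatrix := by
  rw [Matrix.isUnit_iff_isUnit_det]
  refine SmoothFun.isUnit_of_ev_ne_zero fun u => ?_
  rw [RingHom.map_det, map_jacMatrix]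
  exact u.2.2

/-- The vector `ξ = -δh · (∇^S h)⁻¹`, for a derivation `δ`. -/
noncomputable def disp (δ : Derivation ℝ (SmoothFun hΓ.regular) (SmoothFun hΓ.regular))
    (k : Fin 3) : SmoothFun hΓ.regular :=
  -(Matrix.vecMul (fun j => δ (hΓ.elH j)) hΓ.jacMatrix⁻¹) k

theorem sum_disp (δ : Derivation ℝ (SmoothFun hΓ.regular) (SmoothFun hΓ.regular)) (j : Fin 3) :
    ∑ k, hΓ.disp δ k * hΓ.dd (eSpace k) (hΓ.elH j) = -δ (hΓ.elH j) := by
  have h : Matrix.vecMul (-(Matrix.vecMul (fun j => δ (hΓ.elH j)) hΓ.jacMatrix⁻¹)) hΓ.jacMatrix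
      = -fun j => δ (hΓ.elH j) := by
    rw [Matrix.neg_vecMul, Matrix.vecMul_vecMul, Matrix.nonsing_inv_mul _
      ((Matrix.isUnit_iff_isUnit_det _).1 hΓ.isUnit_jacMatrix), Matrix.vecMul_one]
  exact congrFun h j

theorem ev_disp (δ : Derivation ℝ (SmoothFun hΓ.regular) (SmoothFun hΓ.regular)) (k : Fin 3)
    (u : hΓ.regular) : SmoothFun.ev u (hΓ.disp δ k)
      = -(Matrix.vecMul (fun j => SmoothFun.ev u (δ (hΓ.elH j))) (jac Γ u)⁻¹) k := by
  have hu : IsUnit (jac Γ u).det := isUnit_iff_ne_zero.2 u.2.2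
  have h : Matrix.vecMul (fun k => SmoothFun.ev u (hΓ.disp δ k)) (jac Γ u)
      = -fun j => SmoothFun.ev u (δ (hΓ.elH j)) := by
    funext j
    have := congrArg (SmoothFun.ev u) (hΓ.sum_disp δ j)
    simp only [map_sum, map_mul, map_neg] at this
    rw [← map_jacMatrix]
    exact this
  have h2 := congrArg (fun x => Matrix.vecMul x (jac Γ u)⁻¹) h
  simp only [Matrix.vecMul_vecMul, Matrix.mul_nonsing_inv _ hu, Matrix.vecMul_one,
    Matrix.neg_vecMul] at h2
  exact congrFun h2 k

theorem jacMatrix_injective (y : Fin 3 → SmoothFun hΓ.regular)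
    (hy : ∀ j, ∑ k, y k * hΓ.dd (eSpace k) (hΓ.elH j) = 0) (k : Fin 3) : y k = 0 := by
  have h : Matrix.vecMul y hΓ.jacMatrix = 0 := funext hy
  have h2 := congrArg (fun x => Matrix.vecMul x hΓ.jacMatrix⁻¹) h
  simp only [Matrix.vecMul_vecMul, Matrix.mul_nonsing_inv _
    ((Matrix.isUnit_iff_isUnit_det _).1 hΓ.isUnit_jacMatrix), Matrix.vecMul_one,
    Matrix.zero_vecMul] at h2
  exact congrFun h2 k

/-- A smooth function of `(p, ρ, ∇^S ρ)` as a ring element. -/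
noncomputable def comp (G : Vec3 × ℝ × Vec3 → ℝ) (hG : ContDiffOn ℝ ∞ G posDensity) :
    SmoothFun hΓ.regular :=
  SmoothFun.mk (fun w => G (phase Γ w)) (hG.comp hΓ.contDiff_phase.contDiffOn fun _ hw => hw.1)

theorem ev_comp (G : Vec3 × ℝ × Vec3 → ℝ) (hG : ContDiffOn ℝ ∞ G posDensity) (u : hΓ.regular) :
    SmoothFun.ev u (hΓ.comp G hG) = G (phase Γ u) := rfl

end SmoothFamily

theorem contDiffOn_fderiv_posDensity {G : Vec3 × ℝ × Vec3 → ℝ} (hG : ContDiffOn ℝ ∞ G posDensity)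
    (a : Vec3 × ℝ × Vec3) : ContDiffOn ℝ ∞ (fun z => fderiv ℝ G z a) posDensity :=
  (hG.fderiv_of_isOpen isOpen_posDensity (by simp)).clm_apply contDiffOn_const

namespace SmoothFamily

variable {Γ : ℝ → ℝ → Fields} (hΓ : SmoothFamily Γ)

/-- The fluid data given by a family of curves of fields. -/
noncomputable def data {G : Vec3 × ℝ × Vec3 → ℝ} (hG : ContDiffOn ℝ ∞ G posDensity) :
    FluidData (SmoothFun hΓ.regular) where
  dt := hΓ.dd eTime
  d i := hΓ.dd (eSpace i)
  h := hΓ.elH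
  p j := hΓ.el (fP Γ j) (hΓ.contDiff_fP j)
  rho := hΓ.el (fRho Γ) hΓ.contDiff_fRho
  chi := hΓ.el (fChi Γ) hΓ.contDiff_fChi
  v := hΓ.disp (hΓ.dd eTime)
  ham := hΓ.comp G hG
  hamP i := hΓ.comp _ (contDiffOn_fderiv_posDensity hG (Pi.single i 1, 0, 0))
  hamR := hΓ.comp _ (contDiffOn_fderiv_posDensity hG (0, 1, 0))
  hamQ i := hΓ.comp _ (contDiffOn_fderiv_posDensity hG (0, 0, Pi.single i 1))

variable {G : Vec3 × ℝ × Vec3 → ℝ} (hG : ContDiffOn ℝ ∞ G posDensity)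

theorem dd_ham (a : Ext) : hΓ.dd a (hΓ.data hG).ham
    = ∑ i, (hΓ.data hG).hamP i * hΓ.dd a ((hΓ.data hG).p i)
      + (hΓ.data hG).hamR * hΓ.dd a (hΓ.data hG).rho
      + ∑ i, (hΓ.data hG).hamQ i * hΓ.dd a ((hΓ.data hG).d i (hΓ.data hG).rho) := by
  refine SmoothFun.ext_ev fun u => ?_
  have hrho : ∀ i, ∀ u : hΓ.regular, fderiv ℝ (fRho Γ) u (lift (fS Γ) (eSpace i) u)
      = SmoothFun.ev u (hΓ.dd (eSpace i) (hΓ.el (fRho Γ) hΓ.contDiff_fRho)) := fun i u =>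
    (hΓ.ev_dd_el _ _ u).symm
  simp only [data, map_add, map_sum, map_mul]
  rw [hΓ.ev_dd a (F := fun w => G (phase Γ w)) (fun _ => rfl)]
  have hrho' := fun i => hΓ.ev_dd a
    (F := fun w => fderiv ℝ (fRho Γ) w (lift (fS Γ) (eSpace i) w)) (hrho i) u
  simp only [ev_dd_el, hrho', ev_comp]
  set y := lift (fS Γ) a u
  have hGd : HasFDerivAt G (fderiv ℝ G (phase Γ u)) (phase Γ u) :=
    ((hG.contDiffAt (isOpen_posDensity.mem_nhds u.2.1)).differentiableAt (by simp)).hasFDerivAt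
  have hp : HasFDerivAt (fun w => fun i => fP Γ i w)
      (ContinuousLinearMap.pi fun i => fderiv ℝ (fP Γ i) u) (u : Ext) :=
    hasFDerivAt_pi.2 fun i => ((hΓ.contDiff_fP i).differentiable (by simp) _).hasFDerivAt
  have hr : HasFDerivAt (fRho Γ) (fderiv ℝ (fRho Γ) u) (u : Ext) :=
    (hΓ.contDiff_fRho.differentiable (by simp) _).hasFDerivAt
  have hq : HasFDerivAt (fun w => fun i => fderiv ℝ (fRho Γ) w (lift (fS Γ) (eSpace i) w))
      (ContinuousLinearMap.pi fun i =>
        fderiv ℝ (fun w => fderiv ℝ (fRho Γ) w (lift (fS Γ) (eSpace i) w)) u) (u : Ext) :=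
    hasFDerivAt_pi.2 fun i =>
      ((hΓ.contDiff_lie hΓ.contDiff_fRho (eSpace i)).differentiable (by simp) _).hasFDerivAt
  have hcomp := hGd.comp (u : Ext) (hp.prodMk (hr.prodMk hq))
  have hval := congrArg (fun l : Ext →L[ℝ] ℝ => l y) hcomp.fderiv
  refine hval.trans ?_
  have hdec : ∀ z : Vec3 × ℝ × Vec3, z = ∑ i, z.1 i • ((Pi.single i 1, 0, 0) : Vec3 × ℝ × Vec3)
      + z.2.1 • ((0, 1, 0) : Vec3 × ℝ × Vec3)
      + ∑ i, z.2.2 i • ((0, 0, Pi.single i 1) : Vec3 × ℝ × Vec3) := by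
    rintro ⟨a, b, c⟩
    refine Prod.ext ?_ (Prod.ext ?_ ?_)
    · funext i
      fin_cases i <;> simp [Fin.sum_univ_three]
    · simp [Fin.sum_univ_three]
    · funext i
      fin_cases i <;> simp [Fin.sum_univ_three]
  rw [ContinuousLinearMap.comp_apply, hdec ((_ : Ext →L[ℝ] Vec3 × ℝ × Vec3) y)]
  simp only [map_add, map_sum, map_smul, smul_eq_mul, ContinuousLinearMap.prod_apply,
    ContinuousLinearMap.coe_pi']
  simp only [mul_comm]

theorem laws : (hΓ.data hG).Laws where
  comm_t _ f := hΓ.dd_comm _ _ f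
  comm _ _ f := hΓ.dd_comm _ _ f
  vel := hΓ.sum_disp _
  injective := hΓ.jacMatrix_injective
  chain _ := hΓ.dd_ham hG _

end SmoothFamily

/-! ### Evaluation of the differential operators -/

theorem hasDerivAt_time {F : Ext → ℝ} {ε t : ℝ} {x : Vec3} {θ : ℝ}
    (hF : DifferentiableAt ℝ F (ε, t, x, θ)) :
    HasDerivAt (fun τ => F (ε, τ, x, θ)) (fderiv ℝ F (ε, t, x, θ) eTime) t :=
  hF.hasFDerivAt.comp_hasDerivAt (f := fun τ => ((ε, τ, x, θ) : Ext)) t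
    ((hasDerivAt_const t ε).prodMk ((hasDerivAt_id t).prodMk (hasDerivAt_const t (x, θ))))

theorem hasDerivAt_loop {F : Ext → ℝ} {ε t : ℝ} {x : Vec3} {θ : ℝ}
    (hF : DifferentiableAt ℝ F (ε, t, x, θ)) :
    HasDerivAt (fun s => F (ε, t, x, s)) (fderiv ℝ F (ε, t, x, θ) eLoop) θ :=
  hF.hasFDerivAt.comp_hasDerivAt (f := fun s => ((ε, t, x, s) : Ext)) θ
    ((hasDerivAt_const θ ε).prodMk ((hasDerivAt_const θ t).prodMk
      ((hasDerivAt_const θ x).prodMk (hasDerivAt_id θ))))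

theorem fderiv_space {F : Ext → ℝ} {ε t : ℝ} {x : Vec3} {θ : ℝ}
    (hF : DifferentiableAt ℝ F (ε, t, x, θ)) (i : Fin 3) :
    fderiv ℝ (fun y => F (ε, t, y, θ)) x (Pi.single i 1)
      = fderiv ℝ F (ε, t, x, θ) (eSpace i) := by
  have h : HasFDerivAt (fun y : Vec3 => ((ε, t, y, θ) : Ext)) _ x :=
    (hasFDerivAt_prodMk_right (𝕜 := ℝ) ε (t, x, θ)).comp x
      ((hasFDerivAt_prodMk_right (𝕜 := ℝ) t (x, θ)).comp x
        (hasFDerivAt_prodMk_left (𝕜 := ℝ) x θ))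
  exact congrArg (fun l : Vec3 →L[ℝ] ℝ => l (Pi.single i 1)) (hF.hasFDerivAt.comp x h).fderiv

theorem fderiv_lift (F S : Ext → ℝ) (a w : Ext) :
    fderiv ℝ F w (lift S a w) = fderiv ℝ F w a + fderiv ℝ S w a * fderiv ℝ F w eLoop := by
  rw [lift, map_add, map_smul, smul_eq_mul]

namespace SmoothFamily

variable {Γ : ℝ → ℝ → Fields} (hΓ : SmoothFamily Γ)

theorem differentiableAt_fS (hΓ : SmoothFamily Γ) (w : Ext) : DifferentiableAt ℝ (fS Γ) w :=
  hΓ.contDiff_fS.differentiable (by simp) w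

theorem dSpaceS_eq (hΓ : SmoothFamily Γ) {F : Ext → ℝ} {g : Vec3 → ℝ → ℝ} {ε t : ℝ}
    (hg : ∀ y s, g y s = F (ε, t, y, s)) {x : Vec3} {θ : ℝ}
    (hF : DifferentiableAt ℝ F (ε, t, x, θ)) (i : Fin 3) :
    dSpaceS (Γ ε t).S i g x θ
      = fderiv ℝ F (ε, t, x, θ) (lift (fS Γ) (eSpace i) (ε, t, x, θ)) := by
  have h1 : grad (Γ ε t).S x i = fderiv ℝ (fS Γ) (ε, t, x, θ) (eSpace i) :=
    fderiv_space (hΓ.differentiableAt_fS (ε, t, x, θ)) i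
  obtain rfl : g = fun y s => F (ε, t, y, s) := funext fun y => funext fun s => hg y s
  rw [fderiv_lift, dSpaceS, dTheta, h1, fderiv_space hF, (hasDerivAt_loop hF).deriv, smul_eq_mul]

theorem dTimeS_eq (hΓ : SmoothFamily Γ) {F : Ext → ℝ} {g : ℝ → Vec3 → ℝ → ℝ} {ε : ℝ}
    (hg : ∀ τ y s, g τ y s = F (ε, τ, y, s)) {t : ℝ} {x : Vec3} {θ : ℝ}
    (hF : DifferentiableAt ℝ F (ε, t, x, θ)) :
    dTimeS (fun τ => (Γ ε τ).S) g t x θ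
      = fderiv ℝ F (ε, t, x, θ) (lift (fS Γ) eTime (ε, t, x, θ)) := by
  have h1 : deriv (fun τ => (Γ ε τ).S x) t = fderiv ℝ (fS Γ) (ε, t, x, θ) eTime :=
    (hasDerivAt_time (hΓ.differentiableAt_fS (ε, t, x, θ))).deriv
  obtain rfl : g = fun τ y s => F (ε, τ, y, s) :=
    funext fun τ => funext fun y => funext fun s => hg τ y s
  rw [fderiv_lift, dTimeS, dTheta, h1, (hasDerivAt_time hF).deriv, (hasDerivAt_loop hF).deriv,
    smul_eq_mul]

theorem dTimeS_pi_apply (hΓ : SmoothFamily Γ) (ε t : ℝ) (x : Vec3) (θ : ℝ) (j : Fin 3) :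
    dTimeS (fun τ => (Γ ε τ).S) (fun τ => (Γ ε τ).h) t x θ j
      = fderiv ℝ (fH Γ j) (ε, t, x, θ) (lift (fS Γ) eTime (ε, t, x, θ)) := by
  have hd : ∀ j, DifferentiableAt ℝ (fH Γ j) (ε, t, x, θ) := fun j =>
    (hΓ.contDiff_fH j).differentiable (by simp) _
  rw [← hΓ.dTimeS_eq (g := fun τ y s => (Γ ε τ).h y s j) (fun _ _ _ => rfl) (hd j)]
  have h1 : deriv (fun τ => (Γ ε τ).h x θ) t = fun j => deriv (fun τ => (Γ ε τ).h x θ j) t :=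
    deriv_pi fun j => (hasDerivAt_time (hd j)).differentiableAt
  have h2 : deriv (fun s => (Γ ε t).h x s) θ = fun j => deriv (fun s => (Γ ε t).h x s j) θ :=
    deriv_pi fun j => (hasDerivAt_loop (hd j)).differentiableAt
  simp only [dTimeS, dTheta, Pi.add_apply, Pi.smul_apply, h1, h2]

theorem jacS_eq (hΓ : SmoothFamily Γ) (ε t : ℝ) (x : Vec3) (θ : ℝ) :
    jacS (Γ ε t).S (Γ ε t).h x θ = jac Γ (ε, t, x, θ) := by
  ext i j
  exact hΓ.dSpaceS_eq (fun _ _ => rfl) ((hΓ.contDiff_fH j).differentiable (by simp) _) i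

theorem mem_regular_iff (ε t : ℝ) (x : Vec3) (θ : ℝ) :
    (ε, t, x, θ) ∈ hΓ.regular ↔
      0 < (Γ ε t).rho x θ ∧ IsUnit (jacS (Γ ε t).S (Γ ε t).h x θ) := by
  rw [Matrix.isUnit_iff_isUnit_det, isUnit_iff_ne_zero, hΓ.jacS_eq]
  rfl

theorem gradS_rho_eq (hΓ : SmoothFamily Γ) (ε t : ℝ) (x : Vec3) (θ : ℝ) :
    gradS (Γ ε t).S (Γ ε t).rho x θ = (phase Γ (ε, t, x, θ)).2.2 :=
  funext fun i => hΓ.dSpaceS_eq (fun _ _ => rfl) (hΓ.contDiff_fRho.differentiable (by simp) _) i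

/-- The operators `∇^S_i` act as the derivations of the ring, provided that the whole slice
`(ε, t)` is regular. -/
theorem dSpaceS_eq_ev {f : SmoothFun hΓ.regular} {g : Vec3 → ℝ → ℝ} {ε t : ℝ}
    (hreg : ∀ y s, (ε, t, y, s) ∈ hΓ.regular)
    (hg : ∀ y s, g y s = SmoothFun.ev ⟨_, hreg y s⟩ f) (i : Fin 3) (x : Vec3) (θ : ℝ) :
    dSpaceS (Γ ε t).S i g x θ = SmoothFun.ev ⟨_, hreg x θ⟩ (hΓ.dd (eSpace i) f) := by
  rw [hΓ.dSpaceS_eq (F := SmoothFun.rep f) (fun y s => ?_)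
    ((SmoothFun.contDiffAt_rep f ⟨_, hreg x θ⟩).differentiableAt (by simp)),
    hΓ.ev_dd _ (SmoothFun.rep_eq_ev f)]
  rw [hg, SmoothFun.rep_eq_ev f ⟨_, hreg y s⟩]

theorem vel_eq_ev (ε t : ℝ) (x : Vec3) (θ : ℝ) (hw : (ε, t, x, θ) ∈ hΓ.regular) (k : Fin 3) :
    vel (Γ ε t) (velocity (Γ ε) t) x θ k
      = SmoothFun.ev ⟨_, hw⟩ (hΓ.disp (hΓ.dd eTime) k) := by
  rw [ev_disp, vel, hΓ.jacS_eq]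
  have : (velocity (Γ ε) t).h x θ + (velocity (Γ ε) t).S x • dTheta (Γ ε t).h x θ
      = fun j => SmoothFun.ev ⟨(ε, t, x, θ), hw⟩ (hΓ.dd eTime (hΓ.elH j)) := by
    funext j
    exact (hΓ.dTimeS_pi_apply ε t x θ j).trans (hΓ.ev_dd_el _ (hΓ.contDiff_fH j) ⟨_, hw⟩).symm
  rw [this]
  rfl

variable {H : Vec3 → ℝ → Vec3 → ℝ}
  (hH : ContDiffOn ℝ ∞ (fun z : Vec3 × ℝ × Vec3 => H z.1 z.2.1 z.2.2) posDensity)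

theorem lagrangianDensity_eq_ev (ε t : ℝ) (x : Vec3) (θ : ℝ)
    (hw : (ε, t, x, θ) ∈ hΓ.regular) :
    lagrangianDensity H (Γ ε t) (velocity (Γ ε) t) x θ
      = SmoothFun.ev ⟨_, hw⟩ (hΓ.data hH).lag := by
  have hchi : DifferentiableAt ℝ (fChi Γ) (ε, t, x, θ) :=
    hΓ.contDiff_fChi.differentiable (by simp) _
  have h1 : dTimeS (fun τ => (Γ ε τ).S) (fun τ => (Γ ε τ).chi) t x θ = _ :=
    hΓ.dTimeS_eq (fun _ _ _ => rfl) hchi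
  have h2 : ∀ i, gradS (Γ ε t).S (Γ ε t).chi x θ i = _ := fun i =>
    hΓ.dSpaceS_eq (fun _ _ => rfl) hchi i
  have h3 : ∀ {f : Ext → ℝ} (hf : ContDiff ℝ ∞ f), SmoothFun.ev ⟨(ε, t, x, θ), hw⟩ (hΓ.el f hf)
      = f (ε, t, x, θ) := fun hf => rfl
  simp only [FluidData.lag, data, map_add, map_sub, map_mul, map_sum, ev_dd_el, ← h1, ← h2,
    ← vel_eq_ev, h3, ev_comp]
  rw [lagrangianDensity, hΓ.gradS_rho_eq]
  simp only [dotProduct, dTimeS, velocity, fP, fRho, phase, smul_eq_mul]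
  ring

theorem hasFDerivAt_phase {G : Vec3 × ℝ × Vec3 → ℝ} (hG : ContDiffOn ℝ ∞ G posDensity) {w : Ext}
    (hw : w ∈ hΓ.regular) : HasFDerivAt G (fderiv ℝ G (phase Γ w)) (phase Γ w) :=
  ((hG.contDiffAt (isOpen_posDensity.mem_nhds
    (show phase Γ w ∈ posDensity from hw.1))).differentiableAt (by simp)).hasFDerivAt

theorem hamP_eq_ev (ε t : ℝ) (x : Vec3) (θ : ℝ) (hw : (ε, t, x, θ) ∈ hΓ.regular) (i : Fin 3) :
    hamP H (Γ ε t) x θ i = SmoothFun.ev ⟨_, hw⟩ ((hΓ.data hH).hamP i) := by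
  have hd := hΓ.hasFDerivAt_phase hH hw
  rw [hamP, hΓ.gradS_rho_eq]
  have h := hd.comp (phase Γ (ε, t, x, θ)).1 (hasFDerivAt_prodMk_left (𝕜 := ℝ) _
    (phase Γ (ε, t, x, θ)).2)
  exact congrArg (fun l : Vec3 →L[ℝ] ℝ => l (Pi.single i 1)) h.fderiv

theorem hamGradRho_eq_ev (ε t : ℝ) (x : Vec3) (θ : ℝ) (hw : (ε, t, x, θ) ∈ hΓ.regular)
    (i : Fin 3) :
    hamGradRho H (Γ ε t) x θ i = SmoothFun.ev ⟨_, hw⟩ ((hΓ.data hH).hamQ i) := by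
  have hd := hΓ.hasFDerivAt_phase hH hw
  rw [hamGradRho, hΓ.gradS_rho_eq]
  have h := hd.comp (phase Γ (ε, t, x, θ)).2.2 ((hasFDerivAt_prodMk_right (𝕜 := ℝ) _ _).comp _
    (hasFDerivAt_prodMk_right (𝕜 := ℝ) (phase Γ (ε, t, x, θ)).2.1 _))
  exact congrArg (fun l : Vec3 →L[ℝ] ℝ => l (Pi.single i 1)) h.fderiv

theorem hamRho_eq_ev (ε t : ℝ) (x : Vec3) (θ : ℝ) (hw : (ε, t, x, θ) ∈ hΓ.regular) :
    hamRho H (Γ ε t) x θ = SmoothFun.ev ⟨_, hw⟩ (hΓ.data hH).hamR := by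
  have hd := hΓ.hasFDerivAt_phase hH hw
  rw [hamRho, hΓ.gradS_rho_eq]
  exact (hd.comp_hasDerivAt (f := fun r => ((phase Γ (ε, t, x, θ)).1, r,
    (phase Γ (ε, t, x, θ)).2.2)) (phase Γ (ε, t, x, θ)).2.1
    ((hasDerivAt_const _ _).prodMk ((hasDerivAt_id _).prodMk (hasDerivAt_const _ _)))).deriv

theorem hamAt_eq_ev (ε t : ℝ) (x : Vec3) (θ : ℝ) (hw : (ε, t, x, θ) ∈ hΓ.regular) :
    hamAt H (Γ ε t) x θ = SmoothFun.ev ⟨_, hw⟩ (hΓ.data hH).ham := by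
  rw [hamAt, hΓ.gradS_rho_eq]
  rfl

/-! ### The four equations as elements of the ring -/

section Equations

variable {ε t : ℝ} (hreg : ∀ y s, (ε, t, y, s) ∈ hΓ.regular)

theorem divS_eq_ev {f : Fin 3 → SmoothFun hΓ.regular} {g : Vec3 → ℝ → Vec3}
    (hg : ∀ y s i, g y s i = SmoothFun.ev ⟨_, hreg y s⟩ (f i)) (x : Vec3) (θ : ℝ) :
    divS (Γ ε t).S g x θ = SmoothFun.ev ⟨_, hreg x θ⟩ (∑ i, hΓ.dd (eSpace i) (f i)) := by
  rw [divS, map_sum]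
  exact Finset.sum_congr rfl fun i _ => hΓ.dSpaceS_eq_ev hreg (fun y s => hg y s i) i x θ

theorem labels_iff (x : Vec3) (θ : ℝ) :
    dTimeS (fun τ => (Γ ε τ).S) (fun τ => (Γ ε τ).h) t x θ
        = -(Matrix.vecMul (hamP H (Γ ε t) x θ) (jacS (Γ ε t).S (Γ ε t).h x θ)) ↔
      ∀ j, SmoothFun.ev ⟨_, hreg x θ⟩ ((hΓ.data hH).eqLabels j) = 0 := by
  rw [funext_iff]
  refine forall_congr' fun j => ?_
  rw [hΓ.dTimeS_pi_apply, hΓ.jacS_eq, Pi.neg_apply, eq_neg_iff_add_eq_zero]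
  simp only [FluidData.eqLabels, map_add, map_sum, map_mul, ← hamP_eq_ev]
  rw [← hΓ.ev_dd_el eTime (hΓ.contDiff_fH j) ⟨_, hreg x θ⟩]
  have : ∀ k, jac Γ (ε, t, x, θ) k j = SmoothFun.ev ⟨_, hreg x θ⟩ ((hΓ.data hH).d k
      ((hΓ.data hH).h j)) := fun k =>
    (hΓ.ev_dd_el (eSpace k) (hΓ.contDiff_fH j) ⟨_, hreg x θ⟩).symm
  simp only [Matrix.vecMul, dotProduct, this]
  rfl

theorem continuity_iff (x : Vec3) (θ : ℝ) :
    dTimeS (fun τ => (Γ ε τ).S) (fun τ => (Γ ε τ).rho) t x θ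
        + divS (Γ ε t).S (fun y s => (Γ ε t).rho y s • hamP H (Γ ε t) y s) x θ = 0 ↔
      SmoothFun.ev ⟨_, hreg x θ⟩ (hΓ.data hH).eqContinuity = 0 := by
  rw [hΓ.divS_eq_ev hreg (f := fun i => (hΓ.data hH).rho * (hΓ.data hH).hamP i) fun y s i => by
      rw [map_mul, ← hΓ.hamP_eq_ev hH]; rfl,
    hΓ.dTimeS_eq (F := fRho Γ) (g := fun τ => (Γ ε τ).rho) (fun _ _ _ => rfl) (hΓ.contDiff_fRho.differentiable (by simp) _),
    ← hΓ.ev_dd_el _ hΓ.contDiff_fRho ⟨_, hreg x θ⟩, ← map_add]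
  rfl

theorem multiplier_iff (x : Vec3) (θ : ℝ) :
    dTimeS (fun τ => (Γ ε τ).S) (fun τ => (Γ ε τ).chi) t x θ
        + hamP H (Γ ε t) x θ ⬝ᵥ gradS (Γ ε t).S (Γ ε t).chi x θ
        = hamRho H (Γ ε t) x θ - divS (Γ ε t).S (hamGradRho H (Γ ε t)) x θ ↔
      SmoothFun.ev ⟨_, hreg x θ⟩ (hΓ.data hH).eqMultiplier = 0 := by
  rw [hΓ.divS_eq_ev hreg (f := (hΓ.data hH).hamQ) fun y s i => hΓ.hamGradRho_eq_ev hH _ _ _ _ _ i,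
    hΓ.dTimeS_eq (F := fChi Γ) (g := fun τ => (Γ ε τ).chi) (fun _ _ _ => rfl) (hΓ.contDiff_fChi.differentiable (by simp) _),
    ← hΓ.ev_dd_el _ hΓ.contDiff_fChi ⟨_, hreg x θ⟩, hΓ.hamRho_eq_ev hH _ _ _ _ (hreg x θ),
    ← sub_eq_zero, FluidData.eqMultiplier]
  have h2 : ∀ i, gradS (Γ ε t).S (Γ ε t).chi x θ i
      = SmoothFun.ev ⟨_, hreg x θ⟩ ((hΓ.data hH).d i (hΓ.data hH).chi) := fun i =>
    hΓ.dSpaceS_eq_ev hreg (f := (hΓ.data hH).chi) (g := (Γ ε t).chi) (fun _ _ => rfl) i x θ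
  simp only [dotProduct, h2, hΓ.hamP_eq_ev hH _ _ _ _ (hreg x θ), map_mul, map_add, map_sub,
    map_sum]
  rfl

theorem momentum_iff (x : Vec3) (θ : ℝ) (j : Fin 3) :
    dTimeS (fun τ => (Γ ε τ).S) (fun τ y s => (Γ ε τ).p y s j) t x θ
        + divS (Γ ε t).S (fun y s i => hamP H (Γ ε t) y s i * (Γ ε t).p y s j
          + hamGradRho H (Γ ε t) y s i * gradS (Γ ε t).S (Γ ε t).rho y s j) x θ
      = -(gradS (Γ ε t).S (fun y s => (Γ ε t).rho y s * hamRho H (Γ ε t) y s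
          - (Γ ε t).rho y s * divS (Γ ε t).S (hamGradRho H (Γ ε t)) y s
          + (Γ ε t).p y s ⬝ᵥ hamP H (Γ ε t) y s - hamAt H (Γ ε t) y s) x θ j) ↔
      SmoothFun.ev ⟨_, hreg x θ⟩ ((hΓ.data hH).eqMomentum j) = 0 := by
  have hrho : ∀ y s, gradS (Γ ε t).S (Γ ε t).rho y s j
      = SmoothFun.ev ⟨_, hreg y s⟩ ((hΓ.data hH).d j (hΓ.data hH).rho) := fun y s =>
    hΓ.dSpaceS_eq_ev hreg (f := (hΓ.data hH).rho) (g := (Γ ε t).rho) (fun _ _ => rfl) j y s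
  have hdiv : ∀ y s, divS (Γ ε t).S (hamGradRho H (Γ ε t)) y s = _ := fun y s =>
    hΓ.divS_eq_ev hreg (f := (hΓ.data hH).hamQ) (fun y s i => hΓ.hamGradRho_eq_ev hH _ _ _ _ _ i)
      y s
  have hgrad := hΓ.dSpaceS_eq_ev hreg (f := (hΓ.data hH).rho * (hΓ.data hH).hamR
      - (hΓ.data hH).rho * ∑ i, (hΓ.data hH).d i ((hΓ.data hH).hamQ i)
      + ∑ i, (hΓ.data hH).p i * (hΓ.data hH).hamP i - (hΓ.data hH).ham)
    (g := fun y s => (Γ ε t).rho y s * hamRho H (Γ ε t) y s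
          - (Γ ε t).rho y s * divS (Γ ε t).S (hamGradRho H (Γ ε t)) y s
          + (Γ ε t).p y s ⬝ᵥ hamP H (Γ ε t) y s - hamAt H (Γ ε t) y s) (fun y s => by
      rw [hdiv y s, hΓ.hamRho_eq_ev hH _ _ _ _ (hreg y s), hΓ.hamAt_eq_ev hH _ _ _ _ (hreg y s)]
      simp only [dotProduct, hΓ.hamP_eq_ev hH _ _ _ _ (hreg y s), map_add, map_sub, map_mul,
        map_sum]
      rfl) j x θ
  rw [eq_neg_iff_add_eq_zero, gradS, hgrad,
    hΓ.divS_eq_ev hreg (f := fun i => (hΓ.data hH).hamP i * (hΓ.data hH).p j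
      + (hΓ.data hH).hamQ i * (hΓ.data hH).d j (hΓ.data hH).rho) fun y s i => by
      rw [hrho, hΓ.hamP_eq_ev hH _ _ _ _ (hreg y s), hΓ.hamGradRho_eq_ev hH _ _ _ _ (hreg y s),
        map_add, map_mul, map_mul]
      rfl,
    hΓ.dTimeS_eq (F := fP Γ j) (g := fun τ y s => (Γ ε τ).p y s j) (fun _ _ _ => rfl) ((hΓ.contDiff_fP j).differentiable (by simp) _),
    ← hΓ.ev_dd_el _ (hΓ.contDiff_fP j) ⟨_, hreg x θ⟩, ← map_add, ← map_add]
  rfl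

end Equations

end SmoothFamily

/-! ### Periodicity -/

/-- The translation by a period in `x` and `θ`. -/
noncomputable def shift (k : Fin 3 → ℤ) (m : ℤ) : Ext := (0, 0, lat k, 2 * Real.pi * m)

/-- A function which changes by multiples of `2π` under a translation has an invariant derivative,
since these multiples are locally constant. -/
theorem fderiv_add_shift {f : Ext → ℝ} (hf : ContDiff ℝ ∞ f) {t₁ t₂ : ℝ} {c : Ext}
    (h : ∀ w : Ext, w.2.1 ∈ Ioo t₁ t₂ → ∃ n : ℤ, f (w + c) = f w + 2 * Real.pi * n) {w : Ext}
    (hw : w.2.1 ∈ Ioo t₁ t₂) : fderiv ℝ f (w + c) = fderiv ℝ f w := by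
  have hcont : Continuous fun w => f (w + c) - f w := by
    have := hf.continuous
    fun_prop
  obtain ⟨n, hn⟩ := h w hw
  have hO : {w : Ext | w.2.1 ∈ Ioo t₁ t₂} ∈ 𝓝 w :=
    (isOpen_Ioo.preimage (by fun_prop : Continuous fun w : Ext => w.2.1)).mem_nhds hw
  have hev : (fun w => f (w + c)) =ᶠ[𝓝 w] fun w => f w + 2 * Real.pi * n := by
    filter_upwards [hO, hcont.continuousAt (Metric.ball_mem_nhds _ Real.two_pi_pos)] with y hy hy'
    obtain ⟨k, hk⟩ := h y hy
    have h1 : |2 * Real.pi * ((k - n : ℤ) : ℝ)| < 2 * Real.pi * 1 := by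
      have := Metric.mem_ball.1 hy'
      simp only [Real.dist_eq, hk, hn] at this
      convert this using 1
      · push_cast; ring_nf
      · ring
    rw [abs_mul, abs_of_pos Real.two_pi_pos] at h1
    have h2 : |((k - n : ℤ) : ℝ)| < 1 := lt_of_mul_lt_mul_left h1 Real.two_pi_pos.le
    have h3 : k - n = 0 := by
      rw [← Int.cast_abs] at h2
      exact Int.abs_lt_one_iff.1 (by exact_mod_cast h2)
    rw [hk, sub_eq_zero.1 h3]
  rw [← fderiv_comp_add_right, hev.fderiv_eq, fderiv_add_const]

/-- The derivation in the direction of `ε` recovers the variation of a field, if the phase is not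
varied. -/
theorem fderiv_lift_eEps {S F : Ext → ℝ} {F₀ δ : STL → ℝ} {z : STL}
    (hS : DifferentiableAt ℝ S (0, z)) (hSε : ∀ ε, S (ε, z) = S (0, z)) (hF : DifferentiableAt ℝ F (0, z))
    (hFε : ∀ ε, F (ε, z) = F₀ z + ε * δ z) : fderiv ℝ F (0, z) (lift S eEps (0, z)) = δ z := by
  have hS0 : fderiv ℝ S (0, z) eEps = 0 := fderiv_apply_eq_zero_of_invariant hS fun s => by
    have : ((0, z) : Ext) + s • eEps = (s, z) := by
      ext <;> simp [eEps]
    rw [this, hSε]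
  have h1 : HasDerivAt (fun ε : ℝ => F (ε, z)) (fderiv ℝ F (0, z) eEps) 0 :=
    hF.hasFDerivAt.comp_hasDerivAt (f := fun ε : ℝ => ((ε, z) : Ext)) 0
      ((hasDerivAt_id (0 : ℝ)).prodMk (hasDerivAt_const 0 z))
  have h2 : HasDerivAt (fun ε : ℝ => F (ε, z)) (δ z) 0 := by
    simp only [hFε]
    simpa using ((hasDerivAt_id (0 : ℝ)).mul_const (δ z)).const_add (F₀ z)
  rw [fderiv_lift, hS0, zero_mul, add_zero, h1.unique h2]

namespace SmoothFamily

variable {Γ : ℝ → ℝ → Fields} (hΓ : SmoothFamily Γ)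

/-- The ring of smooth functions which, for times in `(t₁, t₂)`, are invariant under the
translation by `c`. -/
def periodic (t₁ t₂ : ℝ) (c : Ext) : Subring (SmoothFun hΓ.regular) where
  carrier := {f | ∀ u u' : hΓ.regular, u.1.2.1 ∈ Ioo t₁ t₂ → u'.1 = u.1 + c →
    SmoothFun.ev u' f = SmoothFun.ev u f}
  mul_mem' hf hg u u' ht hu := by rw [map_mul, map_mul, hf u u' ht hu, hg u u' ht hu]
  add_mem' hf hg u u' ht hu := by rw [map_add, map_add, hf u u' ht hu, hg u u' ht hu]
  one_mem' u u' _ _ := by rw [map_one, map_one]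
  zero_mem' u u' _ _ := by rw [map_zero, map_zero]
  neg_mem' hf u u' ht hu := by rw [map_neg, map_neg, hf u u' ht hu]

section Periodic

variable {t₁ t₂ : ℝ} (hT : ∀ ε, ∀ t ∈ Icc t₁ t₂, (Γ ε t).OnTorus) (k : Fin 3 → ℤ) (m : ℤ)

theorem fderiv_fS_shift (hΓ : SmoothFamily Γ) (hT : ∀ ε, ∀ t ∈ Icc t₁ t₂, (Γ ε t).OnTorus)
    (k : Fin 3 → ℤ) (m : ℤ) {w : Ext} (hw : w.2.1 ∈ Ioo t₁ t₂) :
    fderiv ℝ (fS Γ) (w + shift k m) = fderiv ℝ (fS Γ) w := by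
  refine fderiv_add_shift hΓ.contDiff_fS (fun w hw => ?_) hw
  obtain ⟨n, hn⟩ := (hT w.1 w.2.1 (Ioo_subset_Icc_self hw)).S w.2.2.1 k
  exact ⟨n, by simpa [fS, shift] using hn⟩

theorem fderiv_fH_shift (hΓ : SmoothFamily Γ) (hT : ∀ ε, ∀ t ∈ Icc t₁ t₂, (Γ ε t).OnTorus)
    (k : Fin 3 → ℤ) (m : ℤ) (j : Fin 3) {w : Ext} (hw : w.2.1 ∈ Ioo t₁ t₂) :
    fderiv ℝ (fH Γ j) (w + shift k m) = fderiv ℝ (fH Γ j) w := by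
  refine fderiv_add_shift (hΓ.contDiff_fH j) (fun w hw => ?_) hw
  obtain ⟨n, hn⟩ := (hT w.1 w.2.1 (Ioo_subset_Icc_self hw)).h w.2.2.1 w.2.2.2 k m
  exact ⟨n j, by simpa [fH, shift, lat] using congrFun hn j⟩

theorem fP_shift (hT : ∀ ε, ∀ t ∈ Icc t₁ t₂, (Γ ε t).OnTorus)
    (k : Fin 3 → ℤ) (m : ℤ) (j : Fin 3) {w : Ext} (hw : w.2.1 ∈ Ioo t₁ t₂) :
    fP Γ j (w + shift k m) = fP Γ j w := by
  have := congrFun ((hT w.1 w.2.1 (Ioo_subset_Icc_self hw)).p w.2.2.1 w.2.2.2 k m) j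
  simpa [fP, shift] using this

theorem fRho_shift (hT : ∀ ε, ∀ t ∈ Icc t₁ t₂, (Γ ε t).OnTorus)
    (k : Fin 3 → ℤ) (m : ℤ) {w : Ext} (hw : w.2.1 ∈ Ioo t₁ t₂) :
    fRho Γ (w + shift k m) = fRho Γ w := by
  have := (hT w.1 w.2.1 (Ioo_subset_Icc_self hw)).rho w.2.2.1 w.2.2.2 k m
  simpa [fRho, shift] using this

theorem fChi_shift (hT : ∀ ε, ∀ t ∈ Icc t₁ t₂, (Γ ε t).OnTorus)
    (k : Fin 3 → ℤ) (m : ℤ) {w : Ext} (hw : w.2.1 ∈ Ioo t₁ t₂) :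
    fChi Γ (w + shift k m) = fChi Γ w := by
  have := (hT w.1 w.2.1 (Ioo_subset_Icc_self hw)).chi w.2.2.1 w.2.2.2 k m
  simpa [fChi, shift] using this

theorem lift_shift (hΓ : SmoothFamily Γ) (hT : ∀ ε, ∀ t ∈ Icc t₁ t₂, (Γ ε t).OnTorus)
    (k : Fin 3 → ℤ) (m : ℤ) (a : Ext) {w : Ext} (hw : w.2.1 ∈ Ioo t₁ t₂) :
    lift (fS Γ) a (w + shift k m) = lift (fS Γ) a w := by
  rw [lift, lift, hΓ.fderiv_fS_shift hT k m hw]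

theorem jac_shift (hΓ : SmoothFamily Γ) (hT : ∀ ε, ∀ t ∈ Icc t₁ t₂, (Γ ε t).OnTorus)
    (k : Fin 3 → ℤ) (m : ℤ) {w : Ext} (hw : w.2.1 ∈ Ioo t₁ t₂) :
    jac Γ (w + shift k m) = jac Γ w := by
  ext i j
  simp only [jac, Matrix.of_apply, hΓ.fderiv_fH_shift hT k m j hw, hΓ.lift_shift hT k m _ hw]

theorem phase_shift (hΓ : SmoothFamily Γ) (hT : ∀ ε, ∀ t ∈ Icc t₁ t₂, (Γ ε t).OnTorus)
    (k : Fin 3 → ℤ) (m : ℤ) {w : Ext} (hw : w.2.1 ∈ Ioo t₁ t₂) :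
    phase Γ (w + shift k m) = phase Γ w := by
  have h := fderiv_add_shift (t₁ := t₁) (t₂ := t₂) (c := shift k m) hΓ.contDiff_fRho
    (fun w hw => ⟨0, by simpa using fRho_shift hT k m hw⟩) hw
  simp only [phase, fP_shift hT k m _ hw, fRho_shift hT k m hw, h, hΓ.lift_shift hT k m _ hw]

include hT

theorem dd_mem_periodic (a : Ext) {f : SmoothFun hΓ.regular}
    (hf : f ∈ hΓ.periodic t₁ t₂ (shift k m)) : hΓ.dd a f ∈ hΓ.periodic t₁ t₂ (shift k m) := by
  intro u u' ht hu
  have hO : {w : Ext | w.2.1 ∈ Ioo t₁ t₂} ∈ 𝓝 u.1 :=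
    (isOpen_Ioo.preimage (by fun_prop : Continuous fun w : Ext => w.2.1)).mem_nhds ht
  have hU' : ∀ᶠ w in 𝓝 u.1, w + shift k m ∈ hΓ.regular := by
    refine (by fun_prop : Continuous fun w : Ext => w + shift k m).continuousAt ?_
    rw [← hu]
    exact hΓ.regular.isOpen.mem_nhds u'.2
  have hev : (fun w => SmoothFun.rep f (w + shift k m)) =ᶠ[𝓝 u.1] SmoothFun.rep f := by
    filter_upwards [hO, hU', hΓ.regular.isOpen.mem_nhds u.2] with w hw h1 h2
    rw [SmoothFun.rep_eq_ev f ⟨w, h2⟩, SmoothFun.rep_eq_ev f ⟨_, h1⟩]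
    exact hf _ _ hw rfl
  rw [hΓ.ev_dd a (SmoothFun.rep_eq_ev f), hΓ.ev_dd a (SmoothFun.rep_eq_ev f), hu,
    hΓ.lift_shift hT k m a ht, ← fderiv_comp_add_right, hev.fderiv_eq]

theorem dd_elH_mem_periodic (a : Ext) (j : Fin 3) :
    hΓ.dd a (hΓ.elH j) ∈ hΓ.periodic t₁ t₂ (shift k m) := by
  intro u u' ht hu
  rw [elH, hΓ.ev_dd_el, hΓ.ev_dd_el, hu, hΓ.lift_shift hT k m a ht, hΓ.fderiv_fH_shift hT k m j ht]

theorem disp_mem_periodic (a : Ext) (i : Fin 3) :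
    hΓ.disp (hΓ.dd a) i ∈ hΓ.periodic t₁ t₂ (shift k m) := by
  intro u u' ht hu
  have h := fun j => hΓ.dd_elH_mem_periodic hT k m a j u u' ht hu
  simp only [ev_disp, h, hu, hΓ.jac_shift hT k m ht]

theorem comp_mem_periodic {G : Vec3 × ℝ × Vec3 → ℝ} (hG : ContDiffOn ℝ ∞ G posDensity) :
    hΓ.comp G hG ∈ hΓ.periodic t₁ t₂ (shift k m) := by
  intro u u' ht hu
  rw [ev_comp, ev_comp, hu, hΓ.phase_shift hT k m ht]

theorem elP_mem_periodic (j : Fin 3) :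
    hΓ.el (fP Γ j) (hΓ.contDiff_fP j) ∈ hΓ.periodic t₁ t₂ (shift k m) := by
  intro u u' ht hu
  rw [ev_el, ev_el, hu, fP_shift hT k m j ht]

theorem elRho_mem_periodic :
    hΓ.el (fRho Γ) hΓ.contDiff_fRho ∈ hΓ.periodic t₁ t₂ (shift k m) := by
  intro u u' ht hu
  rw [ev_el, ev_el, hu, fRho_shift hT k m ht]

theorem elChi_mem_periodic :
    hΓ.el (fChi Γ) hΓ.contDiff_fChi ∈ hΓ.periodic t₁ t₂ (shift k m) := by
  intro u u' ht hu
  rw [ev_el, ev_el, hu, fChi_shift hT k m ht]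

end Periodic

/-! ### The first variation of the action -/

/-- The derivation `∂_a`. -/
noncomputable def pd (a : Ext) : Derivation ℝ (SmoothFun hΓ.regular) (SmoothFun hΓ.regular) :=
  SmoothFun.der (fun _ => a) contDiff_const

theorem ev_pd (a : Ext) (f : SmoothFun hΓ.regular) (u : hΓ.regular) :
    SmoothFun.ev u (hΓ.pd a f) = fderiv ℝ (SmoothFun.rep f) u a :=
  SmoothFun.ev_der _ _ (SmoothFun.rep_eq_ev f) u

/-- The derivative `∂_a S` as a ring element. -/
noncomputable def elDS (a : Ext) : SmoothFun hΓ.regular :=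
  hΓ.el (fun w => fderiv ℝ (fS Γ) w a)
    ((hΓ.contDiff_fS.fderiv_right (m := ∞) (by simp)).clm_apply contDiff_const)

theorem dd_eq (a : Ext) (f : SmoothFun hΓ.regular) :
    hΓ.dd a f = hΓ.pd a f + hΓ.elDS a * hΓ.pd eLoop f := by
  refine SmoothFun.ext_ev fun u => ?_
  rw [hΓ.ev_dd a (SmoothFun.rep_eq_ev f), fderiv_lift, map_add, map_mul, ev_pd, ev_pd]
  rfl

theorem pd_eLoop_elDS (a : Ext) : hΓ.pd eLoop (hΓ.elDS a) = 0 := by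
  refine SmoothFun.ext_ev fun u => ?_
  have hc : ContDiff ℝ ∞ fun w => fderiv ℝ (fS Γ) w a :=
    (hΓ.contDiff_fS.fderiv_right (m := ∞) (by simp)).clm_apply contDiff_const
  rw [map_zero, pd, SmoothFun.ev_der _ _ (F := fun w => fderiv ℝ (fS Γ) w a) fun _ => rfl]
  refine fderiv_apply_eq_zero_of_invariant (hc.differentiable (by simp) _) fun s => ?_
  rw [← fderiv_comp_add_right, funext fun w => fS_add_smul_eLoop Γ w s]

theorem elDS_mem_periodic {t₁ t₂ : ℝ} (hT : ∀ ε, ∀ t ∈ Icc t₁ t₂, (Γ ε t).OnTorus)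
    (k : Fin 3 → ℤ) (m : ℤ) (a : Ext) : hΓ.elDS a ∈ hΓ.periodic t₁ t₂ (shift k m) := by
  intro u u' ht hu
  rw [elDS, ev_el, ev_el, hu, hΓ.fderiv_fS_shift hT k m ht]

variable {G : Vec3 × ℝ × Vec3 → ℝ} (hG : ContDiffOn ℝ ∞ G posDensity)

/-- The integrand of the first variation. -/
noncomputable def firstVariation : SmoothFun hΓ.regular :=
  ∑ k, (hΓ.data hG).resP k * hΓ.dd eEps ((hΓ.data hG).p k)
    + (hΓ.data hG).resRho * hΓ.dd eEps (hΓ.data hG).rho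
    + (hΓ.data hG).resChi * hΓ.dd eEps (hΓ.data hG).chi
    + ∑ k, (hΓ.data hG).resH k * hΓ.disp (hΓ.dd eEps) k

/-- The temporal component of the boundary term. -/
noncomputable def fluxT : SmoothFun hΓ.regular :=
  (hΓ.data hG).rho * hΓ.dd eEps (hΓ.data hG).chi
    + ∑ k, (hΓ.data hG).mom k * hΓ.disp (hΓ.dd eEps) k

/-- The spatial components of the boundary term. -/
noncomputable def fluxX (i : Fin 3) : SmoothFun hΓ.regular :=
  (hΓ.data hG).rho * (hΓ.data hG).v i * hΓ.dd eEps (hΓ.data hG).chi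
    + (hΓ.data hG).v i * ∑ k, (hΓ.data hG).mom k * hΓ.disp (hΓ.dd eEps) k
    - (hΓ.data hG).hamQ i * hΓ.dd eEps (hΓ.data hG).rho

/-- The component of the boundary term along the loop. -/
noncomputable def fluxLoop : SmoothFun hΓ.regular :=
  hΓ.elDS eTime * hΓ.fluxT hG + ∑ i, hΓ.elDS (eSpace i) * hΓ.fluxX hG i
    - hΓ.elDS eEps * (hΓ.data hG).lag

/-- The ordinary `ε`-derivative of the Lagrange density is the integrand of the first variation
plus an ordinary divergence. -/
theorem pd_eEps_lag : hΓ.pd eEps (hΓ.data hG).lag = hΓ.firstVariation hG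
    + (hΓ.pd eTime (hΓ.fluxT hG) + ∑ i, hΓ.pd (eSpace i) (hΓ.fluxX hG i)
      + hΓ.pd eLoop (hΓ.fluxLoop hG)) := by
  have h : hΓ.dd eEps (hΓ.data hG).lag = hΓ.firstVariation hG + hΓ.dd eTime (hΓ.fluxT hG)
      + ∑ i, hΓ.dd (eSpace i) (hΓ.fluxX hG i) :=
    (hΓ.laws hG).delta_lag (hΓ.dd eEps) (hΓ.dd_comm _ _) (fun _ => hΓ.dd_comm _ _)
      (hΓ.dd_ham hG _) _ (hΓ.sum_disp _)
  simp only [dd_eq _ eEps (hΓ.data hG).lag, dd_eq _ eTime (hΓ.fluxT hG),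
    fun i => hΓ.dd_eq (eSpace i) (hΓ.fluxX hG i)] at h
  simp only [fluxLoop, map_add, map_sub, map_sum, Derivation.leibniz, pd_eLoop_elDS, smul_eq_mul,
    mul_zero, add_zero]
  rw [Finset.sum_add_distrib] at h
  linear_combination h

section Flux

variable {t₁ t₂ : ℝ} (hT : ∀ ε, ∀ t ∈ Icc t₁ t₂, (Γ ε t).OnTorus) (k : Fin 3 → ℤ) (m : ℤ)
include hT

theorem mom_mem_periodic (i : Fin 3) :
    (hΓ.data hG).mom i ∈ hΓ.periodic t₁ t₂ (shift k m) :=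
  add_mem (hΓ.elP_mem_periodic hT k m i) (mul_mem (hΓ.elRho_mem_periodic hT k m)
    (hΓ.dd_mem_periodic hT k m _ (hΓ.elChi_mem_periodic hT k m)))

theorem fluxT_mem_periodic : hΓ.fluxT hG ∈ hΓ.periodic t₁ t₂ (shift k m) :=
  add_mem (mul_mem (hΓ.elRho_mem_periodic hT k m)
    (hΓ.dd_mem_periodic hT k m _ (hΓ.elChi_mem_periodic hT k m)))
    (sum_mem fun i _ => mul_mem (hΓ.mom_mem_periodic hG hT k m i) (hΓ.disp_mem_periodic hT k m _ i))

theorem fluxX_mem_periodic (i : Fin 3) : hΓ.fluxX hG i ∈ hΓ.periodic t₁ t₂ (shift k m) :=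
  sub_mem (add_mem (mul_mem (mul_mem (hΓ.elRho_mem_periodic hT k m)
      (hΓ.disp_mem_periodic hT k m _ i))
      (hΓ.dd_mem_periodic hT k m _ (hΓ.elChi_mem_periodic hT k m)))
    (mul_mem (hΓ.disp_mem_periodic hT k m _ i) (sum_mem fun i _ =>
      mul_mem (hΓ.mom_mem_periodic hG hT k m i) (hΓ.disp_mem_periodic hT k m _ i))))
    (mul_mem (hΓ.comp_mem_periodic hT k m (contDiffOn_fderiv_posDensity hG _))
      (hΓ.dd_mem_periodic hT k m _ (hΓ.elRho_mem_periodic hT k m)))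

theorem lag_mem_periodic : (hΓ.data hG).lag ∈ hΓ.periodic t₁ t₂ (shift k m) :=
  sub_mem (add_mem (add_mem
    (sum_mem fun i _ => mul_mem (hΓ.elP_mem_periodic hT k m i) (hΓ.disp_mem_periodic hT k m _ i))
    (mul_mem (hΓ.elRho_mem_periodic hT k m)
      (hΓ.dd_mem_periodic hT k m _ (hΓ.elChi_mem_periodic hT k m))))
    (mul_mem (hΓ.elRho_mem_periodic hT k m) (sum_mem fun i _ =>
      mul_mem (hΓ.disp_mem_periodic hT k m _ i)
        (hΓ.dd_mem_periodic hT k m _ (hΓ.elChi_mem_periodic hT k m)))))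
    (hΓ.comp_mem_periodic hT k m hG)

theorem fluxLoop_mem_periodic : hΓ.fluxLoop hG ∈ hΓ.periodic t₁ t₂ (shift k m) :=
  sub_mem (add_mem (mul_mem (hΓ.elDS_mem_periodic hT k m _) (hΓ.fluxT_mem_periodic hG hT k m))
    (sum_mem fun i _ => mul_mem (hΓ.elDS_mem_periodic hT k m _)
      (hΓ.fluxX_mem_periodic hG hT k m i)))
    (mul_mem (hΓ.elDS_mem_periodic hT k m _) (hΓ.lag_mem_periodic hG hT k m))

end Flux

/-- At a time where the curves of the family agree for all `ε`, the derivation in the direction of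
`ε` vanishes on the fields. -/
theorem fderiv_lift_eEps_eq_zero (hΓ : SmoothFamily Γ) {t : ℝ} (h : ∀ ε, Γ ε t = Γ 0 t)
    {F : Ext → ℝ} (hF : Differentiable ℝ F) (hFt : ∀ ε y, F (ε, t, y) = F (0, t, y))
    (y : Vec3 × ℝ) : fderiv ℝ F (0, t, y) (lift (fS Γ) eEps (0, t, y)) = 0 :=
  fderiv_lift_eEps (F₀ := fun z => F (0, z)) (δ := fun _ => 0) (hΓ.differentiableAt_fS _)
    (fun ε => by simp only [fS, h ε]) (hF _) fun ε => by rw [hFt, mul_zero, add_zero]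

theorem ev_fluxT_eq_zero {t : ℝ} (h : ∀ ε, Γ ε t = Γ 0 t) (y : Vec3 × ℝ)
    (hw : (0, t, y) ∈ hΓ.regular) : SmoothFun.ev ⟨_, hw⟩ (hΓ.fluxT hG) = 0 := by
  have h1 : SmoothFun.ev ⟨_, hw⟩ (hΓ.dd eEps (hΓ.data hG).chi) = 0 :=
    (hΓ.ev_dd_el _ hΓ.contDiff_fChi ⟨_, hw⟩).trans (hΓ.fderiv_lift_eEps_eq_zero h
      (hΓ.contDiff_fChi.differentiable (by simp)) (fun ε y => by simp only [fChi, h ε]) y)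
  have h2 : ∀ j, SmoothFun.ev ⟨_, hw⟩ (hΓ.dd eEps (hΓ.elH j)) = 0 := fun j =>
    (hΓ.ev_dd_el _ (hΓ.contDiff_fH j) ⟨_, hw⟩).trans (hΓ.fderiv_lift_eEps_eq_zero h
      ((hΓ.contDiff_fH j).differentiable (by simp)) (fun ε y => by simp only [fH, h ε]) y)
  have h3 : (fun j => SmoothFun.ev ⟨_, hw⟩ (hΓ.dd eEps (hΓ.elH j))) = 0 := funext h2
  simp only [fluxT, map_add, map_mul, map_sum, h1, ev_disp, h3, Matrix.zero_vecMul]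
  simp

/-- The action as an integral over the space-time domain. -/
theorem action_eq {H : Vec3 → ℝ → Vec3 → ℝ}
    (hH : ContDiffOn ℝ ∞ (fun z : Vec3 × ℝ × Vec3 => H z.1 z.2.1 z.2.2) posDensity) {t₁ t₂ : ℝ}
    (ht : t₁ ≤ t₂) {ε : ℝ} (hε : ∀ z ∈ domain t₁ t₂, (ε, z) ∈ hΓ.regular) :
    action H t₁ t₂ (Γ ε)
      = (2 * Real.pi)⁻¹ * ∫ z in domain t₁ t₂, SmoothFun.rep (hΓ.data hH).lag (ε, z) := by
  have hc : ContinuousOn (fun z => SmoothFun.rep (hΓ.data hH).lag (ε, z)) (domain t₁ t₂) :=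
    (SmoothFun.contDiffOn_rep (hΓ.data hH).lag).continuousOn.comp (by fun_prop) hε
  rw [action, intervalIntegral.integral_of_le ht, ← integral_Icc_eq_integral_Ioc,
    setIntegral_domain_eq_space_last hc, ← integral_const_mul]
  refine setIntegral_congr_fun measurableSet_Icc fun t htt => ?_
  simp only [lagrangian]
  rw [intervalIntegral.integral_of_le Real.two_pi_pos.le, ← integral_Icc_eq_integral_Ioc]
  congr 1
  refine setIntegral_congr_fun measurableSet_Icc fun θ hθ => ?_
  refine setIntegral_congr_fun measurableSet_Icc fun x hx => ?_
  have hw : (ε, t, x, θ) ∈ hΓ.regular := hε _ ⟨htt, hx, hθ⟩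
  exact (hΓ.lagrangianDensity_eq_ev hH ε t x θ hw).trans (SmoothFun.rep_eq_ev _ ⟨_, hw⟩).symm

theorem fderiv_slice {f : SmoothFun hΓ.regular} {z : STL} (hz : ((0 : ℝ), z) ∈ hΓ.regular)
    (a : STL) : fderiv ℝ (fun z => SmoothFun.rep f (0, z)) z a
      = SmoothFun.ev ⟨_, hz⟩ (hΓ.pd (0, a) f) := by
  have h := ((SmoothFun.contDiffAt_rep f ⟨_, hz⟩).differentiableAt (by simp)).hasFDerivAt.comp z
    (hasFDerivAt_prodMk_right (𝕜 := ℝ) (0 : ℝ) z)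
  rw [ev_pd]
  exact congrArg (fun l : STL →L[ℝ] ℝ => l a) h.fderiv

/-- The first variation of the action. -/
theorem hasDerivAt_action {H : Vec3 → ℝ → Vec3 → ℝ}
    (hH : ContDiffOn ℝ ∞ (fun z : Vec3 × ℝ × Vec3 => H z.1 z.2.1 z.2.2) posDensity) {t₁ t₂ : ℝ}
    (ht : t₁ ≤ t₂) (hT : ∀ ε, ∀ t ∈ Icc t₁ t₂, (Γ ε t).OnTorus)
    (h₁ : ∀ ε, Γ ε t₁ = Γ 0 t₁) (h₂ : ∀ ε, Γ ε t₂ = Γ 0 t₂)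
    (hreg : ∀ t ∈ Icc t₁ t₂, ∀ y, (0, t, y) ∈ hΓ.regular) :
    HasDerivAt (fun ε => action H t₁ t₂ (Γ ε)) ((2 * Real.pi)⁻¹ *
      ∫ z in domain t₁ t₂, SmoothFun.rep (hΓ.firstVariation hH) (0, z)) 0 := by
  have hK := isCompact_domain t₁ t₂
  have hdom : ∀ z ∈ domain t₁ t₂, ((0 : ℝ), z) ∈ hΓ.regular := fun z hz => hreg z.1 hz.1 z.2
  have hO : IsOpen {z : STL | ((0 : ℝ), z) ∈ hΓ.regular} :=
    hΓ.regular.isOpen.preimage (by fun_prop)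
  have hsl : ∀ f : SmoothFun hΓ.regular, ContDiffOn ℝ 1 (fun z : STL => SmoothFun.rep f (0, z))
      {z : STL | ((0 : ℝ), z) ∈ hΓ.regular} := fun f =>
    ((SmoothFun.contDiffOn_rep f).of_le (by simp)).comp (by fun_prop) fun z hz => hz
  have hint : ∀ f : SmoothFun hΓ.regular,
      IntegrableOn (fun z : STL => SmoothFun.rep f (0, z)) (domain t₁ t₂) := fun f =>
    ((hsl f).continuousOn.mono hdom).integrableOn_compact hK
  -- the action is the integral of the Lagrange density for small `ε`
  have hev : (fun ε => action H t₁ t₂ (Γ ε)) =ᶠ[𝓝 0] fun ε => (2 * Real.pi)⁻¹ *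
      ∫ z in domain t₁ t₂, SmoothFun.rep (hΓ.data hH).lag (ε, z) := by
    have : ∀ᶠ ε : ℝ in 𝓝 0, ∀ z ∈ domain t₁ t₂, (ε, z) ∈ hΓ.regular :=
      hK.eventually_forall_of_forall_eventually fun z hz =>
        hΓ.regular.isOpen.mem_nhds (hdom z hz)
    exact this.mono fun ε hε => hΓ.action_eq hH ht hε
  have hder := hasDerivAt_setIntegral_of_contDiffOn (μ := (volume : Measure STL))
    hΓ.regular.isOpen
    ((SmoothFun.contDiffOn_rep (hΓ.data hH).lag).of_le (by simp)) hK hdom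
  refine ((hder.const_mul (2 * Real.pi)⁻¹).congr_of_eventuallyEq hev).congr_deriv ?_
  congr 1
  have hdiv := setIntegral_domain_div ht hO (A := fun z => SmoothFun.rep (hΓ.fluxT hH) (0, z))
    (B := fun i z => SmoothFun.rep (hΓ.fluxX hH i) (0, z))
    (C := fun z => SmoothFun.rep (hΓ.fluxLoop hH) (0, z)) hreg (hsl _) (fun i => hsl _) (hsl _)
    (fun y => by
      rw [SmoothFun.rep_eq_ev _ ⟨(0, t₁, y), hreg t₁ (left_mem_Icc.2 ht) y⟩]
      exact hΓ.ev_fluxT_eq_zero hH h₁ y _)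
    (fun y => by
      rw [SmoothFun.rep_eq_ev _ ⟨(0, t₂, y), hreg t₂ (right_mem_Icc.2 ht) y⟩]
      exact hΓ.ev_fluxT_eq_zero hH h₂ y _)
    (fun i t htt x θ => by
      have hr := hreg t (Ioo_subset_Icc_self htt)
      rw [SmoothFun.rep_eq_ev _ ⟨(0, t, x, θ), hr _⟩, SmoothFun.rep_eq_ev _ ⟨_, hr _⟩]
      exact hΓ.fluxX_mem_periodic hH hT (Pi.single i 1) 0 i _ _ htt (by simp [shift]))
    (fun t htt x θ => by
      have hr := hreg t (Ioo_subset_Icc_self htt)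
      rw [SmoothFun.rep_eq_ev _ ⟨(0, t, x, θ), hr _⟩, SmoothFun.rep_eq_ev _ ⟨_, hr _⟩]
      exact hΓ.fluxLoop_mem_periodic hH hT 0 1 _ _ htt (by
        have : lat 0 = 0 := funext fun i => by simp [lat]
        simp [shift, this]))
  have hlag : ∀ z ∈ domain t₁ t₂, fderiv ℝ (SmoothFun.rep (hΓ.data hH).lag) (0, z) (1, 0)
      = SmoothFun.rep (hΓ.firstVariation hH) (0, z)
        + SmoothFun.rep (hΓ.pd eTime (hΓ.fluxT hH) + ∑ i, hΓ.pd (eSpace i) (hΓ.fluxX hH i)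
          + hΓ.pd eLoop (hΓ.fluxLoop hH)) (0, z) := fun z hz => by
    have := congrArg (SmoothFun.ev ⟨_, hdom z hz⟩) (hΓ.pd_eEps_lag hH)
    rw [map_add, ev_pd, ← SmoothFun.rep_eq_ev, ← SmoothFun.rep_eq_ev] at this
    exact this
  rw [setIntegral_congr_fun hK.measurableSet hlag, integral_add (hint _) (hint _),
    add_eq_left]
  refine Eq.trans ?_ hdiv
  refine setIntegral_congr_fun hK.measurableSet fun z hz => ?_
  simp only [fun f => SmoothFun.rep_eq_ev f ⟨(0, z), hdom z hz⟩, map_add, map_sum,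
    fun (f : SmoothFun hΓ.regular) a => hΓ.fderiv_slice (f := f) (hdom z hz) a]
  rfl

end SmoothFamily

/-! ### Dependence on the curve at `ε = 0` only -/

theorem fderiv_eq_of_slice_eq {F F' : Ext → ℝ} {z : STL} (hF : DifferentiableAt ℝ F (0, z))
    (hF' : DifferentiableAt ℝ F' (0, z)) (h : ∀ᶠ y in 𝓝 z, F (0, y) = F' (0, y)) (b : STL) :
    fderiv ℝ F (0, z) (0, b) = fderiv ℝ F' (0, z) (0, b) := by
  have key : ∀ {F : Ext → ℝ}, DifferentiableAt ℝ F (0, z) →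
      fderiv ℝ F (0, z) (0, b) = fderiv ℝ (fun y => F (0, y)) z b := fun hF =>
    congrArg (fun l : STL →L[ℝ] ℝ => l b)
      (hF.hasFDerivAt.comp z (hasFDerivAt_prodMk_right (𝕜 := ℝ) (0 : ℝ) z)).fderiv.symm
  rw [key hF, key hF', EventuallyEq.fderiv_eq h]

namespace SmoothFamily

section Agree

variable {Γ Δ : ℝ → ℝ → Fields} (hΓ : SmoothFamily Γ) (hΔ : SmoothFamily Δ) (T : Set ℝ)

/-- The relation between smooth functions on the regular sets of two families which have the same values at `ε = 0` for
times in `T`. -/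
def Agree (f : SmoothFun hΓ.regular) (g : SmoothFun hΔ.regular) : Prop :=
  ∀ (z : STL) (hz : (0, z) ∈ hΓ.regular) (hz' : (0, z) ∈ hΔ.regular), z.1 ∈ T →
    SmoothFun.ev ⟨_, hz⟩ f = SmoothFun.ev ⟨_, hz'⟩ g

variable {hΓ hΔ T}

/-! Agreement is preserved by the ring operations and by the derivations tangent to `ε = 0`. -/

theorem Agree.add {f f' : SmoothFun hΓ.regular} {g g' : SmoothFun hΔ.regular}
    (h : Agree hΓ hΔ T f g) (h' : Agree hΓ hΔ T f' g') : Agree hΓ hΔ T (f + f') (g + g') :=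
  fun z hz hz' ht => by rw [map_add, map_add, h z hz hz' ht, h' z hz hz' ht]

theorem Agree.sub {f f' : SmoothFun hΓ.regular} {g g' : SmoothFun hΔ.regular}
    (h : Agree hΓ hΔ T f g) (h' : Agree hΓ hΔ T f' g') : Agree hΓ hΔ T (f - f') (g - g') :=
  fun z hz hz' ht => by rw [map_sub, map_sub, h z hz hz' ht, h' z hz hz' ht]

theorem Agree.mul {f f' : SmoothFun hΓ.regular} {g g' : SmoothFun hΔ.regular}
    (h : Agree hΓ hΔ T f g) (h' : Agree hΓ hΔ T f' g') : Agree hΓ hΔ T (f * f') (g * g') :=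
  fun z hz hz' ht => by rw [map_mul, map_mul, h z hz hz' ht, h' z hz hz' ht]

theorem Agree.neg {f : SmoothFun hΓ.regular} {g : SmoothFun hΔ.regular}
    (h : Agree hΓ hΔ T f g) : Agree hΓ hΔ T (-f) (-g) :=
  fun z hz hz' ht => by rw [map_neg, map_neg, h z hz hz' ht]

theorem Agree.sum {f : Fin 3 → SmoothFun hΓ.regular} {g : Fin 3 → SmoothFun hΔ.regular}
    (h : ∀ i, Agree hΓ hΔ T (f i) (g i)) : Agree hΓ hΔ T (∑ i, f i) (∑ i, g i) :=
  fun z hz hz' ht => by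
    rw [map_sum, map_sum]
    exact Finset.sum_congr rfl fun i _ => h i z hz hz' ht

variable (hT : IsOpen T) (h0 : ∀ t ∈ T, Γ 0 t = Δ 0 t)

include hT in
theorem eventually_slice {z : STL} (hz : z.1 ∈ T) : ∀ᶠ y : STL in 𝓝 z, y.1 ∈ T :=
  (hT.preimage continuous_fst).mem_nhds hz

include hT h0 in
theorem lift_slice (hΓ : SmoothFamily Γ) (hΔ : SmoothFamily Δ) {z : STL} (hz : z.1 ∈ T) (a : STL) :
    lift (fS Γ) (0, a) (0, z) = lift (fS Δ) (0, a) (0, z) := by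
  rw [lift, lift, fderiv_eq_of_slice_eq (hΓ.differentiableAt_fS _) (hΔ.differentiableAt_fS _)]
  filter_upwards [eventually_slice hT hz] with y hy
  simp only [fS, h0 _ hy]

/-- Directions tangent to `ε = 0` are lifted to such directions. -/
theorem exists_lift_eq (S : Ext → ℝ) (a : STL) (w : Ext) : ∃ b : STL, lift S (0, a) w = (0, b) :=
  ⟨a + fderiv ℝ S w (0, a) • (0, 0, 1), by simp [lift, eLoop]⟩

include hT h0 in
theorem fderiv_lift_slice (hΓ : SmoothFamily Γ) (hΔ : SmoothFamily Δ) {F F' : Ext → ℝ} {z : STL}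
    (hF : DifferentiableAt ℝ F (0, z)) (hF' : DifferentiableAt ℝ F' (0, z)) (hz : z.1 ∈ T)
    (h : ∀ᶠ y in 𝓝 z, y.1 ∈ T → F (0, y) = F' (0, y)) (a : STL) :
    fderiv ℝ F (0, z) (lift (fS Γ) (0, a) (0, z))
      = fderiv ℝ F' (0, z) (lift (fS Δ) (0, a) (0, z)) := by
  rw [lift_slice hT h0 hΓ hΔ hz a]
  obtain ⟨b, hb⟩ := exists_lift_eq (fS Δ) a (0, z)
  rw [hb]
  exact fderiv_eq_of_slice_eq hF hF' (by
    filter_upwards [h, eventually_slice hT hz] with y hy hyT using hy hyT) b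

include hT h0 in
theorem Agree.dd {f : SmoothFun hΓ.regular} {g : SmoothFun hΔ.regular}
    (h : Agree hΓ hΔ T f g) (a : STL) : Agree hΓ hΔ T (hΓ.dd (0, a) f) (hΔ.dd (0, a) g) := by
  intro z hz hz' ht
  rw [hΓ.ev_dd _ (SmoothFun.rep_eq_ev f), hΔ.ev_dd _ (SmoothFun.rep_eq_ev g)]
  refine fderiv_lift_slice hT h0 hΓ hΔ
    ((SmoothFun.contDiffAt_rep f ⟨_, hz⟩).differentiableAt (by simp))
    ((SmoothFun.contDiffAt_rep g ⟨_, hz'⟩).differentiableAt (by simp)) ht ?_ a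
  have hc : Continuous fun y : STL => ((0 : ℝ), y) := by fun_prop
  filter_upwards [hc.continuousAt (hΓ.regular.isOpen.mem_nhds hz),
    hc.continuousAt (hΔ.regular.isOpen.mem_nhds hz')] with y hy hy' hyT
  rw [SmoothFun.rep_eq_ev f ⟨_, hy⟩, SmoothFun.rep_eq_ev g ⟨_, hy'⟩]
  exact h y hy hy' hyT

include h0 in
theorem agree_el {F F' : Ext → ℝ} (hF : ContDiff ℝ ∞ F) (hF' : ContDiff ℝ ∞ F')
    (h : ∀ (t : ℝ) (y : Vec3 × ℝ), Γ 0 t = Δ 0 t → F (0, t, y) = F' (0, t, y)) :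
    Agree hΓ hΔ T (hΓ.el F hF) (hΔ.el F' hF') :=
  fun z _ _ ht => h z.1 z.2 (h0 z.1 ht)

include h0 in
theorem agree_elH (j : Fin 3) : Agree hΓ hΔ T (hΓ.elH j) (hΔ.elH j) :=
  agree_el h0 _ _ fun t y h => by simp only [fH, h]

include hT h0 in
theorem jac_slice (hΓ : SmoothFamily Γ) (hΔ : SmoothFamily Δ) {z : STL} (hz : z.1 ∈ T) :
    jac Γ (0, z) = jac Δ (0, z) := by
  ext i j
  refine fderiv_lift_slice hT h0 hΓ hΔ ((hΓ.contDiff_fH j).differentiable (by simp) _)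
    ((hΔ.contDiff_fH j).differentiable (by simp) _) hz (Eventually.of_forall fun y hy => ?_) _
  simp only [fH, h0 _ hy]

include hT h0 in
theorem phase_slice (hΓ : SmoothFamily Γ) (hΔ : SmoothFamily Δ) {z : STL} (hz : z.1 ∈ T) :
    phase Γ (0, z) = phase Δ (0, z) := by
  have h1 : ∀ i, fP Γ i (0, z) = fP Δ i (0, z) := fun i => by simp only [fP, h0 _ hz]
  have h2 : fRho Γ (0, z) = fRho Δ (0, z) := by simp only [fRho, h0 _ hz]
  have h3 : ∀ i, fderiv ℝ (fRho Γ) (0, z) (lift (fS Γ) (eSpace i) (0, z))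
      = fderiv ℝ (fRho Δ) (0, z) (lift (fS Δ) (eSpace i) (0, z)) := fun i =>
    fderiv_lift_slice hT h0 hΓ hΔ (hΓ.contDiff_fRho.differentiable (by simp) _)
      (hΔ.contDiff_fRho.differentiable (by simp) _) hz
      (Eventually.of_forall fun y hy => by simp only [fRho, h0 _ hy]) _
  simp only [phase, h1, h2, h3]

include hT h0 in
theorem agree_disp (a : STL) (k : Fin 3) :
    Agree hΓ hΔ T (hΓ.disp (hΓ.dd (0, a)) k) (hΔ.disp (hΔ.dd (0, a)) k) := by
  intro z hz hz' ht
  have h := fun j => (agree_elH (hΓ := hΓ) (hΔ := hΔ) h0 j).dd hT h0 a z hz hz' ht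
  simp only [ev_disp, h, jac_slice hT h0 hΓ hΔ ht]

include hT h0 in
theorem agree_comp {G : Vec3 × ℝ × Vec3 → ℝ} (hG : ContDiffOn ℝ ∞ G posDensity) :
    Agree hΓ hΔ T (hΓ.comp G hG) (hΔ.comp G hG) := by
  intro z hz hz' ht
  rw [ev_comp, ev_comp, phase_slice hT h0 hΓ hΔ ht]

variable {G : Vec3 × ℝ × Vec3 → ℝ} (hG : ContDiffOn ℝ ∞ G posDensity)

include h0 in
theorem agree_p (i : Fin 3) : Agree hΓ hΔ T ((hΓ.data hG).p i) ((hΔ.data hG).p i) :=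
  agree_el h0 (hΓ.contDiff_fP i) (hΔ.contDiff_fP i) fun t y h => by simp only [fP, h]

include h0 in
theorem agree_rho : Agree hΓ hΔ T (hΓ.data hG).rho (hΔ.data hG).rho :=
  agree_el h0 hΓ.contDiff_fRho hΔ.contDiff_fRho fun t y h => by simp only [fRho, h]

include h0 in
theorem agree_chi : Agree hΓ hΔ T (hΓ.data hG).chi (hΔ.data hG).chi :=
  agree_el h0 hΓ.contDiff_fChi hΔ.contDiff_fChi fun t y h => by simp only [fChi, h]

include hT h0

theorem agree_mom (k : Fin 3) : Agree hΓ hΔ T ((hΓ.data hG).mom k) ((hΔ.data hG).mom k) :=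
  (agree_p h0 hG k).add ((agree_rho h0 hG).mul ((agree_chi h0 hG).dd hT h0 _))

theorem agree_resP (k : Fin 3) : Agree hΓ hΔ T ((hΓ.data hG).resP k) ((hΔ.data hG).resP k) :=
  (agree_disp hT h0 _ k).sub (agree_comp hT h0 _)

theorem agree_resRho : Agree hΓ hΔ T (hΓ.data hG).resRho (hΔ.data hG).resRho :=
  ((((agree_chi h0 hG).dd hT h0 _).add (Agree.sum fun k =>
    (agree_disp hT h0 _ k).mul ((agree_chi h0 hG).dd hT h0 _))).sub (agree_comp hT h0 _)).add
    (Agree.sum fun k => (agree_comp hT h0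
      (contDiffOn_fderiv_posDensity hG (0, 0, Pi.single k 1))).dd hT h0 _)

theorem agree_resChi : Agree hΓ hΔ T (hΓ.data hG).resChi (hΔ.data hG).resChi :=
  (((agree_rho h0 hG).dd hT h0 _).add (Agree.sum fun k =>
    ((agree_rho h0 hG).mul (agree_disp hT h0 _ k)).dd hT h0 _)).neg

theorem agree_resH (k : Fin 3) : Agree hΓ hΔ T ((hΓ.data hG).resH k) ((hΔ.data hG).resH k) :=
  ((((agree_mom hT h0 hG k).dd hT h0 _).add (Agree.sum fun i =>
    ((agree_disp hT h0 _ i).mul (agree_mom hT h0 hG k)).dd hT h0 _)).add (Agree.sum fun i =>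
    (agree_mom hT h0 hG i).mul ((agree_disp hT h0 _ i).dd hT h0 _))).neg

end Agree

/-! ### The equations and the variational derivatives -/

section Vanishing

variable {Γ : ℝ → ℝ → Fields} (hΓ : SmoothFamily Γ) (t₁ t₂ : ℝ)

/-- The ideal of functions which vanish at `ε = 0` for times in `(t₁, t₂)`. -/
def vanishing : Ideal (SmoothFun hΓ.regular) where
  carrier := {f | ∀ (z : STL) (hz : (0, z) ∈ hΓ.regular), z.1 ∈ Ioo t₁ t₂ →
    SmoothFun.ev ⟨_, hz⟩ f = 0}
  add_mem' hf hg z hz ht := by rw [map_add, hf z hz ht, hg z hz ht, add_zero]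
  zero_mem' z hz ht := map_zero _
  smul_mem' c f hf z hz ht := by rw [smul_eq_mul, map_mul, hf z hz ht, mul_zero]

variable {t₁ t₂}

/-- The vanishing ideal is stable under the derivations tangent to `ε = 0`. -/
theorem dd_mem_vanishing {f : SmoothFun hΓ.regular} (hf : f ∈ hΓ.vanishing t₁ t₂) (a : STL) :
    hΓ.dd (0, a) f ∈ hΓ.vanishing t₁ t₂ := by
  have h : Agree hΓ hΓ (Ioo t₁ t₂) f 0 := fun z hz _ ht => by rw [hf z hz ht, map_zero]
  intro z hz ht
  have := h.dd isOpen_Ioo (fun _ _ => rfl) a z hz hz ht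
  rwa [map_zero, map_zero] at this

theorem vanishing_cancel (y : Fin 3 → SmoothFun hΓ.regular)
    (hy : ∀ j, ∑ k, y k * hΓ.dd (eSpace k) (hΓ.elH j) ∈ hΓ.vanishing t₁ t₂) (k : Fin 3) :
    y k ∈ hΓ.vanishing t₁ t₂ := by
  intro z hz ht
  have hu : IsUnit (jac Γ (0, z)).det := isUnit_iff_ne_zero.2 hz.2
  have h : Matrix.vecMul (fun k => SmoothFun.ev ⟨(0, z), hz⟩ (y k)) (jac Γ (0, z)) = 0 := by
    funext j
    have := hy j z hz ht
    simp only [map_sum, map_mul] at this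
    rw [← hΓ.map_jacMatrix ⟨_, hz⟩]
    exact this
  have h2 := congrArg (fun x => Matrix.vecMul x (jac Γ (0, z))⁻¹) h
  simp only [Matrix.vecMul_vecMul, Matrix.mul_nonsing_inv _ hu, Matrix.vecMul_one,
    Matrix.zero_vecMul] at h2
  exact congrFun h2 k

/-- By continuity, functions vanishing for times in `(t₁, t₂)` vanish at the initial and final
times. -/
theorem ev_eq_zero_of_mem_vanishing (ht : t₁ < t₂)
    (hreg : ∀ t ∈ Icc t₁ t₂, ∀ y, (0, t, y) ∈ hΓ.regular) {f : SmoothFun hΓ.regular}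
    (hf : f ∈ hΓ.vanishing t₁ t₂) {t : ℝ} (htt : t ∈ Icc t₁ t₂) (y : Vec3 × ℝ) :
    SmoothFun.ev ⟨_, hreg t htt y⟩ f = 0 := by
  have hc : ContinuousOn (fun τ => SmoothFun.rep f (0, τ, y)) (Icc t₁ t₂) :=
    (SmoothFun.contDiffOn_rep f).continuousOn.comp (by fun_prop) fun τ hτ => hreg τ hτ y
  have h : EqOn (fun τ => SmoothFun.rep f (0, τ, y)) (fun _ => 0) (Icc t₁ t₂) := by
    refine EqOn.of_subset_closure (s := Ioo t₁ t₂) (fun τ hτ => ?_) hc continuousOn_const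
      Ioo_subset_Icc_self (closure_Ioo ht.ne).symm.subset
    exact (SmoothFun.rep_eq_ev f ⟨_, hreg τ (Ioo_subset_Icc_self hτ) y⟩).trans (hf _ _ hτ)
  rw [← SmoothFun.rep_eq_ev]
  exact h htt

variable {H : Vec3 → ℝ → Vec3 → ℝ}
  (hH : ContDiffOn ℝ ∞ (fun z : Vec3 × ℝ × Vec3 => H z.1 z.2.1 z.2.2) posDensity)

/-- The variational derivatives vanish at `ε = 0` for times in `(t₁, t₂)`. -/
def Stationary (t₁ t₂ : ℝ) {G : Vec3 × ℝ × Vec3 → ℝ} (hG : ContDiffOn ℝ ∞ G posDensity) : Prop :=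
  (∀ k, (hΓ.data hG).resP k ∈ hΓ.vanishing t₁ t₂) ∧ (hΓ.data hG).resRho ∈ hΓ.vanishing t₁ t₂ ∧
    (hΓ.data hG).resChi ∈ hΓ.vanishing t₁ t₂ ∧ ∀ k, (hΓ.data hG).resH k ∈ hΓ.vanishing t₁ t₂

/-- The extended equations on `[t₁, t₂]` are equivalent to the vanishing of the variational
derivatives on `(t₁, t₂)`. -/
theorem solvesExtended_iff (ht : t₁ < t₂) (hreg : ∀ t ∈ Icc t₁ t₂, ∀ y, (0, t, y) ∈ hΓ.regular) :
    SolvesExtended H t₁ t₂ (Γ 0) ↔ hΓ.Stationary t₁ t₂ hH := by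
  rw [Stationary, ← (hΓ.laws hH).eqs_mem_iff (hΓ.vanishing t₁ t₂)
    (fun i f hf => hΓ.dd_mem_vanishing hf _) hΓ.vanishing_cancel]
  have hr : ∀ {t}, t ∈ Icc t₁ t₂ → ∀ y s, (0, t, y, s) ∈ hΓ.regular := fun h y s => hreg _ h (y, s)
  have hI := fun {t} (h : t ∈ Ioo t₁ t₂) => Ioo_subset_Icc_self h
  constructor
  · rintro ⟨h1, h2, h3, h4⟩
    refine ⟨fun j z hz h => ?_, fun j z hz h => ?_, fun z hz h => ?_, fun z hz h => ?_⟩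
    · exact (hΓ.labels_iff hH (hr (hI h)) z.2.1 z.2.2).1 (h1 _ (hI h) _ _) j
    · exact (hΓ.momentum_iff hH (hr (hI h)) z.2.1 z.2.2 j).1 (h2 _ (hI h) _ _ j)
    · exact (hΓ.continuity_iff hH (hr (hI h)) z.2.1 z.2.2).1 (h3 _ (hI h) _ _)
    · exact (hΓ.multiplier_iff hH (hr (hI h)) z.2.1 z.2.2).1 (h4 _ (hI h) _ _)
  · rintro ⟨h1, h2, h3, h4⟩
    refine ⟨fun t h x θ => ?_, fun t h x θ j => ?_, fun t h x θ => ?_, fun t h x θ => ?_⟩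
    · exact (hΓ.labels_iff hH (hr h) x θ).2 fun j =>
        hΓ.ev_eq_zero_of_mem_vanishing ht hreg (h1 j) h _
    · exact (hΓ.momentum_iff hH (hr h) x θ j).2
        (hΓ.ev_eq_zero_of_mem_vanishing ht hreg (h2 j) h _)
    · exact (hΓ.continuity_iff hH (hr h) x θ).2 (hΓ.ev_eq_zero_of_mem_vanishing ht hreg h3 h _)
    · exact (hΓ.multiplier_iff hH (hr h) x θ).2 (hΓ.ev_eq_zero_of_mem_vanishing ht hreg h4 h _)

end Vanishing

end SmoothFamily

/-! ### Solutions are critical points -/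

theorem IsSmoothCurve.smoothFamily {t₁ t₂ : ℝ} {γ : ℝ → Fields} (hγ : IsSmoothCurve t₁ t₂ γ) :
    SmoothFamily fun _ => γ where
  smooth_h := hγ.smooth_h.comp (contDiff_snd (E := ℝ))
  smooth_p := hγ.smooth_p.comp (contDiff_snd (E := ℝ))
  smooth_rho := hγ.smooth_rho.comp (contDiff_snd (E := ℝ))
  smooth_chi := hγ.smooth_chi.comp (contDiff_snd (E := ℝ))
  smooth_S := hγ.smooth_S.comp (contDiff_snd (E := ℝ))

/-- If the variation starts at a curve of configurations with invertible `∇^S h`, then all points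
with `ε = 0` are regular. -/
theorem SmoothFamily.mem_regular_of_base {t₁ t₂ : ℝ} {γ : ℝ → Fields} {Γ : ℝ → ℝ → Fields}
    (hΓ : SmoothFamily Γ) (hγ : IsSmoothCurve t₁ t₂ γ)
    (hdet : ∀ t ∈ Icc t₁ t₂, ∀ x θ, IsUnit (jacS (γ t).S (γ t).h x θ))
    (hbase : ∀ t ∈ Icc t₁ t₂, Γ 0 t = γ t) :
    ∀ t ∈ Icc t₁ t₂, ∀ y, (0, t, y) ∈ hΓ.regular := by
  rintro t ht ⟨x, θ⟩
  rw [hΓ.mem_regular_iff, hbase t ht]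
  exact ⟨(hγ.config t ht).rho_pos x θ, hdet t ht x θ⟩

theorem SmoothFamily.continuousOn_rep_slice {Γ : ℝ → ℝ → Fields} (hΓ : SmoothFamily Γ) {t₁ t₂ : ℝ}
    (hreg : ∀ t ∈ Icc t₁ t₂, ∀ y, (0, t, y) ∈ hΓ.regular) (f : SmoothFun hΓ.regular) :
    ContinuousOn (fun z => SmoothFun.rep f (0, z)) (domain t₁ t₂) :=
  (SmoothFun.contDiffOn_rep f).continuousOn.comp (by fun_prop) fun z hz => hreg z.1 hz.1 z.2

theorem SmoothFamily.setIntegral_eq_zero_of_mem_vanishing {Γ : ℝ → ℝ → Fields}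
    (hΓ : SmoothFamily Γ) {t₁ t₂ : ℝ} (hreg : ∀ t ∈ Icc t₁ t₂, ∀ y, (0, t, y) ∈ hΓ.regular)
    {f : SmoothFun hΓ.regular} (hf : f ∈ hΓ.vanishing t₁ t₂) :
    ∫ z in domain t₁ t₂, SmoothFun.rep f (0, z) = 0 := by
  rw [setIntegral_domain (hΓ.continuousOn_rep_slice hreg f)]
  refine setIntegral_Icc_eq_zero fun t ht => ?_
  have h : ∀ x θ, SmoothFun.rep f (0, t, x, θ) = 0 := fun x θ =>
    (SmoothFun.rep_eq_ev f ⟨_, hreg t (Ioo_subset_Icc_self ht) (x, θ)⟩).trans (hf _ _ ht)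
  simp only [h, integral_zero]

theorem isCriticalPoint_of_solvesExtended {H : Vec3 → ℝ → Vec3 → ℝ}
    (hH : ContDiffOn ℝ ∞ (fun z : Vec3 × ℝ × Vec3 => H z.1 z.2.1 z.2.2) posDensity)
    {t₁ t₂ : ℝ} (ht : t₁ < t₂) {γ : ℝ → Fields} (hγ : IsSmoothCurve t₁ t₂ γ)
    (hdet : ∀ t ∈ Icc t₁ t₂, ∀ x θ, IsUnit (jacS (γ t).S (γ t).h x θ))
    (h : SolvesExtended H t₁ t₂ γ) : IsCriticalPoint H t₁ t₂ γ := by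
  intro Γ hV
  have hΔ := hγ.smoothFamily
  have hregΔ := hΔ.mem_regular_of_base hγ hdet fun _ _ => rfl
  have hΓ := hV.smoothFamily
  have hreg := hΓ.mem_regular_of_base hγ hdet hV.base
  obtain ⟨s1, s2, s3, s4⟩ := (hΔ.solvesExtended_iff hH ht hregΔ).1 h
  have h0 : ∀ t ∈ Ioo t₁ t₂, Γ 0 t = (fun _ : ℝ => γ) 0 t := fun t htt =>
    hV.base t (Ioo_subset_Icc_self htt)
  have transfer : ∀ {f : SmoothFun hΓ.regular} {g : SmoothFun hΔ.regular},
      SmoothFamily.Agree hΓ hΔ (Ioo t₁ t₂) f g → g ∈ hΔ.vanishing t₁ t₂ →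
        f ∈ hΓ.vanishing t₁ t₂ := fun hfg hg z hz htz => by
    have hz' := hregΔ z.1 (Ioo_subset_Icc_self htz) z.2
    rw [hfg z hz hz' htz, hg z hz' htz]
  have hfv : hΓ.firstVariation hH ∈ hΓ.vanishing t₁ t₂ := by
    refine add_mem (add_mem (add_mem (sum_mem fun k _ => ?_) ?_) ?_) (sum_mem fun k _ => ?_)
    · exact Ideal.mul_mem_right _ _
        (transfer (SmoothFamily.agree_resP isOpen_Ioo h0 hH k) (s1 k))
    · exact Ideal.mul_mem_right _ _ (transfer (SmoothFamily.agree_resRho isOpen_Ioo h0 hH) s2)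
    · exact Ideal.mul_mem_right _ _ (transfer (SmoothFamily.agree_resChi isOpen_Ioo h0 hH) s3)
    · exact Ideal.mul_mem_right _ _
        (transfer (SmoothFamily.agree_resH isOpen_Ioo h0 hH k) (s4 k))
  have hder := hΓ.hasDerivAt_action hH ht.le hV.onTorus
    (fun ε => (hV.left_end ε).trans (hV.left_end 0).symm)
    (fun ε => (hV.right_end ε).trans (hV.right_end 0).symm) hreg
  rwa [hΓ.setIntegral_eq_zero_of_mem_vanishing hreg hfv, mul_zero] at hder

/-! ### Critical points are solutions -/

/-- The variation of a curve by `ε` times given variations of `h`, `p`, `ρ` and `χ`. -/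
def perturb (γ : ℝ → Fields) (δh δp : Fin 3 → STL → ℝ) (δρ δχ : STL → ℝ) (ε t : ℝ) : Fields where
  h x θ := (γ t).h x θ + fun j => ε * δh j (t, x, θ)
  p x θ := (γ t).p x θ + fun j => ε * δp j (t, x, θ)
  rho x θ := (γ t).rho x θ + ε * δρ (t, x, θ)
  chi x θ := (γ t).chi x θ + ε * δχ (t, x, θ)
  S := (γ t).S

theorem perturb_zero (γ : ℝ → Fields) (δh δp : Fin 3 → STL → ℝ) (δρ δχ : STL → ℝ) (t : ℝ) :
    perturb γ δh δp δρ δχ 0 t = γ t := by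
  simp only [perturb, zero_mul, add_zero]
  congr 1 <;> (funext x θ; exact add_zero _)

/-- A smooth function which is periodic in `x` and `θ` for times in `[t₁, t₂]` and vanishes at the
initial and final times. -/
structure IsTestFunction (t₁ t₂ : ℝ) (f : STL → ℝ) : Prop where
  smooth : ContDiff ℝ ∞ f
  periodic : ∀ t ∈ Icc t₁ t₂, ∀ x θ (k : Fin 3 → ℤ) (m : ℤ),
    f (t, x + lat k, θ + 2 * Real.pi * m) = f (t, x, θ)
  left : ∀ y, f (t₁, y) = 0
  right : ∀ y, f (t₂, y) = 0

theorem IsSmoothCurve.isVariation_perturb {t₁ t₂ : ℝ} {γ : ℝ → Fields}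
    (hγ : IsSmoothCurve t₁ t₂ γ) {δh δp : Fin 3 → STL → ℝ} {δρ δχ : STL → ℝ}
    (hh : ∀ j, IsTestFunction t₁ t₂ (δh j)) (hp : ∀ j, IsTestFunction t₁ t₂ (δp j))
    (hρ : IsTestFunction t₁ t₂ δρ) (hχ : IsTestFunction t₁ t₂ δχ) :
    IsVariation t₁ t₂ γ (perturb γ δh δp δρ δχ) where
  smooth_h := (hγ.smooth_h.comp (contDiff_snd (E := ℝ))).add (contDiff_pi.2 fun j =>
    contDiff_fst.mul ((hh j).smooth.comp (contDiff_snd (E := ℝ))))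
  smooth_p := (hγ.smooth_p.comp (contDiff_snd (E := ℝ))).add (contDiff_pi.2 fun j =>
    contDiff_fst.mul ((hp j).smooth.comp (contDiff_snd (E := ℝ))))
  smooth_rho := (hγ.smooth_rho.comp (contDiff_snd (E := ℝ))).add
    (contDiff_fst.mul (hρ.smooth.comp (contDiff_snd (E := ℝ))))
  smooth_chi := (hγ.smooth_chi.comp (contDiff_snd (E := ℝ))).add
    (contDiff_fst.mul (hχ.smooth.comp (contDiff_snd (E := ℝ))))
  smooth_S := hγ.smooth_S.comp (contDiff_snd (E := ℝ))
  onTorus ε t ht := by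
    have hc := (hγ.config t ht).onTorus
    refine ⟨fun x θ k m => ?_, fun x θ k m => ?_, fun x θ k m => ?_, fun x θ k m => ?_, hc.S⟩
    · obtain ⟨n, hn⟩ := hc.h x θ k m
      refine ⟨n, ?_⟩
      simp only [perturb, hn, fun j => (hh j).periodic t ht]
      exact add_right_comm _ _ _
    · simp only [perturb, hc.p, fun j => (hp j).periodic t ht]
    · simp only [perturb, hc.rho, hρ.periodic t ht]
    · simp only [perturb, hc.chi, hχ.periodic t ht]
  base t _ := perturb_zero γ δh δp δρ δχ t
  left_end ε := by
    simp only [perturb, hρ.left, hχ.left, fun j => (hh j).left, fun j => (hp j).left, mul_zero,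
      add_zero]
    congr 1 <;> (funext x θ; exact add_zero _)
  right_end ε := by
    simp only [perturb, hρ.right, hχ.right, fun j => (hh j).right, fun j => (hp j).right, mul_zero,
      add_zero]
    congr 1 <;> (funext x θ; exact add_zero _)

namespace SmoothFamily

variable {Γ : ℝ → ℝ → Fields} (hΓ : SmoothFamily Γ)

/-- A smooth function on the regular set, at `ε = 0`, multiplied by a function of time. -/
noncomputable def cutoff (β : ℝ → ℝ) (f : SmoothFun hΓ.regular) (z : STL) : ℝ :=
  β z.1 * SmoothFun.rep f (0, z)

theorem isTestFunction_cutoff {t₁ t₂ : ℝ} (hreg : ∀ t ∈ Icc t₁ t₂, ∀ y, (0, t, y) ∈ hΓ.regular)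
    {β : ℝ → ℝ} (hβ : ContDiff ℝ ∞ β) (hs : tsupport β ⊆ Ioo t₁ t₂) {f : SmoothFun hΓ.regular}
    (hf : ∀ k m, f ∈ hΓ.periodic t₁ t₂ (shift k m)) :
    IsTestFunction t₁ t₂ (hΓ.cutoff β f) := by
  have hβ0 : ∀ t, t ∉ Ioo t₁ t₂ → β t = 0 := fun t ht =>
    image_eq_zero_of_notMem_tsupport fun h => ht (hs h)
  refine ⟨contDiff_iff_contDiffAt.2 fun z => ?_, fun t ht x θ k m => ?_, fun y => ?_, fun y => ?_⟩
  · by_cases hz : z.1 ∈ tsupport β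
    · have h1 : ContDiffAt ℝ ∞ (fun z : STL => SmoothFun.rep f (0, z)) z :=
        (SmoothFun.contDiffAt_rep f ⟨_, hreg z.1 (Ioo_subset_Icc_self (hs hz)) z.2⟩).comp z
          (by fun_prop : ContDiff ℝ ∞ fun z : STL => ((0 : ℝ), z)).contDiffAt
      exact (hβ.comp contDiff_fst).contDiffAt.mul h1
    · have h1 : ∀ᶠ y : STL in 𝓝 z, β y.1 = 0 :=
        continuous_fst.continuousAt (notMem_tsupport_iff_eventuallyEq.1 hz)
      exact (contDiffAt_const (c := (0 : ℝ))).congr_of_eventuallyEq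
        (h1.mono fun y hy => by simp [cutoff, hy])
  · by_cases hto : t ∈ Ioo t₁ t₂
    · simp only [cutoff]
      rw [SmoothFun.rep_eq_ev f ⟨_, hreg t ht (x, θ)⟩, SmoothFun.rep_eq_ev f ⟨_, hreg t ht _⟩,
        hf k m ⟨(0, t, x, θ), hreg t ht (x, θ)⟩ _ hto (by simp [shift])]
    · simp [cutoff, hβ0 t hto]
  · simp [cutoff, hβ0 t₁ left_notMem_Ioo]
  · simp [cutoff, hβ0 t₂ right_notMem_Ioo]

variable {G : Vec3 × ℝ × Vec3 → ℝ} (hG : ContDiffOn ℝ ∞ G posDensity)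

section Periodic

variable {t₁ t₂ : ℝ} (hT : ∀ ε, ∀ t ∈ Icc t₁ t₂, (Γ ε t).OnTorus) (k : Fin 3 → ℤ) (m : ℤ)
include hT

theorem resP_mem_periodic (i : Fin 3) :
    (hΓ.data hG).resP i ∈ hΓ.periodic t₁ t₂ (shift k m) :=
  sub_mem (hΓ.disp_mem_periodic hT k m _ i)
    (hΓ.comp_mem_periodic hT k m (contDiffOn_fderiv_posDensity hG _))

theorem resRho_mem_periodic : (hΓ.data hG).resRho ∈ hΓ.periodic t₁ t₂ (shift k m) :=
  add_mem (sub_mem (add_mem (hΓ.dd_mem_periodic hT k m _ (hΓ.elChi_mem_periodic hT k m))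
    (sum_mem fun i _ => mul_mem (hΓ.disp_mem_periodic hT k m _ i)
      (hΓ.dd_mem_periodic hT k m _ (hΓ.elChi_mem_periodic hT k m))))
    (hΓ.comp_mem_periodic hT k m (contDiffOn_fderiv_posDensity hG _)))
    (sum_mem fun _ _ => hΓ.dd_mem_periodic hT k m _
      (hΓ.comp_mem_periodic hT k m (contDiffOn_fderiv_posDensity hG _)))

theorem resChi_mem_periodic : (hΓ.data hG).resChi ∈ hΓ.periodic t₁ t₂ (shift k m) :=
  neg_mem (add_mem (hΓ.dd_mem_periodic hT k m _ (hΓ.elRho_mem_periodic hT k m))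
    (sum_mem fun i _ => hΓ.dd_mem_periodic hT k m _ (mul_mem (hΓ.elRho_mem_periodic hT k m)
      (hΓ.disp_mem_periodic hT k m _ i))))

theorem resH_mem_periodic (i : Fin 3) :
    (hΓ.data hG).resH i ∈ hΓ.periodic t₁ t₂ (shift k m) :=
  neg_mem (add_mem (add_mem (hΓ.dd_mem_periodic hT k m _ (hΓ.mom_mem_periodic hG hT k m i))
    (sum_mem fun j _ => hΓ.dd_mem_periodic hT k m _ (mul_mem (hΓ.disp_mem_periodic hT k m _ j)
      (hΓ.mom_mem_periodic hG hT k m i))))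
    (sum_mem fun j _ => mul_mem (hΓ.mom_mem_periodic hG hT k m j)
      (hΓ.dd_mem_periodic hT k m _ (hΓ.disp_mem_periodic hT k m _ j))))

end Periodic

/-- The variation of the labels whose displacement is the variational derivative itself. -/
noncomputable def testH (j : Fin 3) : SmoothFun hΓ.regular :=
  -∑ k, (hΓ.data hG).resH k * hΓ.dd (eSpace k) (hΓ.elH j)

/-- The sum of the squares of the variational derivatives. -/
noncomputable def resSq : SmoothFun hΓ.regular :=
  ∑ k, (hΓ.data hG).resP k ^ 2 + (hΓ.data hG).resRho ^ 2 + (hΓ.data hG).resChi ^ 2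
    + ∑ k, (hΓ.data hG).resH k ^ 2

theorem ev_resSq_nonneg (u : hΓ.regular) : 0 ≤ SmoothFun.ev u (hΓ.resSq hG) := by
  simp only [resSq, map_add, map_sum, map_pow]
  positivity

theorem resSq_mem_periodic {t₁ t₂ : ℝ} (hT : ∀ ε, ∀ t ∈ Icc t₁ t₂, (Γ ε t).OnTorus)
    (k : Fin 3 → ℤ) (m : ℤ) : hΓ.resSq hG ∈ hΓ.periodic t₁ t₂ (shift k m) :=
  add_mem (add_mem (add_mem
    (sum_mem fun i _ => pow_mem (hΓ.resP_mem_periodic hG hT k m i) 2)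
    (pow_mem (hΓ.resRho_mem_periodic hG hT k m) 2))
    (pow_mem (hΓ.resChi_mem_periodic hG hT k m) 2))
    (sum_mem fun i _ => pow_mem (hΓ.resH_mem_periodic hG hT k m i) 2)

theorem stationary_of_resSq {t₁ t₂ : ℝ} (h : hΓ.resSq hG ∈ hΓ.vanishing t₁ t₂) :
    hΓ.Stationary t₁ t₂ hG := by
  have key : ∀ (z : STL) (hz : (0, z) ∈ hΓ.regular), z.1 ∈ Ioo t₁ t₂ →
      (∀ k, SmoothFun.ev ⟨_, hz⟩ ((hΓ.data hG).resP k) = 0)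
      ∧ SmoothFun.ev ⟨_, hz⟩ (hΓ.data hG).resRho = 0 ∧ SmoothFun.ev ⟨_, hz⟩ (hΓ.data hG).resChi = 0
      ∧ ∀ k, SmoothFun.ev ⟨_, hz⟩ ((hΓ.data hG).resH k) = 0 := by
    intro z hz ht
    have h0 := h z hz ht
    simp only [resSq, map_add, map_sum, map_pow] at h0
    have hs : ∀ f : Fin 3 → ℝ, 0 ≤ ∑ k, f k ^ 2 := fun f => by positivity
    rw [add_eq_zero_iff_of_nonneg (add_nonneg (add_nonneg (hs _) (sq_nonneg _)) (sq_nonneg _))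
      (hs _), add_eq_zero_iff_of_nonneg (add_nonneg (hs _) (sq_nonneg _)) (sq_nonneg _),
      add_eq_zero_iff_of_nonneg (hs _) (sq_nonneg _),
      Finset.sum_eq_zero_iff_of_nonneg (fun _ _ => sq_nonneg _),
      Finset.sum_eq_zero_iff_of_nonneg (fun _ _ => sq_nonneg _)] at h0
    obtain ⟨⟨⟨h1, h2⟩, h3⟩, h4⟩ := h0
    exact ⟨fun k => pow_eq_zero_iff two_ne_zero |>.1 (h1 k (Finset.mem_univ k)),
      pow_eq_zero_iff two_ne_zero |>.1 h2, pow_eq_zero_iff two_ne_zero |>.1 h3,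
      fun k => pow_eq_zero_iff two_ne_zero |>.1 (h4 k (Finset.mem_univ k))⟩
  exact ⟨fun k z hz ht => (key z hz ht).1 k, fun z hz ht => (key z hz ht).2.1,
    fun z hz ht => (key z hz ht).2.2.1, fun k z hz ht => (key z hz ht).2.2.2 k⟩

end SmoothFamily

/-- Every point of `ℝ³ × ℝ` is a translate by periods of a point of the fundamental domain. -/
theorem exists_shift (x : Vec3) (θ : ℝ) : ∃ x₀ ∈ cell, ∃ θ₀ ∈ Icc 0 (2 * Real.pi),
    ∃ (k : Fin 3 → ℤ) (m : ℤ), x = x₀ + lat k ∧ θ = θ₀ + 2 * Real.pi * m := by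
  have key : ∀ s : ℝ, s - 2 * Real.pi * (⌊s / (2 * Real.pi)⌋ : ℝ) ∈ Icc 0 (2 * Real.pi) := by
    intro s
    have hp := Real.two_pi_pos
    have h1 := Int.floor_le (s / (2 * Real.pi))
    have h2 := (Int.lt_floor_add_one (s / (2 * Real.pi))).le
    rw [le_div_iff₀ hp] at h1
    rw [div_le_iff₀ hp] at h2
    constructor <;> linarith
  refine ⟨fun i => x i - 2 * Real.pi * (⌊x i / (2 * Real.pi)⌋ : ℝ),
    ⟨fun i => (key (x i)).1, fun i => (key (x i)).2⟩, _, key θ,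
    fun i => ⌊x i / (2 * Real.pi)⌋, ⌊θ / (2 * Real.pi)⌋, ?_, by ring⟩
  funext i
  simp [lat]

theorem sum_mul_self_eq (b c d : ℝ) (f g : Fin 3 → ℝ) :
    ∑ k, f k * (b * f k) + c * (b * c) + d * (b * d) + ∑ k, g k * (b * g k)
      = b * (∑ k, f k ^ 2 + c ^ 2 + d ^ 2 + ∑ k, g k ^ 2) := by
  simp only [Fin.sum_univ_three]
  ring

namespace SmoothFamily

/-- The variation by the variational derivatives themselves, multiplied by a function of time. -/
noncomputable def testVariation {γ : ℝ → Fields} (hΔ : SmoothFamily fun _ => γ)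
    {G : Vec3 × ℝ × Vec3 → ℝ} (hG : ContDiffOn ℝ ∞ G posDensity) (β : ℝ → ℝ) : ℝ → ℝ → Fields :=
  perturb γ (fun j => hΔ.cutoff β (hΔ.testH hG j)) (fun k => hΔ.cutoff β ((hΔ.data hG).resP k))
    (hΔ.cutoff β (hΔ.data hG).resRho) (hΔ.cutoff β (hΔ.data hG).resChi)

/-- For this variation, the integrand of the first variation is a sum of squares. -/
theorem ev_firstVariation_testVariation {γ : ℝ → Fields} (hΔ : SmoothFamily fun _ => γ)
    {G : Vec3 × ℝ × Vec3 → ℝ} (hG : ContDiffOn ℝ ∞ G posDensity) (β : ℝ → ℝ)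
    (hΓ : SmoothFamily (hΔ.testVariation hG β)) {z : STL} (hzΓ : (0, z) ∈ hΓ.regular)
    (hzΔ : (0, z) ∈ hΔ.regular) : SmoothFun.ev ⟨_, hzΓ⟩ (hΓ.firstVariation hG)
      = β z.1 * SmoothFun.ev ⟨_, hzΔ⟩ (hΔ.resSq hG) := by
  have h0 : ∀ t ∈ univ, hΔ.testVariation hG β 0 t = (fun _ : ℝ => γ) 0 t := fun t _ =>
    perturb_zero _ _ _ _ _ t
  have hcut : ∀ f, hΔ.cutoff β f z = β z.1 * SmoothFun.ev ⟨(0, z), hzΔ⟩ f := fun f => by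
    rw [← SmoothFun.rep_eq_ev]; rfl
  have hS := hΓ.differentiableAt_fS (0, z)
  have e1 : ∀ k, SmoothFun.ev ⟨(0, z), hzΓ⟩ (hΓ.dd eEps ((hΓ.data hG).p k)) = hΔ.cutoff β ((hΔ.data hG).resP k) z := fun k =>
    (hΓ.ev_dd_el _ (hΓ.contDiff_fP k) ⟨_, hzΓ⟩).trans
      (fderiv_lift_eEps (F₀ := fun z => (γ z.1).p z.2.1 z.2.2 k) hS (fun _ => rfl)
        ((hΓ.contDiff_fP k).differentiable (by simp) _) fun _ => rfl)
  have e2 : SmoothFun.ev ⟨(0, z), hzΓ⟩ (hΓ.dd eEps (hΓ.data hG).rho) = hΔ.cutoff β (hΔ.data hG).resRho z :=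
    (hΓ.ev_dd_el _ hΓ.contDiff_fRho ⟨_, hzΓ⟩).trans
      (fderiv_lift_eEps (F₀ := fun z => (γ z.1).rho z.2.1 z.2.2) hS (fun _ => rfl)
        (hΓ.contDiff_fRho.differentiable (by simp) _) fun _ => rfl)
  have e3 : SmoothFun.ev ⟨(0, z), hzΓ⟩ (hΓ.dd eEps (hΓ.data hG).chi) = hΔ.cutoff β (hΔ.data hG).resChi z :=
    (hΓ.ev_dd_el _ hΓ.contDiff_fChi ⟨_, hzΓ⟩).trans
      (fderiv_lift_eEps (F₀ := fun z => (γ z.1).chi z.2.1 z.2.2) hS (fun _ => rfl)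
        (hΓ.contDiff_fChi.differentiable (by simp) _) fun _ => rfl)
  have e4 : ∀ j, SmoothFun.ev ⟨(0, z), hzΓ⟩ (hΓ.dd eEps (hΓ.elH j)) = hΔ.cutoff β (hΔ.testH hG j) z := fun j =>
    (hΓ.ev_dd_el _ (hΓ.contDiff_fH j) ⟨_, hzΓ⟩).trans
      (fderiv_lift_eEps (F₀ := fun z => (γ z.1).h z.2.1 z.2.2 j) hS (fun _ => rfl)
        ((hΓ.contDiff_fH j).differentiable (by simp) _) fun _ => rfl)
  have hJ := jac_slice isOpen_univ h0 hΓ hΔ (mem_univ z.1)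
  have e5 : ∀ k, SmoothFun.ev ⟨(0, z), hzΓ⟩ (hΓ.disp (hΓ.dd eEps) k)
      = β z.1 * SmoothFun.ev ⟨(0, z), hzΔ⟩ ((hΔ.data hG).resH k) := by
    intro k
    have hv : (fun j => hΔ.cutoff β (hΔ.testH hG j) z) = -Matrix.vecMul (fun k => β z.1 *
        SmoothFun.ev ⟨(0, z), hzΔ⟩ ((hΔ.data hG).resH k)) (jac (fun _ => γ) (0, z)) := by
      funext j
      rw [hcut, ← hΔ.map_jacMatrix ⟨_, hzΔ⟩]
      simp only [testH, map_neg, map_sum, map_mul, mul_neg, Finset.mul_sum,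
        ← mul_assoc]
      rfl
    rw [hΓ.ev_disp, funext e4, hv, hJ, Matrix.neg_vecMul, Matrix.vecMul_vecMul,
      Matrix.mul_nonsing_inv _ (isUnit_iff_ne_zero.2 hzΔ.2), Matrix.vecMul_one]
    simp
  have a1 := fun k => agree_resP (hΓ := hΓ) (hΔ := hΔ) isOpen_univ h0 hG k z hzΓ hzΔ
    (mem_univ _)
  have a2 := agree_resRho (hΓ := hΓ) (hΔ := hΔ) isOpen_univ h0 hG z hzΓ hzΔ
    (mem_univ _)
  have a3 := agree_resChi (hΓ := hΓ) (hΔ := hΔ) isOpen_univ h0 hG z hzΓ hzΔ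
    (mem_univ _)
  have a4 := fun k => agree_resH (hΓ := hΓ) (hΔ := hΔ) isOpen_univ h0 hG k z hzΓ hzΔ
    (mem_univ _)
  simp only [firstVariation, resSq, map_add, map_sum, map_mul, map_pow, e1, e2, e3, e5, a1, a2, a3,
    a4, hcut]
  exact sum_mul_self_eq _ _ _ _ _

end SmoothFamily

theorem solvesExtended_of_isCriticalPoint {H : Vec3 → ℝ → Vec3 → ℝ}
    (hH : ContDiffOn ℝ ∞ (fun z : Vec3 × ℝ × Vec3 => H z.1 z.2.1 z.2.2) posDensity)
    {t₁ t₂ : ℝ} (ht : t₁ < t₂) {γ : ℝ → Fields} (hγ : IsSmoothCurve t₁ t₂ γ)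
    (hdet : ∀ t ∈ Icc t₁ t₂, ∀ x θ, IsUnit (jacS (γ t).S (γ t).h x θ))
    (h : IsCriticalPoint H t₁ t₂ γ) : SolvesExtended H t₁ t₂ γ := by
  have hΔ := hγ.smoothFamily
  have hregΔ := hΔ.mem_regular_of_base hγ hdet fun _ _ => rfl
  have hT : ∀ ε, ∀ t ∈ Icc t₁ t₂, ((fun _ : ℝ => γ) ε t).OnTorus := fun _ t htt =>
    (hγ.config t htt).onTorus
  refine (hΔ.solvesExtended_iff hH ht hregΔ).2 (hΔ.stationary_of_resSq hH ?_)
  rintro ⟨t₀, x, θ⟩ hz (ht₀ : t₀ ∈ Ioo t₁ t₂)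
  obtain ⟨β, hβs, -, hβ, hβr, hβ1⟩ := exists_contDiff_tsupport_subset (n := ⊤)
    (Ioo_mem_nhds ht₀.1 ht₀.2)
  have hV : IsVariation t₁ t₂ γ (hΔ.testVariation hH β) := hγ.isVariation_perturb
    (fun j => hΔ.isTestFunction_cutoff hregΔ hβ hβs fun k m =>
      neg_mem (sum_mem fun i _ => mul_mem (hΔ.resH_mem_periodic hH hT k m i)
        (hΔ.dd_elH_mem_periodic hT k m _ j)))
    (fun j => hΔ.isTestFunction_cutoff hregΔ hβ hβs fun k m => hΔ.resP_mem_periodic hH hT k m j)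
    (hΔ.isTestFunction_cutoff hregΔ hβ hβs fun k m => hΔ.resRho_mem_periodic hH hT k m)
    (hΔ.isTestFunction_cutoff hregΔ hβ hβs fun k m => hΔ.resChi_mem_periodic hH hT k m)
  have hΓ := hV.smoothFamily
  have hreg := hΓ.mem_regular_of_base hγ hdet hV.base
  have hder := (h _ hV).unique (hΓ.hasDerivAt_action hH ht.le hV.onTorus
    (fun ε => (hV.left_end ε).trans (hV.left_end 0).symm)
    (fun ε => (hV.right_end ε).trans (hV.right_end 0).symm) hreg)
  have hint := (mul_eq_zero.1 hder.symm).resolve_left (inv_ne_zero Real.two_pi_pos.ne')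
  have hsq : ∀ z ∈ domain t₁ t₂, SmoothFun.rep (hΓ.firstVariation hH) (0, z)
      = β z.1 * SmoothFun.rep (hΔ.resSq hH) (0, z) := fun z hz => by
    rw [SmoothFun.rep_eq_ev _ ⟨_, hreg z.1 hz.1 z.2⟩, SmoothFun.rep_eq_ev _ ⟨_, hregΔ z.1 hz.1 z.2⟩]
    exact hΔ.ev_firstVariation_testVariation hH β hΓ _ _
  have hK := (isCompact_domain t₁ t₂).measurableSet
  rw [setIntegral_congr_fun hK hsq] at hint
  have hzero := eq_zero_of_setIntegral_domain_eq_zero ht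
    ((hβ.continuous.comp continuous_fst).continuousOn.mul (hΔ.continuousOn_rep_slice hregΔ _))
    (fun z hz => mul_nonneg (hβr (mem_range_self z.1)).1 (by
      change 0 ≤ SmoothFun.rep (hΔ.resSq hH) (0, z)
      rw [SmoothFun.rep_eq_ev _ ⟨_, hregΔ z.1 hz.1 z.2⟩]
      exact hΔ.ev_resSq_nonneg hH _)) hint
  obtain ⟨x₀, hx₀, θ₀, hθ₀, k, m, rfl, rfl⟩ := exists_shift x θ
  have hI := Ioo_subset_Icc_self ht₀
  rw [hΔ.resSq_mem_periodic hH hT k m ⟨_, hregΔ t₀ hI (x₀, θ₀)⟩ _ ht₀ (by simp [shift]),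
    ← SmoothFun.rep_eq_ev]
  have := hzero (t₀, x₀, θ₀) ⟨hI, hx₀, hθ₀⟩
  simpa [hβ1] using this

end ExtLBEP

theorem theorem3 (L : ExtLBEP.Vec3 → ℝ → ExtLBEP.Vec3 → ℝ) (hL : ExtLBEP.IsEPLagrangian L)
    (t₁ t₂ : ℝ) (ht : t₁ < t₂) (γ : ℝ → ExtLBEP.Fields) (hγ : ExtLBEP.IsSmoothCurve t₁ t₂ γ)
    (hdet : ∀ t ∈ Set.Icc t₁ t₂, ∀ x θ, IsUnit (ExtLBEP.jacS (γ t).S (γ t).h x θ)) :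
    ExtLBEP.IsCriticalPoint (ExtLBEP.hamiltonian L) t₁ t₂ γ ↔
      ExtLBEP.SolvesExtended (ExtLBEP.hamiltonian L) t₁ t₂ γ :=
  ⟨ExtLBEP.solvesExtended_of_isCriticalPoint hL.contDiffOn_hamiltonian ht hγ hdet,
    ExtLBEP.isCriticalPoint_of_solvesExtended hL.contDiffOn_hamiltonian ht hγ hdet⟩
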